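/- Let $m,n$ be relatively prime positive integers and let $(\alpha_1,\alpha_2)\in\mathbb{C}^2\setminus\{(0,0)\}$ satisfy $m\alpha_1+n\alpha_2=0$ (for instance $(\alpha_1,\alpha_2)=(-n,m)$). **Configurations.** Consider the unit square lattice in $\mathbb{R}^2$ whose faces have midpoints $\mathbb{Z}^2$. Let $E_1=\mathbb{Z}^2+(\tfrac12,0)$ and $E_2=\mathbb{Z}^2+(0,\tfrac12)$ be the midpoints of the vertical and horizontal edges. Let $\mathscr{L}:E_1\cup E_2\to\mathbb{Z}_{\ge0}$ be an $(m,n)$-periodic higher spin vertex configuration: $\mathscr{L}(e+(m,n))=\mathscr{L}(e)$; $\mathscr{L}(e+k(-n,m))=0$ for $|k|\gg0$; and at every vertex the labels of the left and lower edges have the same sum as the labels of the right and upper edges. It is a *five-vertex configuration* if at every vertex at most two of the four incident edges have non-zero label. **Algebras.** Put $P_i(u)=\prod (u-(x_1\alpha_1+x_2\alpha_2))^{\mathscr{L}(x_1,x_2)}$, the product over $(x_1,x_2)\in E_i$ modulo $\mathbb{Z}(m,n)$. Let $\tilde{\mathcal A}$ be the $\mathbb{C}$-algebra generated by $H,X_1^\pm,X_2^\pm$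 with relations $HX_i^\pm-X_i^\pm H=\pm\alpha_iX_i^\pm$, $X_i^\pm X_i^\mp=P_i(H\mp\tfrac{\alpha_i}{2})$, and $X_i^+X_j^-=X_j^-X_i^+$ for $i\ne j$. Let $\mathcal A(\mathscr{L})$ be the quotient of $\tilde{\mathcal A}$ by the ideal of all $a$ with $f(H)a=0$ for some nonzero polynomial $f$, and let $\mathcal A(\mathscr{L})_{\mathrm{loc}}=\mathcal A(\mathscr{L})\otimes_{\mathbb{C}[H]}\mathbb{C}(H)$ be its (Ore) localization at the nonzero polynomials in $H$. Let $\mathcal C$ be the centralizer of $H$ in $\mathcal A(\mathscr{L})$, let $F=\mathbb{Z}\alpha_1+\mathbb{Z}\alpha_2$, and for $\lambda\in F$ let $\mathcal C_\lambda=\mathcal C/(H-\lambda)$. **Paths.** For $\lambda=x_1\alpha_1+x_2\alpha_2\in F$ and a sequence $\underline i=i_1\cdots i_\ell$ in $\{1,2\}$, consider the path in $\mathbb{R}^2$ from $(x_1,x_2)$ with successive steps $\mathbf e_{i_1},\dots,\mathbf e_{i_\ell}$. Define $\mathrm{ord}(\underline i,\lambda)=\max(v,h)$, where $v$ (respectively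 $h$) is the number of vertical (respectively horizontal) edges it crosses, each edge $e$ counted with multiplicity $\mathscr{L}(e)$. Put $X(\underline i)=X_{i_\ell}^+\cdots X_{i_1}^+$. For a sequence $\underline i$ consisting of $k$ ones and $l$ twos in any order put $$C_{k,l}=X(\underline i)\prod_{\lambda\in F}(H-\lambda)^{-\mathrm{ord}(\underline i,\lambda)}\in\mathcal A(\mathscr{L})_{\mathrm{loc}}.$$ **Cylinder.** Let $\mathbb{T}=\mathbb{R}^2/\mathbb{Z}(m,n)$, let $\overline{\mathscr{L}}\subset\mathbb{T}$ be the image of the union of the closed edges with non-zero label, and let $\bar\lambda\in\mathbb{T}$ be the class of $(x_1,x_2)$ for $\lambda=x_1\alpha_1+x_2\alpha_2$. Then: (a) For all $k,l\ge0$, $C_{k,l}$ does not depend on the choice of $\underline i$. (b) $C=C_{m,n}$ belongs to the center of $\mathcal A(\mathscr{L})_{\mathrm{loc}}$; in particular it commutes with $\mathcal A(\mathscr{L})$. (c) Let $\lambda\in F$ be such that the connected component of $\mathbb{T}\setminus\overline{\mathscr{L}}$ containing $\bar\lambda$ is not contractible. Then $C$ can be written as $a\,f(H)^{-1}$ with $a\in\mathcal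 C$ and $f\in\mathbb{C}[u]$, $f(\lambda)\neq0$; its image $c=f(\lambda)^{-1}\,\overline{a}\in\mathcal C_\lambda$ is the same for every such expression; $c$ is invertible; and $\mathcal C_\lambda$ is generated as a $\mathbb{C}$-algebra by $c$ and $c^{-1}$. Moreover $\mathcal C_\lambda$ is the Laurent polynomial algebra in $c$. (d) $C$ belongs to (the image of) $\mathcal A(\mathscr{L})$ if and only if $\mathscr{L}$ is a five-vertex configuration; likewise, $C$ belongs to the center of $\mathcal A(\mathscr{L})$ if and only if $\mathscr{L}$ is a five-vertex configuration. -/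

import Mathlib

open Polynomial

noncomputable section

namespace KleinianFiber

/-! ### Shift relations and the Ore condition in an algebra generated by weight vectors -/

section Ore

variable {B : Type*} [Ring B] [Algebra ℂ B]

theorem shift_aeval {h x : B} {c : ℂ} (hx : h * x - x * h = c • x) (f : ℂ[X]) :
    x * aeval h f = aeval h (taylor (-c) f) * x := by
  have h1 : x * h = (h - algebraMap ℂ B c) * x := by
    rw [sub_mul, ← Algebra.smul_def, ← hx]; abel
  induction f using Polynomial.induction_on' with
  | add p q hp hq => simp only [map_add, mul_add, add_mul, hp, hq]
  | monomial n a =>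
    rw [← C_mul_X_pow_eq_monomial, taylor_mul, taylor_C, taylor_pow, taylor_X]
    simp only [map_mul, map_pow, aeval_C, aeval_X, map_sub, map_neg, ← sub_eq_add_neg]
    rw [← mul_assoc, ← Algebra.commutes a x, mul_assoc, mul_assoc]
    congr 1
    exact ((show SemiconjBy x h (h - algebraMap ℂ B c) from h1).pow_right n).eq

theorem left_ore {h : B} {S : Set B} (hS : Algebra.adjoin ℂ S = ⊤)
    (hw : ∀ x ∈ S, ∃ c : ℂ, h * x - x * h = c • x) (b : B) :
    ∀ f : ℂ[X], f ≠ 0 → ∃ g : ℂ[X], g ≠ 0 ∧ ∃ b' : B, aeval h g * b = b' * aeval h f := by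
  have hb : b ∈ Algebra.adjoin ℂ S := by rw [hS]; trivial
  induction hb using Algebra.adjoin_induction with
  | mem x hx =>
    intro f hf
    obtain ⟨c, hc⟩ := hw x hx
    refine ⟨taylor (-c) f, ?_, x, (shift_aeval hc f).symm⟩
    exact fun h0 => hf (taylor_injective (-c) (by rw [h0, map_zero]))
  | algebraMap r =>
    intro f hf
    exact ⟨f, hf, algebraMap ℂ B r, (Algebra.commutes r _).symm⟩
  | add x y _ _ ihx ihy =>
    intro f hf
    obtain ⟨g₁, hg₁, b₁, h₁⟩ := ihx f hf
    obtain ⟨g₂, hg₂, b₂, h₂⟩ := ihy f hf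
    refine ⟨g₁ * g₂, mul_ne_zero hg₁ hg₂, aeval h g₂ * b₁ + aeval h g₁ * b₂, ?_⟩
    rw [mul_add, add_mul, mul_assoc _ b₁, mul_assoc _ b₂, ← h₁, ← h₂, ← mul_assoc, ← mul_assoc,
      ← map_mul, ← map_mul, mul_comm g₂ g₁]
  | mul x y _ _ ihx ihy =>
    intro f hf
    obtain ⟨g, hg, y', hy'⟩ := ihy f hf
    obtain ⟨g₁, hg₁, x', hx'⟩ := ihx g hg
    exact ⟨g₁, hg₁, x' * y', by rw [← mul_assoc, hx', mul_assoc, hy', mul_assoc]⟩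

theorem exists_ad_annihilator {h : B} {S : Set B} (hS : Algebra.adjoin ℂ S = ⊤)
    (hw : ∀ x ∈ S, ∃ c : ℂ, h * x - x * h = c • x) (a : B) :
    ∃ p : ℂ[X], p ≠ 0 ∧
      aeval (LinearMap.mulLeft ℂ h - LinearMap.mulRight ℂ h) p a = 0 := by
  set E : Set B := {x | ∃ c : ℂ, h * x - x * h = c • x} with hE
  have hEE : ∀ x ∈ E, ∀ y ∈ E, x * y ∈ E := by
    rintro x ⟨c, hc⟩ y ⟨d, hd⟩
    refine ⟨c + d, ?_⟩
    have : h * (x * y) - x * y * h = (h * x - x * h) * y + x * (h * y - y * h) := by noncomm_ring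
    rw [this, hc, hd, add_smul, smul_mul_assoc, mul_smul_comm]
  have ha : a ∈ Submodule.span ℂ E := by
    have hb : a ∈ Algebra.adjoin ℂ S := by rw [hS]; trivial
    induction hb using Algebra.adjoin_induction with
    | mem x hx => exact Submodule.subset_span (hw x hx)
    | algebraMap r =>
      refine Submodule.subset_span ⟨0, ?_⟩
      rw [zero_smul, Algebra.commutes r h, sub_self]
    | add x y _ _ ihx ihy => exact add_mem ihx ihy
    | mul x y _ _ ihx ihy =>
      have := Submodule.mul_mem_mul ihx ihy
      rw [Submodule.span_mul_span] at this
      refine Submodule.span_mono ?_ this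
      rintro _ ⟨u, hu, v, hv, rfl⟩
      exact hEE u hu v hv
  induction ha using Submodule.span_induction with
  | mem x hx =>
    obtain ⟨c, hc⟩ := hx
    refine ⟨X - C c, X_sub_C_ne_zero c, ?_⟩
    simp [hc, Algebra.algebraMap_eq_smul_one]
  | zero => exact ⟨1, one_ne_zero, map_zero _⟩
  | add x y _ _ ihx ihy =>
    obtain ⟨p, hp, hpx⟩ := ihx
    obtain ⟨q, hq, hqy⟩ := ihy
    refine ⟨p * q, mul_ne_zero hp hq, ?_⟩
    rw [map_add]
    nth_rewrite 1 [mul_comm p q]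
    rw [map_mul, map_mul, Module.End.mul_apply, Module.End.mul_apply, hpx, hqy, map_zero,
      map_zero, add_zero]
  | smul r x _ ihx =>
    obtain ⟨p, hp, hpx⟩ := ihx
    exact ⟨p, hp, by rw [map_smul, hpx, smul_zero]⟩

theorem right_torsion {h : B} {S : Set B} (hS : Algebra.adjoin ℂ S = ⊤)
    (hw : ∀ x ∈ S, ∃ c : ℂ, h * x - x * h = c • x) (f : ℂ[X]) (hf : f ≠ 0) :
    ∀ a : B, a * aeval h f = 0 → ∃ g : ℂ[X], g ≠ 0 ∧ aeval h g * a = 0 := by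
  induction hd : f.natDegree using Nat.strong_induction_on generalizing f with
  | _ d ih =>
    intro a ha
    by_cases h0 : f.natDegree = 0
    · obtain ⟨c, rfl⟩ := natDegree_eq_zero.1 h0
      have hc : c ≠ 0 := fun h => hf (by rw [h, map_zero])
      refine ⟨C c, hf, ?_⟩
      rw [aeval_C] at ha ⊢
      rw [Algebra.commutes, ha]
    · obtain ⟨c, hc⟩ := IsAlgClosed.exists_root f
        (fun hdeg => h0 (natDegree_eq_of_degree_eq_some (by rw [hdeg]; rfl)))
      obtain ⟨q, rfl⟩ := dvd_iff_isRoot.2 hc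
      have hq : q ≠ 0 := right_ne_zero_of_mul hf
      have hdeg : q.natDegree < d := by
        rw [← hd, natDegree_mul (X_sub_C_ne_zero c) hq, natDegree_X_sub_C]; omega
      rw [mul_comm, map_mul, ← mul_assoc] at ha
      -- split off one linear factor
      have key : ∀ b : B, b * aeval h (X - C c) = 0 → ∃ g : ℂ[X], g ≠ 0 ∧ aeval h g * b = 0 := by
        intro b hb
        obtain ⟨p, hp, hpb⟩ := exists_ad_annihilator hS hw b
        have hbh : b * h = c • b := by
          rw [map_sub, aeval_X, aeval_C, mul_sub, sub_eq_zero] at hb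
          rw [hb, ← Algebra.commutes, Algebra.smul_def]
        refine ⟨taylor (-c) p, fun h0 => hp (taylor_injective (-c) (by rw [h0, map_zero])), ?_⟩
        have hcomm : ∀ g : ℂ[X], (aeval h g * b) * h = c • (aeval h g * b) := by
          intro g; rw [mul_assoc, hbh, mul_smul_comm]
        have gen : ∀ r : ℂ[X], aeval (LinearMap.mulLeft ℂ h - LinearMap.mulRight ℂ h) r b
            = aeval h (taylor (-c) r) * b := by
          intro r
          induction r using Polynomial.induction_on with
          | C s => simp [Algebra.smul_def]
          | add r s hr hs => simp only [map_add, LinearMap.add_apply, add_mul, hr, hs]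
          | monomial n s hr =>
            have e : (C s * X ^ (n + 1) : ℂ[X]) = X * (C s * X ^ n) := by ring
            rw [e, map_mul, Module.End.mul_apply, hr, aeval_X, LinearMap.sub_apply,
              LinearMap.mulLeft_apply, LinearMap.mulRight_apply, hcomm, taylor_mul _ X, taylor_X,
              map_mul (aeval h), map_add, aeval_X, aeval_C, map_neg, add_mul, add_mul, neg_mul,
              neg_mul, mul_assoc, mul_assoc, ← Algebra.smul_def, ← sub_eq_add_neg]
        rw [← gen, hpb]
      obtain ⟨g₁, hg₁, h₁⟩ := key _ ha
      rw [← mul_assoc] at h₁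
      obtain ⟨g₂, hg₂, h₂⟩ := ih _ hdeg q hq rfl _ h₁
      exact ⟨g₂ * g₁, mul_ne_zero hg₂ hg₁, by rw [map_mul, mul_assoc, h₂]⟩

end Ore

/-! ### Noncommutative Kleinian fiber products -/

/-- The generators `H`, `X_i^+`, `X_i^-` (with `i ∈ {1, 2}` indexed by `Fin 2`). -/
inductive Gen : Type
  | H : Gen
  | Xp (i : Fin 2) : Gen
  | Xm (i : Fin 2) : Gen

/-- A generator as an element of the free algebra. -/
abbrev gen (g : Gen) : FreeAlgebra ℂ Gen := FreeAlgebra.ι ℂ g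

/-- The defining relations of the algebra before killing torsion. -/
inductive Rel (α : Fin 2 → ℂ) (p : Fin 2 → ℂ[X]) :
    FreeAlgebra ℂ Gen → FreeAlgebra ℂ Gen → Prop
  | H_Xp (i : Fin 2) :
      Rel α p (gen .H * gen (.Xp i) - gen (.Xp i) * gen .H) (α i • gen (.Xp i))
  | H_Xm (i : Fin 2) :
      Rel α p (gen .H * gen (.Xm i) - gen (.Xm i) * gen .H) (-α i • gen (.Xm i))
  | Xp_Xm (i : Fin 2) :
      Rel α p (gen (.Xp i) * gen (.Xm i))
        (aeval (gen .H - algebraMap ℂ (FreeAlgebra ℂ Gen) (α i / 2)) (p i))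
  | Xm_Xp (i : Fin 2) :
      Rel α p (gen (.Xm i) * gen (.Xp i))
        (aeval (gen .H + algebraMap ℂ (FreeAlgebra ℂ Gen) (α i / 2)) (p i))
  | comm (i j : Fin 2) (hij : i ≠ j) :
      Rel α p (gen (.Xp i) * gen (.Xm j)) (gen (.Xm j) * gen (.Xp i))

/-- The algebra presented by the generators and relations above. -/
abbrev PreAlg (α : Fin 2 → ℂ) (p : Fin 2 → ℂ[X]) : Type := RingQuot (Rel α p)

/-- The image of a generator in the presented algebra. -/
def preGen (α : Fin 2 → ℂ) (p : Fin 2 → ℂ[X]) (g : Gen) : PreAlg α p :=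
  RingQuot.mkAlgHom ℂ (Rel α p) (gen g)

theorem adjoin_preGen (α : Fin 2 → ℂ) (p : Fin 2 → ℂ[X]) :
    Algebra.adjoin ℂ (Set.range (preGen α p)) = ⊤ := by
  have h : Set.range (preGen α p)
      = RingQuot.mkAlgHom ℂ (Rel α p) '' Set.range (FreeAlgebra.ι ℂ) := by
    rw [← Set.range_comp]; rfl
  rw [h, ← AlgHom.map_adjoin, FreeAlgebra.adjoin_range_ι, Algebra.map_top]
  exact (AlgHom.range_eq_top _).2 (RingQuot.mkAlgHom_surjective ℂ _)

theorem weight_preGen (α : Fin 2 → ℂ) (p : Fin 2 → ℂ[X]) :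
    ∀ x ∈ Set.range (preGen α p), ∃ c : ℂ,
      preGen α p .H * x - x * preGen α p .H = c • x := by
  rintro _ ⟨g, rfl⟩
  cases g with
  | H => exact ⟨0, by rw [sub_self, zero_smul]⟩
  | Xp i =>
    refine ⟨α i, ?_⟩
    have := RingQuot.mkAlgHom_rel ℂ (Rel.H_Xp (α := α) (p := p) i)
    rwa [map_sub, map_mul, map_mul, map_smul] at this
  | Xm i =>
    refine ⟨-α i, ?_⟩
    have := RingQuot.mkAlgHom_rel ℂ (Rel.H_Xm (α := α) (p := p) i)
    rwa [map_sub, map_mul, map_mul, map_smul] at this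

/-- The ideal of all `a` with `f(H) a = 0` for some nonzero polynomial `f`. -/
def torsionIdeal (α : Fin 2 → ℂ) (p : Fin 2 → ℂ[X]) : Ideal (PreAlg α p) where
  carrier := {a | ∃ f : ℂ[X], f ≠ 0 ∧ aeval (preGen α p .H) f * a = 0}
  zero_mem' := ⟨1, one_ne_zero, mul_zero _⟩
  add_mem' := by
    rintro a b ⟨f, hf, ha⟩ ⟨g, hg, hb⟩
    refine ⟨f * g, mul_ne_zero hf hg, ?_⟩
    rw [mul_add]
    nth_rewrite 1 [mul_comm f g]
    rw [map_mul, map_mul, mul_assoc, mul_assoc, ha, hb, mul_zero, mul_zero, add_zero]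
  smul_mem' := by
    rintro b a ⟨f, hf, ha⟩
    obtain ⟨g, hg, b', hb'⟩ := left_ore (adjoin_preGen α p) (weight_preGen α p) b f hf
    exact ⟨g, hg, by rw [smul_eq_mul, ← mul_assoc, hb', mul_assoc, ha, mul_zero]⟩

instance (α : Fin 2 → ℂ) (p : Fin 2 → ℂ[X]) : (torsionIdeal α p).IsTwoSided where
  mul_mem_of_left := by
    rintro a b ⟨f, hf, ha⟩
    exact ⟨f, hf, by rw [← mul_assoc, ha, zero_mul]⟩

/-- The noncommutative Kleinian fiber product with parameters `α₁, α₂` and `p₁, p₂`. -/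
abbrev Alg (α : Fin 2 → ℂ) (p : Fin 2 → ℂ[X]) : Type := PreAlg α p ⧸ torsionIdeal α p

/-- The image of a generator in the Kleinian fiber product. -/
def algGen (α : Fin 2 → ℂ) (p : Fin 2 → ℂ[X]) (g : Gen) : Alg α p :=
  Ideal.Quotient.mk (torsionIdeal α p) (preGen α p g)

/-- The element `H`. -/
abbrev elH (α : Fin 2 → ℂ) (p : Fin 2 → ℂ[X]) : Alg α p := algGen α p .H

/-- The elements `X_i^+`. -/
abbrev elX (α : Fin 2 → ℂ) (p : Fin 2 → ℂ[X]) (i : Fin 2) : Alg α p := algGen α p (.Xp i)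

theorem adjoin_algGen (α : Fin 2 → ℂ) (p : Fin 2 → ℂ[X]) :
    Algebra.adjoin ℂ (Set.range (algGen α p)) = ⊤ := by
  have h : Set.range (algGen α p)
      = Ideal.Quotient.mkₐ ℂ (torsionIdeal α p) '' Set.range (preGen α p) := by
    rw [← Set.range_comp]; rfl
  rw [h, ← AlgHom.map_adjoin, adjoin_preGen, Algebra.map_top]
  exact (AlgHom.range_eq_top _).2 (Ideal.Quotient.mkₐ_surjective ℂ _)

theorem weight_algGen (α : Fin 2 → ℂ) (p : Fin 2 → ℂ[X]) :
    ∀ x ∈ Set.range (algGen α p), ∃ c : ℂ, elH α p * x - x * elH α p = c • x := by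
  rintro _ ⟨g, rfl⟩
  obtain ⟨c, hc⟩ := weight_preGen α p _ ⟨g, rfl⟩
  exact ⟨c, congrArg (Ideal.Quotient.mkₐ ℂ (torsionIdeal α p)) hc⟩

/-- The multiplicative set of all `f(H)` with `f` a nonzero polynomial. -/
def polyH (α : Fin 2 → ℂ) (p : Fin 2 → ℂ[X]) : Submonoid (Alg α p) where
  carrier := {s | ∃ f : ℂ[X], f ≠ 0 ∧ aeval (elH α p) f = s}
  one_mem' := ⟨1, one_ne_zero, map_one _⟩
  mul_mem' := by
    rintro _ _ ⟨f, hf, rfl⟩ ⟨g, hg, rfl⟩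
    exact ⟨f * g, mul_ne_zero hf hg, map_mul _ _ _⟩

/-- `f(H)` as an element of the multiplicative set. -/
def polyH.of (α : Fin 2 → ℂ) (p : Fin 2 → ℂ[X]) (f : ℂ[X]) (hf : f ≠ 0) : polyH α p :=
  ⟨aeval (elH α p) f, f, hf, rfl⟩

theorem exists_ore (α : Fin 2 → ℂ) (p : Fin 2 → ℂ[X]) (r : Alg α p) (s : polyH α p) :
    ∃ d : Alg α p × polyH α p, (d.2 : Alg α p) * r = d.1 * s := by
  obtain ⟨_, f, hf, rfl⟩ := s
  obtain ⟨g, hg, b', hb'⟩ := left_ore (adjoin_algGen α p) (weight_algGen α p) r f hf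
  exact ⟨(b', polyH.of α p g hg), hb'⟩

instance oreSet (α : Fin 2 → ℂ) (p : Fin 2 → ℂ[X]) : OreLocalization.OreSet (polyH α p) where
  ore_right_cancel := by
    rintro r₁ r₂ ⟨_, f, hf, rfl⟩ h
    have h0 : (r₁ - r₂) * aeval (elH α p) f = 0 := by rw [sub_mul, sub_eq_zero]; exact h
    obtain ⟨g, hg, h1⟩ :=
      right_torsion (adjoin_algGen α p) (weight_algGen α p) f hf _ h0
    refine ⟨polyH.of α p g hg, ?_⟩
    rw [mul_sub, sub_eq_zero] at h1
    exact h1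
  oreNum r s := (Classical.choose (exists_ore α p r s)).1
  oreDenom r s := (Classical.choose (exists_ore α p r s)).2
  ore_eq r s := Classical.choose_spec (exists_ore α p r s)

/-- The localization `A ⊗_{ℂ[H]} ℂ(H)`, i.e. the Ore localization of the Kleinian fiber product
at the nonzero polynomials in `H`. -/
abbrev AlgLoc (α : Fin 2 → ℂ) (p : Fin 2 → ℂ[X]) : Type :=
  OreLocalization (polyH α p) (Alg α p)

/-- The canonical map from the Kleinian fiber product to its localization. -/
abbrev toLoc (α : Fin 2 → ℂ) (p : Fin 2 → ℂ[X]) : Alg α p →+* AlgLoc α p :=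
  OreLocalization.numeratorRingHom

/-- The element `1 / f(H)` of the localization. -/
def invPoly (α : Fin 2 → ℂ) (p : Fin 2 → ℂ[X]) (f : ℂ[X]) (hf : f ≠ 0) : AlgLoc α p :=
  ((OreLocalization.numeratorUnit (polyH.of α p f hf))⁻¹ : (AlgLoc α p)ˣ)

/-- The cyclic subalgebra: the centralizer of `H`. -/
abbrev cyclicSubalgebra (α : Fin 2 → ℂ) (p : Fin 2 → ℂ[X]) : Subalgebra ℂ (Alg α p) :=
  Subalgebra.centralizer ℂ {elH α p}

/-- `H` as an element of its own centralizer. -/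
def cyclicH (α : Fin 2 → ℂ) (p : Fin 2 → ℂ[X]) : cyclicSubalgebra α p :=
  ⟨elH α p, by rw [Subalgebra.mem_centralizer_iff]; rintro g rfl; rfl⟩

theorem cyclicH_commute (α : Fin 2 → ℂ) (p : Fin 2 → ℂ[X]) (a : cyclicSubalgebra α p) :
    cyclicH α p * a = a * cyclicH α p :=
  Subtype.ext ((Subalgebra.mem_centralizer_iff ℂ).1 a.2 _ rfl)

/-- The principal ideal of the cyclic subalgebra generated by `H - μ`. -/
def cyclicIdeal (α : Fin 2 → ℂ) (p : Fin 2 → ℂ[X]) (μ : ℂ) : Ideal (cyclicSubalgebra α p) :=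
  Ideal.span {cyclicH α p - algebraMap ℂ (cyclicSubalgebra α p) μ}

instance (α : Fin 2 → ℂ) (p : Fin 2 → ℂ[X]) (μ : ℂ) : (cyclicIdeal α p μ).IsTwoSided where
  mul_mem_of_left := by
    intro a b ha
    obtain ⟨c, rfl⟩ := Ideal.mem_span_singleton'.1 ha
    refine Ideal.mem_span_singleton'.2 ⟨c * b, ?_⟩
    rw [mul_assoc, mul_assoc, mul_sub, sub_mul, cyclicH_commute, Algebra.commutes]

/-- The cyclic subquotient at `μ`: the cyclic subalgebra modulo `H - μ`. -/
abbrev CyclicSubquotient (α : Fin 2 → ℂ) (p : Fin 2 → ℂ[X]) (μ : ℂ) : Type :=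
  cyclicSubalgebra α p ⧸ cyclicIdeal α p μ

/-- `IsValueAt α p μ z c`: the element `z` of the localization is regular at `H = μ`, i.e. it is a
fraction `a f(H)⁻¹` with `a` in the cyclic subalgebra and `f(μ) ≠ 0`, and its image in the cyclic
subquotient at `μ`, obtained by setting `H = μ`, is `c`. -/
def IsValueAt (α : Fin 2 → ℂ) (p : Fin 2 → ℂ[X]) (μ : ℂ) (z : AlgLoc α p)
    (c : CyclicSubquotient α p μ) : Prop :=
  ∃ (a : cyclicSubalgebra α p) (f : ℂ[X]) (hf : f.eval μ ≠ 0),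
    z = toLoc α p a * invPoly α p f (fun h => hf (by rw [h, eval_zero])) ∧
      c = (f.eval μ)⁻¹ • Ideal.Quotient.mk (cyclicIdeal α p μ) a

/-! ### Higher spin vertex configurations -/

/-- An `(m, n)`-periodic higher spin vertex configuration on the square lattice whose faces have
midpoints in `ℤ²`. The value `vert (x, y)` is the label of the vertical edge with midpoint
`(x + 1/2, y)`, and `horiz (x, y)` is the label of the horizontal edge with midpoint
`(x, y + 1/2)`. The vertex `(x + 1/2, y + 1/2)` is encoded by `(x, y)`. -/
structure Config (m n : ℕ) where
  vert : ℤ × ℤ → ℕ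
  horiz : ℤ × ℤ → ℕ
  vert_periodic : ∀ e, vert (e + ((m : ℤ), (n : ℤ))) = vert e
  horiz_periodic : ∀ e, horiz (e + ((m : ℤ), (n : ℤ))) = horiz e
  vert_finite : ∀ e, ∃ K : ℤ, ∀ k : ℤ, K ≤ |k| → vert (e + k • (-(n : ℤ), (m : ℤ))) = 0
  horiz_finite : ∀ e, ∃ K : ℤ, ∀ k : ℤ, K ≤ |k| → horiz (e + k • (-(n : ℤ), (m : ℤ))) = 0
  /-- Local current conservation at the vertex `(x + 1/2, y + 1/2)`. -/
  ice : ∀ x y : ℤ, horiz (x, y) + vert (x, y) = horiz (x + 1, y) + vert (x, y + 1)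

namespace Config

variable {m n : ℕ} (L : Config m n) (α : Fin 2 → ℂ)

/-- Five-vertex configuration: at every vertex at most two of the four incident edges (left,
below, right, above) have non-zero label. -/
def IsFiveVertex : Prop :=
  ∀ x y : ℤ,
    (({L.horiz (x, y), L.vert (x, y), L.horiz (x + 1, y), L.vert (x, y + 1)} :
      Multiset ℕ).filter (· ≠ 0)).card ≤ 2

/-- The group of translations generated by `(m, n)`, acting on `ℤ²`. -/
abbrev Period (m n : ℕ) : AddSubgroup (ℤ × ℤ) := AddSubgroup.zmultiples ((m : ℤ), (n : ℤ))

/-- The complex number `x₁ α₁ + x₂ α₂` attached to the face with midpoint `(x₁, x₂)`. -/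
def faceValue (x : ℤ × ℤ) : ℂ := x.1 * α 0 + x.2 * α 1

/-- The polynomials `P₁, P₂`: products of `(u - (x₁ α₁ + x₂ α₂)) ^ L(x₁, x₂)` over the midpoints
`(x₁, x₂)` of vertical, respectively horizontal, edges modulo `(m, n)`. -/
def poly : Fin 2 → ℂ[X] :=
  ![∏ᶠ q : (ℤ × ℤ) ⧸ Period m n,
      (X - C (faceValue α q.out + α 0 / 2)) ^ L.vert q.out,
    ∏ᶠ q : (ℤ × ℤ) ⧸ Period m n,
      (X - C (faceValue α q.out + α 1 / 2)) ^ L.horiz q.out]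

/-- The number of vertical edges, counted with multiplicity, crossed by the face path that starts
at the face `x` and whose steps are `(1, 0)` for each letter `0` and `(0, 1)` for each letter `1`. -/
def vertCross : List (Fin 2) → ℤ × ℤ → ℕ
  | [], _ => 0
  | 0 :: i, x => L.vert x + vertCross i (x + (1, 0))
  | 1 :: i, x => vertCross i (x + (0, 1))

/-- The number of horizontal edges, counted with multiplicity, crossed by such a face path. -/
def horizCross : List (Fin 2) → ℤ × ℤ → ℕ
  | [], _ => 0
  | 0 :: i, x => horizCross i (x + (1, 0))
  | 1 :: i, x => L.horiz x + horizCross i (x + (0, 1))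

/-- The order of the face path `i` starting at the face `x`. See `sum_vertexOrder_above` and
`sum_vertexOrder_left` for the two crossing numbers as sums of orders of vertices. -/
def order (i : List (Fin 2)) (x : ℤ × ℤ) : ℕ := max (L.vertCross i x) (L.horizCross i x)

/-- The polynomial `∏_λ (u - λ) ^ ord(i, λ)`, with `λ = x₁ α₁ + x₂ α₂` ranging over the faces
`(x₁, x₂)` modulo `(m, n)`. -/
def orderPoly (i : List (Fin 2)) : ℂ[X] :=
  ∏ᶠ q : (ℤ × ℤ) ⧸ Period m n, (X - C (faceValue α q.out)) ^ L.order i q.out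

theorem orderPoly_ne_zero (i : List (Fin 2)) : L.orderPoly α i ≠ 0 :=
  finprod_induction (· ≠ 0) one_ne_zero (fun _ _ => mul_ne_zero)
    (fun _ => pow_ne_zero _ (X_sub_C_ne_zero _))

/-- The element `X(i) = X_{i_ℓ}^+ ⋯ X_{i_1}^+`. -/
def pathX (i : List (Fin 2)) : Alg α (L.poly α) := (i.reverse.map (elX α (L.poly α))).prod

/-- The element `X(i) ∏_λ (H - λ) ^ (-ord(i, λ))` of the localization. -/
def pathC (i : List (Fin 2)) : AlgLoc α (L.poly α) :=
  toLoc α (L.poly α) (L.pathX α i) *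
    invPoly α (L.poly α) (L.orderPoly α i) (L.orderPoly_ne_zero α i)

end Config

/-- `Seq₂(k, l)`: sequences with `k` letters `1` and `l` letters `2` (written `0` and `1`). -/
def Seq2 (k l : ℕ) : Set (List (Fin 2)) := {i | i.count 0 = k ∧ i.count 1 = l}

namespace Config

variable {m n : ℕ} (L : Config m n) (α : Fin 2 → ℂ)

/-- The element `C_{k,l}`, computed from the sequence `1 ⋯ 1 2 ⋯ 2`. -/
def elC (k l : ℕ) : AlgLoc α (L.poly α) :=
  L.pathC α (List.replicate k 0 ++ List.replicate l 1)

/-! ### The cylinder -/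

/-- The twisted cylinder `ℝ² / ⟨(m, n)⟩`. -/
abbrev Cylinder (m n : ℕ) : Type := (ℝ × ℝ) ⧸ AddSubgroup.zmultiples ((m : ℝ), (n : ℝ))

/-- The union in `ℝ²` of the closed edges with non-zero label. -/
def edgeSet : Set (ℝ × ℝ) :=
  {a | ∃ x : ℤ × ℤ, L.vert x ≠ 0 ∧ a.1 = x.1 + 1 / 2 ∧
      (x.2 : ℝ) - 1 / 2 ≤ a.2 ∧ a.2 ≤ x.2 + 1 / 2} ∪
  {a | ∃ x : ℤ × ℤ, L.horiz x ≠ 0 ∧ a.2 = x.2 + 1 / 2 ∧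
      (x.1 : ℝ) - 1 / 2 ≤ a.1 ∧ a.1 ≤ x.1 + 1 / 2}

/-- The image of `edgeSet` in the cylinder. -/
def edgeSetBar : Set (Cylinder m n) :=
  (QuotientAddGroup.mk : ℝ × ℝ → Cylinder m n) '' L.edgeSet

/-- The midpoint of the face `x`, as a point of the cylinder. -/
def facePoint (m n : ℕ) (x : ℤ × ℤ) : Cylinder m n :=
  QuotientAddGroup.mk ((x.1 : ℝ), (x.2 : ℝ))

/-- The connected component, in the complement of the configuration in the cylinder, of the
midpoint of the face `x`. -/
def component (x : ℤ × ℤ) : Set (Cylinder m n) :=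
  connectedComponentIn L.edgeSetBarᶜ (facePoint m n x)

/-- The face `x` lies in an incontractible component. -/
def InIncontractible (x : ℤ × ℤ) : Prop := ¬ ContractibleSpace (L.component x)

/-! ### The order of a path in terms of the orders of vertices

Each horizontal step of a face path crosses as many vertical edges as the sum of the orders of all
vertices directly above it, and each vertical step crosses as many horizontal edges as the sum of
the orders of all vertices directly to its left. -/

/-- The order of the vertex `(x + 1/2, y + 1/2)`: edges to the right minus edges to the left. -/
def vertexOrder (v : ℤ × ℤ) : ℤ := (L.horiz (v + (1, 0)) : ℤ) - L.horiz v

/-- By current conservation it is also edges below minus edges above. -/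
theorem vertexOrder_eq (v : ℤ × ℤ) :
    L.vertexOrder v = (L.vert v : ℤ) - L.vert (v + (0, 1)) := by
  have h := L.ice v.1 v.2
  have e1 : v + (1, 0) = (v.1 + 1, v.2) := by ext <;> simp
  have e2 : v + (0, 1) = (v.1, v.2 + 1) := by ext <;> simp
  rw [vertexOrder, e1, e2]
  have h' : (L.horiz v : ℤ) + L.vert v = L.horiz (v.1 + 1, v.2) + L.vert (v.1, v.2 + 1) := by
    exact_mod_cast h
  linarith

theorem finsum_telescope (f : ℕ → ℕ) (N : ℕ) (hN : ∀ t, N ≤ t → f t = 0) :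
    ∑ᶠ t : ℕ, ((f t : ℤ) - f (t + 1)) = f 0 := by
  rw [finsum_eq_sum_of_support_subset (s := Finset.range N)]
  · rw [Finset.sum_range_sub' (fun t => (f t : ℤ)), hN N le_rfl]; simp
  · intro t ht
    by_contra h
    have h' : N ≤ t := by simpa using h
    exact ht (by simp [hN t h', hN (t + 1) (by omega)])

theorem eventually_zero (hm : 0 < m) (hn : 0 < n) (g : ℤ × ℤ → ℕ)
    (hp : ∀ e, g (e + ((m : ℤ), (n : ℤ))) = g e)
    (hf : ∀ e, ∃ K : ℤ, ∀ k : ℤ, K ≤ |k| → g (e + k • (-(n : ℤ), (m : ℤ))) = 0)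
    (w : ℤ × ℤ) (hw : w = (0, 1) ∨ w = (-1, 0)) (e : ℤ × ℤ) :
    ∃ N : ℕ, ∀ t : ℕ, N ≤ t → g (e + (t : ℤ) • w) = 0 := by
  choose K hK using hf
  set M : ℕ := m ^ 2 + n ^ 2 with hM
  have hMpos : 0 < M := by positivity
  set B : ℕ := (Finset.range M).sup fun r => (K (e + (r : ℤ) • w)).toNat with hB
  refine ⟨M * B, fun t ht => ?_⟩
  set s := t / M with hs
  set r := t % M with hr
  have hrM : r < M := Nat.mod_lt _ hMpos
  have hsB : B ≤ s := (Nat.le_div_iff_mul_le hMpos).2 (by rwa [mul_comm])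
  have hKs : K (e + (r : ℤ) • w) ≤ (s : ℤ) := by
    have h1 : (K (e + (r : ℤ) • w)).toNat ≤ B :=
      Finset.le_sup (f := fun r : ℕ => (K (e + (r : ℤ) • w)).toNat) (Finset.mem_range.2 hrM)
    have := Int.self_le_toNat (K (e + (r : ℤ) • w))
    omega
  have ht' : (t : ℤ) = s * ((m : ℤ) ^ 2 + (n : ℤ) ^ 2) + r := by
    have := Nat.div_add_mod t M
    rw [← hs, ← hr, hM] at this
    rw [← this]; push_cast; ring
  have hper : ∀ (b : ℤ) (x : ℤ × ℤ), g (x + b • ((m : ℤ), (n : ℤ))) = g x := fun b x =>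
    (Function.Periodic.zsmul (f := g) hp b) x
  rcases hw with rfl | rfl
  · have : e + (t : ℤ) • ((0, 1) : ℤ × ℤ)
        = e + (r : ℤ) • ((0, 1) : ℤ × ℤ) + ((s : ℤ) * m) • (-(n : ℤ), (m : ℤ))
          + ((s : ℤ) * n) • ((m : ℤ), (n : ℤ)) := by
      ext <;> simp [ht'] <;> ring
    rw [this, hper]
    refine hK _ _ (hKs.trans ?_)
    rw [abs_of_nonneg (by positivity)]
    have : (1 : ℤ) ≤ m := by exact_mod_cast hm
    nlinarith [Int.natCast_nonneg s]
  · have : e + (t : ℤ) • ((-1, 0) : ℤ × ℤ)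
        = e + (r : ℤ) • ((-1, 0) : ℤ × ℤ) + ((s : ℤ) * n) • (-(n : ℤ), (m : ℤ))
          + (-(s : ℤ) * m) • ((m : ℤ), (n : ℤ)) := by
      ext <;> simp [ht'] <;> ring
    rw [this, hper]
    refine hK _ _ (hKs.trans ?_)
    rw [abs_of_nonneg (by positivity)]
    have : (1 : ℤ) ≤ n := by exact_mod_cast hn
    nlinarith [Int.natCast_nonneg s]

theorem sum_vertexOrder_above (hm : 0 < m) (hn : 0 < n) (x : ℤ × ℤ) :
    ∑ᶠ t : ℕ, L.vertexOrder (x + (0, (t : ℤ))) = L.vert x := by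
  obtain ⟨N, hN⟩ := eventually_zero hm hn L.vert L.vert_periodic L.vert_finite (0, 1) (.inl rfl) x
  have := finsum_telescope (fun t => L.vert (x + (t : ℤ) • ((0, 1) : ℤ × ℤ))) N hN
  simp only [Nat.cast_zero, zero_smul, add_zero] at this
  rw [← this]
  refine finsum_congr fun t => ?_
  rw [vertexOrder_eq]
  congr 3 <;> ext <;> simp [add_assoc]

theorem sum_vertexOrder_left (hm : 0 < m) (hn : 0 < n) (x : ℤ × ℤ) :
    ∑ᶠ t : ℕ, L.vertexOrder (x + (-1 - (t : ℤ), 0)) = L.horiz x := by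
  obtain ⟨N, hN⟩ :=
    eventually_zero hm hn L.horiz L.horiz_periodic L.horiz_finite (-1, 0) (.inr rfl) x
  have := finsum_telescope (fun t => L.horiz (x + (t : ℤ) • ((-1, 0) : ℤ × ℤ))) N hN
  simp only [Nat.cast_zero, zero_smul, add_zero] at this
  rw [← this]
  refine finsum_congr fun t => ?_
  rw [vertexOrder]
  congr 3 <;> ext <;> simp <;> ring

end Config

end KleinianFiber

end

open KleinianFiber KleinianFiber.Config

/-!
Everything rests on one change of generators. In the localization `X_1^-` and `X_2^+` are
invertible, so `Y₁ = (X_1^-)⁻¹` and `Y₂ = X_2^+` are commuting units, and each generator is a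
monomial in `Y₁, Y₂` times a polynomial in `H` (`Gauge`). The product of the `X_i^+` along a face
path is then `Y₂ ^ l Y₁ ^ k ∏ (H - λ) ^ v(λ)`, where `v` counts the vertical edges crossed
(`hom_pathX`). Current conservation provides a height function on faces that is periodic and
changes across each edge by its label, so vertical minus horizontal crossings is a difference of
heights (`vertCross_sub_horizCross`). This gives the independence of the path
(`pathC_eq_pathC`), and it shows that `C = Y₂ ^ n Y₁ ^ m` on the nose (`elC_eq_mono`). The latter
is central since `m α₁ + n α₂ = 0`.

The algebra is graded by `ℤ²`: the elements of degree `d` have the form `Y₂ ^ l Y₁ ^ k q(H)` with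
`d = (k, l)`, and `q` vanishes at every face `y` for which no walk of non-increasing height leads
from `y` to `y + d` (`piece`, `iSup_piece`). The cyclic subalgebra consists of the degrees in
`ℤ (m, n)` (`mem_iSup_piece_of_commute`). Conversely, a walk from `x` to `z` across edges with label
zero gives an element of degree `z - x` whose polynomial does not vanish at `x`
(`exists_of_reach`).

If the component of `x` is incontractible, then there is such a walk from `x` to `x + (m, n)`. The
greedy walk, which moves right whenever the edge to the right has label zero and upwards otherwise,
can only fail at a face whose right and upper edges both have non-zero labels. Following non-zero
edges backwards from the upper right vertex of that face, along the two innermost paths, encloses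
a region that is homeomorphic to a planar region between two graphs and is embedded in the
cylinder, so the component would be contractible (`Pocket.contractibleSpace_component`). If the
greedy walk does not fail, then periodicity of the height closes it up
(`reach_period_of_not_stuck`). The walk and its reverse show that `C` and `C⁻¹` have values `c`
and `c⁻¹` in the cyclic subquotient, and that these generate it. There are no further relations,
because the algebra acts on functions `ℤ → ℂ[z, z⁻¹][u]` with `C` acting as `z` (`rep`), and this
maps the subquotient to the Laurent polynomials (`evalSubquotient`).

Finally, the polynomials `f` with `C f(H)` in the algebra form an ideal. For a five-vertex
configuration the greedy walk never fails, so this ideal has no common zeros and contains `1`.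
If `C` lies in the algebra, the grading gives a walk of non-increasing height from every face to its
translate; by periodicity of the height it crosses only edges with label zero, so no pocket
exists and the configuration is five-vertex.
-/

open Polynomial

noncomputable section

namespace KleinianFiber

/-! ### Pockets: combinatorics of the bounding lattice paths -/

namespace Config

variable {m n : ℕ} (L : Config m n)

/-- The edge arriving at the vertex `v` from below (`ε = 0`) or from the left (`ε = 1`) has
non-zero label. -/
def InEdge (ε : ℤ) (v : ℤ × ℤ) : Prop :=
  (ε = 0 ∧ L.vert v ≠ 0) ∨ (ε = 1 ∧ L.horiz v ≠ 0)

theorem InEdge.exists_prev {L : Config m n} {ε : ℤ} {v : ℤ × ℤ} (h : L.InEdge ε v) :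
    ∃ ε', L.InEdge ε' (v.1 - ε, v.2 - (1 - ε)) := by
  obtain ⟨a, b⟩ := v
  rcases h with ⟨rfl, h⟩ | ⟨rfl, h⟩
  · have := L.ice a (b - 1)
    simp only [sub_add_cancel] at this
    by_cases h' : L.vert (a, b - 1) = 0
    · exact ⟨1, .inr ⟨rfl, by simpa using by omega⟩⟩
    · exact ⟨0, .inl ⟨rfl, by simpa using h'⟩⟩
  · have := L.ice (a - 1) b
    simp only [sub_add_cancel] at this
    by_cases h' : L.vert (a - 1, b) = 0
    · exact ⟨1, .inr ⟨rfl, by simpa using by omega⟩⟩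
    · exact ⟨0, .inl ⟨rfl, by simpa using h'⟩⟩

/-- Current conservation, forwards: a vertex with a non-zero incoming edge has a non-zero outgoing
edge, to the vertex on the right (`ε' = 1`) or above (`ε' = 0`). -/
theorem InEdge.exists_next {L : Config m n} {ε : ℤ} {v : ℤ × ℤ} (h : L.InEdge ε v) :
    ∃ ε', (ε' = 0 ∨ ε' = 1) ∧ L.InEdge ε' (v.1 + ε', v.2 + (1 - ε')) := by
  obtain ⟨a, b⟩ := v
  have := L.ice a b
  have hne : L.horiz (a, b) + L.vert (a, b) ≠ 0 := by
    rcases h with ⟨rfl, h⟩ | ⟨rfl, h⟩ <;> omega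
  by_cases h' : L.vert (a, b + 1) = 0
  · exact ⟨1, .inr rfl, .inr ⟨rfl, by simpa using by omega⟩⟩
  · exact ⟨0, .inl rfl, .inl ⟨rfl, by simpa using h'⟩⟩

/-- A sequence of vertices followed backwards along non-zero edges. The vertex at depth `j` is
`(a j, T - j - a j)`, where `T` is the sum of the coordinates of the initial vertex. -/
def IsBackPath (T : ℤ) (a : ℕ → ℤ) : Prop :=
  ∀ j : ℕ, L.InEdge (a j - a (j + 1)) (a j, T - j - a j)

theorem IsBackPath.step {L : Config m n} {T : ℤ} {a : ℕ → ℤ} (h : L.IsBackPath T a) (j : ℕ) :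
    a (j + 1) = a j ∨ a (j + 1) = a j - 1 := by
  rcases h j with ⟨h, -⟩ | ⟨h, -⟩
  · left; omega
  · right; omega

/-- Every backward path can be continued, with a prescribed preference `δ` for one of the two
kinds of edges. -/
theorem exists_isBackPath (δ ε₀ : ℤ) (y : ℤ × ℤ) (h : L.InEdge ε₀ y) :
    ∃ a : ℕ → ℤ, L.IsBackPath (y.1 + y.2) a ∧ a 0 = y.1 ∧ a 1 = y.1 - ε₀ ∧
      ∀ j : ℕ, 1 ≤ j → L.InEdge δ (a j, y.1 + y.2 - j - a j) → a (j + 1) = a j - δ := by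
  classical
  -- the choice of the next edge at a vertex
  have key : ∀ v : ℤ × ℤ, ∃ e : ℤ, ((∃ ε, L.InEdge ε v) → L.InEdge e v) ∧
      (L.InEdge δ v → e = δ) := by
    intro v
    by_cases hv : L.InEdge δ v
    · exact ⟨δ, fun _ => hv, fun _ => rfl⟩
    · by_cases hv' : ∃ ε, L.InEdge ε v
      · exact ⟨hv'.choose, fun _ => hv'.choose_spec, fun h => absurd h hv⟩
      · exact ⟨0, fun h => absurd h hv', fun h => absurd h hv⟩
  choose e he hδ using key
  let s : ℕ → ℤ := fun j => Nat.rec (y.1 - ε₀)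
    (fun j c => c - e (c, y.1 + y.2 - (j + 1 : ℕ) - c)) j
  have hs : ∀ j, s (j + 1) = s j - e (s j, y.1 + y.2 - (j + 1 : ℕ) - s j) := fun j => rfl
  have hs0 : s 0 = y.1 - ε₀ := rfl
  have hin : ∀ j, ∃ ε, L.InEdge ε (s j, y.1 + y.2 - (j + 1 : ℕ) - s j) := by
    intro j
    induction j with
    | zero =>
      obtain ⟨ε, hε⟩ := h.exists_prev
      refine ⟨ε, ?_⟩
      convert hε using 2
      rw [hs0]; push_cast; ring
    | succ j ih =>
      obtain ⟨ε, hε⟩ := (he _ ih).exists_prev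
      refine ⟨ε, ?_⟩
      convert hε using 2
      simp only [hs]; push_cast; ring
  refine ⟨fun j => Nat.casesOn j y.1 s, ?_, rfl, rfl, ?_⟩
  · rintro (_ | j)
    · simpa [hs0] using h
    · have := he _ (hin j)
      show L.InEdge (s j - s (j + 1)) (s j, y.1 + y.2 - (j + 1 : ℕ) - s j)
      rwa [hs, sub_sub_cancel]
  · rintro (_ | j) hj h'
    · omega
    · show s (j + 1) = s j - δ
      rw [hs, hδ _ h']

/-- The two innermost backward paths that start at the upper right vertex of the face `y`, to the
left and downwards. -/
structure Pocket (y : ℤ × ℤ) where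
  l : ℕ → ℤ
  r : ℕ → ℤ
  l_path : L.IsBackPath (y.1 + y.2) l
  r_path : L.IsBackPath (y.1 + y.2) r
  l_zero : l 0 = y.1
  r_zero : r 0 = y.1
  l_one : l 1 = y.1 - 1
  r_one : r 1 = y.1
  l_inner : ∀ j : ℕ, 1 ≤ j → L.InEdge 0 (l j, y.1 + y.2 - j - l j) → l (j + 1) = l j
  r_inner : ∀ j : ℕ, 1 ≤ j → L.InEdge 1 (r j, y.1 + y.2 - j - r j) → r (j + 1) = r j - 1

theorem exists_pocket (y : ℤ × ℤ) (hv : L.vert y ≠ 0) (hh : L.horiz y ≠ 0) :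
    Nonempty (L.Pocket y) := by
  obtain ⟨l, h1, h2, h3, h4⟩ := L.exists_isBackPath 0 1 y (.inr ⟨rfl, hh⟩)
  obtain ⟨r, k1, k2, k3, k4⟩ := L.exists_isBackPath 1 0 y (.inl ⟨rfl, hv⟩)
  exact ⟨⟨l, r, h1, k1, h2, k2, h3, by simpa using k3, by simpa using h4, k4⟩⟩

namespace Pocket

variable {L} {y : ℤ × ℤ} (P : L.Pocket y)

/-- No non-zero edge enters the region between the two bounding paths. -/
theorem edge_outside (j : ℕ) (hj : ∀ i, 1 ≤ i → i ≤ j → P.l i < P.r i) (c ε : ℤ)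
    (h : L.InEdge ε (c, y.1 + y.2 - j - c)) :
    (c ≤ P.l j ∧ c - ε ≤ P.l (j + 1)) ∨ (P.r j ≤ c ∧ P.r (j + 1) ≤ c - ε) := by
  have hε : ε = 0 ∨ ε = 1 := by rcases h with ⟨h, -⟩ | ⟨h, -⟩ <;> simp [h]
  induction j generalizing c ε with
  | zero =>
    have h1 := P.l_zero; have h2 := P.r_zero; have h3 := P.l_one; have h4 := P.r_one
    simp only [zero_add] at *
    omega
  | succ j ih =>
    have hout : c ≤ P.l (j + 1) ∨ P.r (j + 1) ≤ c := by
      obtain ⟨ε', hε', h'⟩ := h.exists_next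
      have e : ((c, y.1 + y.2 - ((j + 1 : ℕ) : ℤ) - c).1 + ε',
          (c, y.1 + y.2 - ((j + 1 : ℕ) : ℤ) - c).2 + (1 - ε'))
          = (c + ε', y.1 + y.2 - j - (c + ε')) := by
        ext <;> simp; ring
      rw [e] at h'
      have := ih (fun i h1 h2 => hj i h1 (by omega)) _ _ h' hε'
      omega
    have hl := P.l_path.step (j + 1)
    have hr := P.r_path.step (j + 1)
    rcases hout with hc | hc
    · left
      refine ⟨hc, ?_⟩
      rcases hc.lt_or_eq with hc' | rfl
      · omega
      · rcases hε with rfl | rfl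
        · have := P.l_inner (j + 1) (by omega) h
          omega
        · omega
    · right
      refine ⟨hc, ?_⟩
      rcases hc.lt_or_eq with hc' | rfl
      · omega
      · rcases hε with rfl | rfl
        · omega
        · have := P.r_inner (j + 1) (by omega) h
          omega

end Pocket

end Config

/-! ### Piecewise linear interpolation of integer sequences -/

/-- The function on `ℝ` that is linear on each `[k, k + 1]` and takes the value `a k` at each
natural number `k`; it is constant on `(-∞, 0]`. -/
def interp (a : ℕ → ℤ) (τ : ℝ) : ℝ :=
  a ⌊τ⌋.toNat + Int.fract τ * (a (⌊τ⌋ + 1).toNat - a ⌊τ⌋.toNat)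

theorem interp_of_mem' (a : ℕ → ℤ) (k : ℤ) {τ : ℝ} (h1 : (k : ℝ) ≤ τ) (h2 : τ ≤ k + 1) :
    interp a τ = a k.toNat + (τ - k) * (a (k + 1).toNat - a k.toNat) := by
  rcases h2.lt_or_eq with h2 | h2
  · have : ⌊τ⌋ = k := Int.floor_eq_iff.2 ⟨h1, h2⟩
    rw [interp, Int.fract, this]
  · have : ⌊τ⌋ = k + 1 := Int.floor_eq_iff.2 ⟨by push_cast; linarith, by push_cast; linarith⟩
    rw [interp, Int.fract, this, h2]
    push_cast; ring

theorem interp_of_mem (a : ℕ → ℤ) (j : ℕ) {τ : ℝ} (h1 : (j : ℝ) ≤ τ) (h2 : τ ≤ j + 1) :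
    interp a τ = a j + (τ - j) * (a (j + 1) - a j) := by
  have := interp_of_mem' a (j : ℤ) (τ := τ) (by exact_mod_cast h1) (by exact_mod_cast h2)
  simpa using this

theorem locallyFinite_Icc_int : LocallyFinite fun k : ℤ => Set.Icc (k : ℝ) (k + 1) := by
  intro x
  refine ⟨Set.Ioo (x - 1) (x + 1), Ioo_mem_nhds (by linarith) (by linarith), ?_⟩
  refine (Set.finite_Icc (⌊x⌋ - 3) (⌊x⌋ + 3)).subset ?_
  rintro k ⟨z, ⟨h1, h2⟩, h3, h4⟩
  have h5 := Int.floor_le x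
  have h6 := Int.lt_floor_add_one x
  constructor
  · have : ((⌊x⌋ - 3 : ℤ) : ℝ) < k := by push_cast; linarith
    exact (by exact_mod_cast this : ⌊x⌋ - 3 < k).le
  · have : (k : ℝ) < ((⌊x⌋ + 3 : ℤ) : ℝ) := by push_cast; linarith
    exact (by exact_mod_cast this : k < ⌊x⌋ + 3).le

theorem continuous_interp (a : ℕ → ℤ) : Continuous (interp a) := by
  refine locallyFinite_Icc_int.continuous ?_ (fun _ => isClosed_Icc) fun k => ?_
  · ext x
    simpa using ⟨⌊x⌋, Int.floor_le x, (Int.lt_floor_add_one x).le⟩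
  · refine ContinuousOn.congr
      (f := fun τ : ℝ => a k.toNat + (τ - k) * (a (k + 1).toNat - a k.toNat))
      (by fun_prop) fun τ (hτ : τ ∈ Set.Icc (k : ℝ) (k + 1)) => interp_of_mem' a k hτ.1 hτ.2

/-! ### Pockets: topology -/

/-- The region between the graphs of two continuous functions over a convex set is contractible. -/
theorem contractibleSpace_between {I : Set ℝ} (hI : Convex ℝ I) (hne : I.Nonempty)
    {f g : ℝ → ℝ} (hf : Continuous f) (hg : Continuous g) (hfg : ∀ τ ∈ I, f τ < g τ) :
    ContractibleSpace {q : ℝ × ℝ | q.1 ∈ I ∧ f q.1 < q.2 ∧ q.2 < g q.1} := by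
  have hc : Convex ℝ (I ×ˢ Set.Ioo (0 : ℝ) 1) := hI.prod (convex_Ioo _ _)
  have := hc.contractibleSpace (hne.prod ⟨1 / 2, by norm_num, by norm_num⟩)
  refine Homeomorph.contractibleSpace (Y := ↥(I ×ˢ Set.Ioo (0 : ℝ) 1))
    { toFun := fun q => ⟨(q.1.1, (q.1.2 - f q.1.1) / (g q.1.1 - f q.1.1)), q.2.1, ?_, ?_⟩
      invFun := fun q => ⟨(q.1.1, f q.1.1 + q.1.2 * (g q.1.1 - f q.1.1)), q.2.1, ?_, ?_⟩
      left_inv := ?_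
      right_inv := ?_
      continuous_toFun := ?_
      continuous_invFun := ?_ }
  · have := hfg _ q.2.1
    exact div_pos (by linarith [q.2.2.1]) (by linarith)
  · have := hfg _ q.2.1
    exact (div_lt_one (by linarith)).2 (by linarith [q.2.2.2])
  · have := mul_pos q.2.2.1 (sub_pos.2 (hfg _ q.2.1))
    simp only; linarith
  · have := mul_lt_mul_of_pos_right q.2.2.2 (sub_pos.2 (hfg _ q.2.1))
    simp only; linarith
  · rintro ⟨⟨a, b⟩, h1, h2, h3⟩
    have := (sub_pos.2 (hfg _ h1)).ne'
    refine Subtype.ext (Prod.ext rfl ?_)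
    simp only at this ⊢
    field_simp
    ring
  · rintro ⟨⟨a, b⟩, h1, h2⟩
    have := (sub_pos.2 (hfg _ h1)).ne'
    refine Subtype.ext (Prod.ext rfl ?_)
    simp only at this ⊢
    field_simp
    ring
  · refine Continuous.subtype_mk (Continuous.prodMk (by fun_prop)
      (Continuous.div (by fun_prop) (by fun_prop) fun q => ?_)) _
    exact (sub_pos.2 (hfg _ q.2.1)).ne'
  · exact Continuous.subtype_mk (by fun_prop) _

namespace Config

variable {m n : ℕ} (L : Config m n)

theorem mem_edgeSet_iff (p : ℝ × ℝ) :
    p ∈ L.edgeSet ↔ ∃ (v : ℤ × ℤ) (ε : ℤ) (s : ℝ), L.InEdge ε v ∧ 0 ≤ s ∧ s ≤ 1 ∧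
      p = ((v.1 : ℝ) + 1 / 2 - ε * s, (v.2 : ℝ) + 1 / 2 - (1 - ε) * s) := by
  constructor
  · rintro (⟨v, hv, h1, h2, h3⟩ | ⟨v, hv, h1, h2, h3⟩)
    · refine ⟨v, 0, v.2 + 1 / 2 - p.2, .inl ⟨rfl, hv⟩, by linarith, by linarith, ?_⟩
      ext <;> simp [h1]
    · refine ⟨v, 1, v.1 + 1 / 2 - p.1, .inr ⟨rfl, hv⟩, by linarith, by linarith, ?_⟩
      ext <;> simp [h1]
  · rintro ⟨v, ε, s, (⟨rfl, hv⟩ | ⟨rfl, hv⟩), h0, h1, rfl⟩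
    · refine .inl ⟨v, hv, ?_, ?_, ?_⟩ <;> simp <;> linarith
    · refine .inr ⟨v, hv, ?_, ?_, ?_⟩ <;> simp <;> linarith

theorem isClosed_edgeSet : IsClosed L.edgeSet := by
  have hfin : ∀ (F : ℤ × ℤ → Set (ℝ × ℝ)), (∀ x, IsClosed (F x)) →
      (∀ x, ∀ p ∈ F x, |p.1 - x.1| ≤ 1 ∧ |p.2 - x.2| ≤ 1) → IsClosed (⋃ x, F x) := by
    intro F hF hb
    refine LocallyFinite.isClosed_iUnion (fun p => ?_) hF
    refine ⟨Set.Ioo (p.1 - 1) (p.1 + 1) ×ˢ Set.Ioo (p.2 - 1) (p.2 + 1),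
      prod_mem_nhds (Ioo_mem_nhds (by linarith) (by linarith))
        (Ioo_mem_nhds (by linarith) (by linarith)), ?_⟩
    have key : ∀ (a z : ℝ) (k : ℤ), |z - k| ≤ 1 → a - 1 < z → z < a + 1 →
        k ∈ Set.Icc (⌊a⌋ - 3) (⌊a⌋ + 3) := by
      intro a z k h1 h2 h3
      obtain ⟨h4, h5⟩ := abs_le.1 h1
      have h6 := Int.floor_le a
      have h7 := Int.lt_floor_add_one a
      constructor
      · have : ((⌊a⌋ - 3 : ℤ) : ℝ) < k := by push_cast; linarith
        exact (by exact_mod_cast this : ⌊a⌋ - 3 < k).le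
      · have : (k : ℝ) < ((⌊a⌋ + 3 : ℤ) : ℝ) := by push_cast; linarith
        exact (by exact_mod_cast this : k < ⌊a⌋ + 3).le
    refine ((Set.finite_Icc (⌊p.1⌋ - 3) (⌊p.1⌋ + 3)).prod
      (Set.finite_Icc (⌊p.2⌋ - 3) (⌊p.2⌋ + 3))).subset ?_
    rintro x ⟨z, hz, ⟨h1, h2⟩, h3, h4⟩
    obtain ⟨h5, h6⟩ := hb x z hz
    exact ⟨key _ _ _ h5 h1 h2, key _ _ _ h6 h3 h4⟩
  have h1 := hfin (fun x => {a : ℝ × ℝ | L.vert x ≠ 0 ∧ a.1 = x.1 + 1 / 2 ∧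
      (x.2 : ℝ) - 1 / 2 ≤ a.2 ∧ a.2 ≤ x.2 + 1 / 2})
    (fun x => (isClosed_const.and ((isClosed_eq (by fun_prop) (by fun_prop)).and
      ((isClosed_le (by fun_prop) (by fun_prop)).and (isClosed_le (by fun_prop) (by fun_prop))))))
    (fun x p ⟨_, h1, h2, h3⟩ => by
      constructor <;> rw [abs_le] <;> constructor <;> linarith)
  have h2 := hfin (fun x => {a : ℝ × ℝ | L.horiz x ≠ 0 ∧ a.2 = x.2 + 1 / 2 ∧
      (x.1 : ℝ) - 1 / 2 ≤ a.1 ∧ a.1 ≤ x.1 + 1 / 2})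
    (fun x => (isClosed_const.and ((isClosed_eq (by fun_prop) (by fun_prop)).and
      ((isClosed_le (by fun_prop) (by fun_prop)).and (isClosed_le (by fun_prop) (by fun_prop))))))
    (fun x p ⟨_, h1, h2, h3⟩ => by
      constructor <;> rw [abs_le] <;> constructor <;> linarith)
  convert h1.union h2 using 1
  ext p
  simp [edgeSet]

namespace Pocket

variable {L} {y : ℤ × ℤ} (P : L.Pocket y)

/-- The depths (distances, along the diagonal direction, below the upper right vertex of `y`) that
occur in the pocket. -/
def depths : Set ℝ := {τ | 0 < τ ∧ ∀ i : ℕ, 1 ≤ i → (i : ℝ) ≤ τ → P.l i < P.r i}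

/-- The open region of the plane between the two bounding paths. -/
def region : Set (ℝ × ℝ) :=
  {p | (y.1 + y.2 + 1 - p.1 - p.2 : ℝ) ∈ P.depths ∧
    interp P.l (y.1 + y.2 + 1 - p.1 - p.2) < p.1 - 1 / 2 ∧
    p.1 - 1 / 2 < interp P.r (y.1 + y.2 + 1 - p.1 - p.2)}

theorem convex_depths : Convex ℝ P.depths := by
  refine Set.OrdConnected.convex ⟨?_⟩
  rintro a ⟨ha, -⟩ b ⟨-, hb⟩ c ⟨h1, h2⟩
  exact ⟨by linarith, fun i hi hic => hb i hi (by linarith)⟩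

theorem one_mem_depths : 1 ∈ P.depths := by
  refine ⟨one_pos, fun i h1 h2 => ?_⟩
  have : i = 1 := le_antisymm (by exact_mod_cast h2) h1
  rw [this, P.l_one, P.r_one]; omega

theorem isOpen_depths : IsOpen P.depths := by
  refine isOpen_iff_mem_nhds.2 fun τ hτ => ?_
  filter_upwards [Ioi_mem_nhds hτ.1, Iio_mem_nhds (Nat.lt_floor_add_one τ)] with σ h1 h2
  refine ⟨h1, fun i hi hiσ => hτ.2 i hi ?_⟩
  have : (i : ℝ) < ((⌊τ⌋₊ + 1 : ℕ) : ℝ) := by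
    push_cast; exact lt_of_le_of_lt hiσ h2
  have h3 : i ≤ ⌊τ⌋₊ := Nat.lt_succ_iff.1 (by exact_mod_cast this)
  exact (Nat.le_floor_iff hτ.1.le).1 h3

theorem interp_lt (τ : ℝ) (hτ : τ ∈ P.depths) : interp P.l τ < interp P.r τ := by
  have h1 : (⌊τ⌋₊ : ℝ) ≤ τ := Nat.floor_le hτ.1.le
  have h2 := Nat.lt_floor_add_one τ
  have h0 := hτ.1
  set j := ⌊τ⌋₊ with hj
  rw [interp_of_mem _ j h1 h2.le, interp_of_mem _ j h1 h2.le]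
  rcases Nat.eq_zero_or_pos j with h | h
  · rw [h, P.l_zero, P.r_zero, zero_add, P.l_one, P.r_one]
    push_cast
    have : (j : ℝ) = 0 := by exact_mod_cast h
    nlinarith
  · have h3 := hτ.2 j h h1
    have h4 : P.l (j + 1) ≤ P.r (j + 1) := by
      have := P.l_path.step j
      have := P.r_path.step j
      omega
    have h3' : (P.l j : ℝ) < P.r j := by exact_mod_cast h3
    have h4' : (P.l (j + 1) : ℝ) ≤ P.r (j + 1) := by exact_mod_cast h4
    nlinarith [mul_pos (sub_pos.2 h3') (show 0 < 1 - (τ - j) by linarith),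
      mul_nonneg (sub_nonneg.2 h4') (show 0 ≤ τ - j by linarith)]

theorem isOpen_region : IsOpen P.region := by
  have h1 := continuous_interp P.l
  have h2 := continuous_interp P.r
  have h3 : Continuous fun p : ℝ × ℝ => (y.1 + y.2 + 1 - p.1 - p.2 : ℝ) := by fun_prop
  have h4 : Continuous fun p : ℝ × ℝ => p.1 - 1 / 2 := by fun_prop
  exact (P.isOpen_depths.preimage h3).inter
    ((isOpen_lt (h1.comp h3) h4).inter (isOpen_lt h4 (h2.comp h3)))

/-- Depth and horizontal coordinate as coordinates of the plane. -/
def shear (T : ℤ) : ℝ × ℝ ≃ₜ ℝ × ℝ where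
  toFun p := (T + 1 - p.1 - p.2, p.1 - 1 / 2)
  invFun q := (q.2 + 1 / 2, T + 1 - q.1 - (q.2 + 1 / 2))
  left_inv p := by ext <;> simp; ring
  right_inv q := by ext <;> simp
  continuous_toFun := by fun_prop
  continuous_invFun := by fun_prop

instance contractibleSpace_region : ContractibleSpace P.region := by
  have := contractibleSpace_between P.convex_depths ⟨1, P.one_mem_depths⟩
    (continuous_interp P.l) (continuous_interp P.r) P.interp_lt
  refine ((shear (y.1 + y.2)).sets (s := P.region) (t := _) ?_).contractibleSpace
    (Y := {q : ℝ × ℝ | q.1 ∈ P.depths ∧ interp P.l q.1 < q.2 ∧ q.2 < interp P.r q.1})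
  ext p
  simp [region, shear]

theorem isPreconnected_region : IsPreconnected P.region :=
  isPreconnected_iff_preconnectedSpace.2 inferInstance

theorem face_mem_region : ((y.1 : ℝ), (y.2 : ℝ)) ∈ P.region := by
  have e : (y.1 + y.2 + 1 - (y.1 : ℝ) - (y.2 : ℝ)) = 1 := by ring
  refine ⟨by rw [e]; exact P.one_mem_depths, ?_, ?_⟩
  · rw [e, interp_of_mem _ 1 (by norm_num) (by norm_num), P.l_one]; norm_num
  · rw [e, interp_of_mem _ 1 (by norm_num) (by norm_num), P.r_one]; norm_num

theorem disjoint_region_edgeSet : Disjoint P.region L.edgeSet := by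
  rw [Set.disjoint_left]
  rintro p ⟨hI, hl, hr⟩ hp
  obtain ⟨v, ε, s, hv, hs0, hs1, rfl⟩ := (L.mem_edgeSet_iff p).1 hp
  have e : ((y.1 : ℝ) + y.2 + 1 - ((v.1 : ℝ) + 1 / 2 - ε * s) - ((v.2 : ℝ) + 1 / 2 - (1 - ε) * s))
      = ((y.1 + y.2 - v.1 - v.2 : ℤ) : ℝ) + s := by push_cast; ring
  simp only at hI hl hr
  rw [e] at hI hl hr
  have hk : -1 < y.1 + y.2 - v.1 - v.2 := by
    have h0 := hI.1
    have : (-1 : ℝ) < ((y.1 + y.2 - v.1 - v.2 : ℤ) : ℝ) := by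
      by_contra hcon
      linarith
    exact_mod_cast this
  obtain ⟨j, hj⟩ := Int.eq_ofNat_of_zero_le (show 0 ≤ y.1 + y.2 - v.1 - v.2 by omega)
  rw [hj] at hI hl hr
  rw [Int.cast_natCast] at hI hl hr
  rw [interp_of_mem _ j (by linarith) (by linarith)] at hl hr
  have hv' : L.InEdge ε (v.1, y.1 + y.2 - j - v.1) := by
    convert hv using 1
    ext <;> simp; omega
  rcases P.edge_outside j
      (fun i h1 h2 => hI.2 i h1 ((Nat.cast_le.2 h2).trans (by linarith))) _ _ hv'
    with ⟨h1, h2⟩ | ⟨h1, h2⟩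
  · have h1' : (v.1 : ℝ) ≤ P.l j := by exact_mod_cast h1
    have h2' : (v.1 - ε : ℝ) ≤ P.l (j + 1) := by exact_mod_cast h2
    nlinarith [mul_le_mul_of_nonneg_left h1' (sub_nonneg.2 hs1),
      mul_le_mul_of_nonneg_left h2' hs0]
  · have h1' : (P.r j : ℝ) ≤ v.1 := by exact_mod_cast h1
    have h2' : (P.r (j + 1) : ℝ) ≤ v.1 - ε := by exact_mod_cast h2
    nlinarith [mul_le_mul_of_nonneg_left h1' (sub_nonneg.2 hs1),
      mul_le_mul_of_nonneg_left h2' hs0]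

/-- Both bounding paths run along non-zero edges. -/
theorem _root_.KleinianFiber.Config.IsBackPath.mem_edgeSet {T : ℤ} {a : ℕ → ℤ}
    (h : L.IsBackPath T a) {p : ℝ × ℝ} (h0 : 0 ≤ T + 1 - p.1 - p.2)
    (hp : p.1 - 1 / 2 = interp a (T + 1 - p.1 - p.2)) : p ∈ L.edgeSet := by
  set τ := (T : ℝ) + 1 - p.1 - p.2 with hτ
  have h1 : (⌊τ⌋₊ : ℝ) ≤ τ := Nat.floor_le h0
  have h2 := Nat.lt_floor_add_one τ
  set j := ⌊τ⌋₊
  rw [interp_of_mem _ j h1 h2.le] at hp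
  refine (L.mem_edgeSet_iff p).2 ⟨_, _, τ - j, h j, by linarith, by linarith, ?_⟩
  have e1 : p.1 = 1 / 2 + (a j + (τ - j) * (a (j + 1) - a j)) := by linarith
  have e2 : p.2 = T + 1 - τ - p.1 := by rw [hτ]; ring
  ext
  · rw [e1]; push_cast; ring
  · rw [e2, e1]; push_cast; ring

theorem closure_region_diff : closure P.region ∩ L.edgeSetᶜ ⊆ P.region := by
  rintro p ⟨hp, hΩ⟩
  have hcl := continuous_interp P.l
  have hcr := continuous_interp P.r
  set d : ℝ × ℝ → ℝ := fun p => y.1 + y.2 + 1 - p.1 - p.2 with hd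
  have hdc : Continuous d := by fun_prop
  -- weak forms of the defining inequalities persist in the closure
  have h0 : 0 ≤ d p := closure_minimal (s := P.region) (t := {p | 0 ≤ d p})
    (fun q hq => hq.1.1.le) (isClosed_le (by fun_prop) (by fun_prop)) hp
  have hl : interp P.l (d p) ≤ p.1 - 1 / 2 :=
    closure_minimal (s := P.region) (t := {p | interp P.l (d p) ≤ p.1 - 1 / 2})
    (fun q hq => hq.2.1.le) (isClosed_le (by fun_prop) (by fun_prop)) hp
  have hr : p.1 - 1 / 2 ≤ interp P.r (d p) :=
    closure_minimal (s := P.region) (t := {p | p.1 - 1 / 2 ≤ interp P.r (d p)})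
    (fun q hq => hq.2.2.le) (isClosed_le (by fun_prop) (by fun_prop)) hp
  have hcast : (((y.1 + y.2 : ℤ) : ℝ) + 1 - p.1 - p.2) = d p := by push_cast; rfl
  have hnl : p.1 - 1 / 2 ≠ interp P.l (d p) := fun h =>
    hΩ (P.l_path.mem_edgeSet (by rw [hcast]; exact h0) (by rw [hcast]; exact h))
  have hnr : p.1 - 1 / 2 ≠ interp P.r (d p) := fun h =>
    hΩ (P.r_path.mem_edgeSet (by rw [hcast]; exact h0) (by rw [hcast]; exact h))
  refine ⟨⟨lt_of_le_of_ne h0 fun h => ?_, fun i hi hid => ?_⟩, lt_of_le_of_ne hl hnl.symm,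
    lt_of_le_of_ne hr hnr⟩
  · -- at depth zero both paths are at the upper right vertex
    change 0 = d p at h
    rw [← h, interp_of_mem _ 0 (by simp) (by simp)] at hl hr hnl
    simp only [P.l_zero, P.r_zero] at hl hr hnl
    simp only [Nat.cast_zero, sub_zero, zero_mul, add_zero] at hl hr hnl
    exact hnl (le_antisymm hr hl)
  · change (i : ℝ) ≤ d p at hid
    rcases hid.lt_or_eq with hlt | heq
    · obtain ⟨q, hq1, hq2⟩ := mem_closure_iff.1 hp _ (isOpen_lt continuous_const hdc) hlt
      exact hq2.1.2 i hi hq1.le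
    · by_contra hcon
      have hcon' : (P.r i : ℝ) ≤ P.l i := by exact_mod_cast not_lt.1 hcon
      rw [← heq, interp_of_mem _ i le_rfl (by simp)] at hl hr hnl
      simp only [sub_self, zero_mul, add_zero] at hl hr hnl
      exact hnl (by linarith)

/-- A connected subset of the complement of the configuration that meets a pocket lies in it. -/
theorem subset_region {s : Set (ℝ × ℝ)} (hs : IsPreconnected s) (hsΩ : Disjoint s L.edgeSet)
    (hne : (s ∩ P.region).Nonempty) : s ⊆ P.region := by
  refine hs.subset_left_of_subset_union P.isOpen_region isClosed_closure.isOpen_compl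
    (Set.disjoint_compl_right_iff_subset.2 subset_closure) (fun p hp => ?_) hne
  by_cases h : p ∈ closure P.region
  · exact .inl (P.closure_region_diff ⟨h, fun h' => Set.disjoint_left.1 hsΩ hp h'⟩)
  · exact .inr h

end Pocket

end Config

/-! ### Components of the cylinder and walks between faces -/

namespace Config

variable {m n : ℕ} (L : Config m n)

/-- Two faces are adjacent if they share an edge with label zero. -/
def Adj (x z : ℤ × ℤ) : Prop :=
  (z = x + (1, 0) ∧ L.vert x = 0) ∨ (z = x + (0, 1) ∧ L.horiz x = 0) ∨
    (x = z + (1, 0) ∧ L.vert z = 0) ∨ (x = z + (0, 1) ∧ L.horiz z = 0)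

/-- There is a walk between two faces that crosses only edges with label zero. -/
def Reach : ℤ × ℤ → ℤ × ℤ → Prop := Relation.ReflTransGen L.Adj

theorem Adj.symm {L : Config m n} {x z : ℤ × ℤ} (h : L.Adj x z) : L.Adj z x := by
  unfold Adj at *; tauto

theorem Reach.symm {L : Config m n} {x z : ℤ × ℤ} (h : L.Reach x z) : L.Reach z x := by
  induction h with
  | refl => exact .refl
  | tail _ h ih => exact .head h.symm ih

/-- The midpoint of a face in the plane. -/
def facePt (x : ℤ × ℤ) : ℝ × ℝ := ((x.1 : ℝ), (x.2 : ℝ))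

theorem disjoint_segment_right {x : ℤ × ℤ} (h : L.vert x = 0) :
    Disjoint (segment ℝ (facePt x) (facePt (x + (1, 0)))) L.edgeSet := by
  rw [Set.disjoint_left]
  rintro p hp hE
  rw [segment_eq_image_lineMap] at hp
  obtain ⟨t, ⟨h0, h1⟩, rfl⟩ := hp
  simp only [AffineMap.lineMap_apply, facePt, edgeSet, Set.mem_union, Set.mem_ofPred_eq,
    Prod.fst_add, Prod.snd_add, vsub_eq_sub, vadd_eq_add, Prod.fst_sub, Prod.snd_sub, Prod.smul_fst,
    Prod.smul_snd, smul_eq_mul, Int.cast_add, Int.cast_one, add_zero, sub_self,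
    mul_zero, zero_add, add_sub_cancel_left, mul_one] at hE
  rcases hE with ⟨z, hz, h2, h3, h4⟩ | ⟨z, hz, h2, h3, h4⟩
  · have e1 : z.2 = x.2 := by
      have a1 : (z.2 : ℝ) < x.2 + 1 := by linarith
      have a2 : (x.2 : ℝ) < z.2 + 1 := by linarith
      have a1' : z.2 < x.2 + 1 := by exact_mod_cast a1
      have a2' : x.2 < z.2 + 1 := by exact_mod_cast a2
      omega
    have e2 : z.1 = x.1 := by
      have a1 : (z.1 : ℝ) < x.1 + 1 := by linarith
      have a2 : (x.1 : ℝ) < z.1 + 1 := by linarith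
      have a1' : z.1 < x.1 + 1 := by exact_mod_cast a1
      have a2' : x.1 < z.1 + 1 := by exact_mod_cast a2
      omega
    exact hz (by rwa [Prod.ext e2 e1])
  · have a1 : (2 * x.2 : ℝ) = 2 * z.2 + 1 := by linarith
    have a2 : 2 * x.2 = 2 * z.2 + 1 := by exact_mod_cast a1
    omega

theorem disjoint_segment_up {x : ℤ × ℤ} (h : L.horiz x = 0) :
    Disjoint (segment ℝ (facePt x) (facePt (x + (0, 1)))) L.edgeSet := by
  rw [Set.disjoint_left]
  rintro p hp hE
  rw [segment_eq_image_lineMap] at hp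
  obtain ⟨t, ⟨h0, h1⟩, rfl⟩ := hp
  simp only [AffineMap.lineMap_apply, facePt, edgeSet, Set.mem_union, Set.mem_ofPred_eq,
    Prod.fst_add, Prod.snd_add, vsub_eq_sub, vadd_eq_add, Prod.fst_sub, Prod.snd_sub, Prod.smul_fst,
    Prod.smul_snd, smul_eq_mul, Int.cast_add, Int.cast_one, add_zero, sub_self,
    mul_zero, zero_add, add_sub_cancel_left, mul_one] at hE
  rcases hE with ⟨z, hz, h2, h3, h4⟩ | ⟨z, hz, h2, h3, h4⟩
  · have a1 : (2 * x.1 : ℝ) = 2 * z.1 + 1 := by linarith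
    have a2 : 2 * x.1 = 2 * z.1 + 1 := by exact_mod_cast a1
    omega
  · have e1 : z.1 = x.1 := by
      have a1 : (z.1 : ℝ) < x.1 + 1 := by linarith
      have a2 : (x.1 : ℝ) < z.1 + 1 := by linarith
      have a1' : z.1 < x.1 + 1 := by exact_mod_cast a1
      have a2' : x.1 < z.1 + 1 := by exact_mod_cast a2
      omega
    have e2 : z.2 = x.2 := by
      have a1 : (z.2 : ℝ) < x.2 + 1 := by linarith
      have a2 : (x.2 : ℝ) < z.2 + 1 := by linarith
      have a1' : z.2 < x.2 + 1 := by exact_mod_cast a1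
      have a2' : x.2 < z.2 + 1 := by exact_mod_cast a2
      omega
    exact hz (by rwa [Prod.ext e1 e2])

theorem Adj.disjoint_segment {L : Config m n} {x z : ℤ × ℤ} (h : L.Adj x z) :
    Disjoint (segment ℝ (facePt x) (facePt z)) L.edgeSet := by
  rcases h with ⟨rfl, h⟩ | ⟨rfl, h⟩ | ⟨rfl, h⟩ | ⟨rfl, h⟩
  · exact L.disjoint_segment_right h
  · exact L.disjoint_segment_up h
  · rw [segment_symm]; exact L.disjoint_segment_right h
  · rw [segment_symm]; exact L.disjoint_segment_up h

theorem Pocket.facePt_mem_of_reach {L : Config m n} {y x z : ℤ × ℤ} (P : L.Pocket y)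
    (hx : facePt x ∈ P.region) (h : L.Reach x z) : facePt z ∈ P.region := by
  induction h with
  | refl => exact hx
  | tail _ h ih =>
    exact P.subset_region (convex_segment _ _).isPreconnected h.disjoint_segment
      ⟨_, left_mem_segment _ _ _, ih⟩ (right_mem_segment _ _ _)

/-- A face whose right and upper edges both have non-zero labels bounds a pocket, so no walk from
it can go around the cylinder. -/
theorem not_reach_period (hm : 0 < m) {y : ℤ × ℤ} (hv : L.vert y ≠ 0) (hh : L.horiz y ≠ 0) :
    ¬ L.Reach y (y + ((m : ℤ), (n : ℤ))) := by
  intro h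
  obtain ⟨P⟩ := L.exists_pocket y hv hh
  have h1 := (P.facePt_mem_of_reach P.face_mem_region h).1.1
  simp only [facePt, Prod.fst_add, Prod.snd_add, Int.cast_add, Int.cast_natCast] at h1
  have h2 : (1 : ℝ) ≤ m := by exact_mod_cast hm
  have h3 : (0 : ℝ) ≤ n := n.cast_nonneg
  linarith

theorem vert_add_zsmul (x : ℤ × ℤ) (k : ℤ) : L.vert (x + k • ((m : ℤ), (n : ℤ))) = L.vert x :=
  Function.Periodic.zsmul (f := L.vert) L.vert_periodic k x

theorem horiz_add_zsmul (x : ℤ × ℤ) (k : ℤ) : L.horiz (x + k • ((m : ℤ), (n : ℤ))) = L.horiz x :=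
  Function.Periodic.zsmul (f := L.horiz) L.horiz_periodic k x

theorem add_zsmul_mem_edgeSet {p : ℝ × ℝ} (k : ℤ) (hp : p ∈ L.edgeSet) :
    p + k • ((m : ℝ), (n : ℝ)) ∈ L.edgeSet := by
  rcases hp with ⟨x, hx, h1, h2, h3⟩ | ⟨x, hx, h1, h2, h3⟩
  · refine .inl ⟨x + k • ((m : ℤ), (n : ℤ)), by rwa [vert_add_zsmul], ?_, ?_, ?_⟩ <;>
      simp <;> linarith
  · refine .inr ⟨x + k • ((m : ℤ), (n : ℤ)), by rwa [horiz_add_zsmul], ?_, ?_, ?_⟩ <;>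
      simp <;> linarith

theorem mk_eq_mk_iff (p q : ℝ × ℝ) :
    (QuotientAddGroup.mk p : Cylinder m n) = QuotientAddGroup.mk q ↔
      ∃ k : ℤ, q = p + k • ((m : ℝ), (n : ℝ)) := by
  rw [QuotientAddGroup.eq, AddSubgroup.mem_zmultiples_iff]
  refine exists_congr fun k => ?_
  constructor
  · intro h; rw [h]; abel
  · intro h; rw [h]; abel

theorem mk_mem_edgeSetBar_iff (p : ℝ × ℝ) :
    (QuotientAddGroup.mk p : Cylinder m n) ∈ L.edgeSetBar ↔ p ∈ L.edgeSet := by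
  constructor
  · rintro ⟨q, hq, h⟩
    obtain ⟨k, rfl⟩ := (mk_eq_mk_iff q p).1 h
    exact L.add_zsmul_mem_edgeSet k hq
  · exact fun h => ⟨p, h, rfl⟩

theorem Adj.component_eq {L : Config m n} {x z : ℤ × ℤ} (h : L.Adj x z) :
    L.component x = L.component z := by
  have hc : Continuous (QuotientAddGroup.mk : ℝ × ℝ → Cylinder m n) :=
    QuotientAddGroup.continuous_mk
  have hpre : IsPreconnected ((QuotientAddGroup.mk : ℝ × ℝ → Cylinder m n) ''
      segment ℝ (facePt x) (facePt z)) :=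
    (convex_segment _ _).isPreconnected.image _ hc.continuousOn
  refine connectedComponentIn_eq (hpre.subset_connectedComponentIn
    (Set.mem_image_of_mem _ (left_mem_segment _ _ _)) ?_
    (Set.mem_image_of_mem _ (right_mem_segment _ _ _)))
  rintro _ ⟨p, hp, rfl⟩ hE
  exact Set.disjoint_left.1 h.disjoint_segment hp ((L.mk_mem_edgeSetBar_iff p).1 hE)

theorem Reach.component_eq {L : Config m n} {x z : ℤ × ℤ} (h : L.Reach x z) :
    L.component x = L.component z := by
  induction h with
  | refl => rfl
  | tail _ h ih => rw [ih, h.component_eq]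

namespace Pocket

variable {L} {y : ℤ × ℤ} (P : L.Pocket y)

/-- The translates of a pocket by non-zero multiples of the period are disjoint from it: a
translate that meets the pocket lies in it, but the depth of a translated face is too small. -/
theorem region_translate (hm : 0 < m) {p : ℝ × ℝ} (hp : p ∈ P.region) (k : ℤ)
    (hk : p + k • ((m : ℝ), (n : ℝ)) ∈ P.region) : k = 0 := by
  have hm' : (1 : ℝ) ≤ m := by exact_mod_cast hm
  have hn' : (0 : ℝ) ≤ n := n.cast_nonneg
  have main : ∀ (k : ℤ) (p : ℝ × ℝ), 0 < k → p ∈ P.region →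
      p + k • ((m : ℝ), (n : ℝ)) ∈ P.region → False := by
    intro k p hk hp hpk
    have hpre : IsPreconnected ((fun q => q + k • ((m : ℝ), (n : ℝ))) '' P.region) :=
      P.isPreconnected_region.image _ (by fun_prop)
    have hsub := P.subset_region hpre ?_ ⟨_, Set.mem_image_of_mem _ hp, hpk⟩
    · have h1 := (hsub (Set.mem_image_of_mem _ P.face_mem_region)).1.1
      have hk' : (1 : ℝ) ≤ k := by exact_mod_cast hk
      simp at h1
      nlinarith
    · rw [Set.disjoint_left]
      rintro _ ⟨q, hq, rfl⟩ hE
      have := L.add_zsmul_mem_edgeSet (-k) hE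
      simp only [neg_smul, add_neg_cancel_right] at this
      exact Set.disjoint_left.1 P.disjoint_region_edgeSet hq this
  rcases lt_trichotomy k 0 with h | h | h
  · refine (main (-k) _ (by omega) hk ?_).elim
    rwa [neg_smul, add_neg_cancel_right]
  · exact h
  · exact (main k p h hp hk).elim

theorem component_eq :
    L.component y = (QuotientAddGroup.mk : ℝ × ℝ → Cylinder m n) '' P.region := by
  have hc : Continuous (QuotientAddGroup.mk : ℝ × ℝ → Cylinder m n) :=
    QuotientAddGroup.continuous_mk
  have ho : IsOpenMap (QuotientAddGroup.mk : ℝ × ℝ → Cylinder m n) :=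
    QuotientAddGroup.isOpenMap_coe
  have hsub : (QuotientAddGroup.mk : ℝ × ℝ → Cylinder m n) '' P.region ⊆ L.edgeSetBarᶜ := by
    rintro _ ⟨p, hp, rfl⟩ hE
    exact Set.disjoint_left.1 P.disjoint_region_edgeSet hp ((L.mk_mem_edgeSetBar_iff p).1 hE)
  have hmem : facePoint m n y ∈ (QuotientAddGroup.mk : ℝ × ℝ → Cylinder m n) '' P.region :=
    ⟨_, P.face_mem_region, rfl⟩
  refine Set.Subset.antisymm ?_
    ((P.isPreconnected_region.image _ hc.continuousOn).subset_connectedComponentIn hmem hsub)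
  -- the points of the complement all of whose lifts are outside the pocket form an open set
  set V : Set (ℝ × ℝ) := {p | p ∉ L.edgeSet ∧ ∀ k : ℤ, p + k • ((m : ℝ), (n : ℝ)) ∉ P.region}
  have hV : IsOpen V := by
    refine Metric.isOpen_iff.2 ?_
    rintro p ⟨hpE, hpk⟩
    obtain ⟨ε, hε, hball⟩ := Metric.isOpen_iff.1 L.isClosed_edgeSet.isOpen_compl p hpE
    refine ⟨ε, hε, fun q hq => ⟨hball hq, fun k hk => hpk k ?_⟩⟩
    have hpre : IsPreconnected ((fun q => q + k • ((m : ℝ), (n : ℝ))) '' Metric.ball p ε) :=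
      (convex_ball p ε).isPreconnected.image _ (by fun_prop)
    refine P.subset_region hpre ?_ ⟨_, Set.mem_image_of_mem _ hq, hk⟩
      (Set.mem_image_of_mem _ (Metric.mem_ball_self hε))
    rw [Set.disjoint_left]
    rintro _ ⟨q, hq, rfl⟩ hE
    have := L.add_zsmul_mem_edgeSet (-k) hE
    simp only [neg_smul, add_neg_cancel_right] at this
    exact hball hq this
  refine isPreconnected_connectedComponentIn.subset_left_of_subset_union (ho _ P.isOpen_region)
    (ho _ hV) ?_ ?_ ⟨_, mem_connectedComponentIn (hsub hmem), hmem⟩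
  · rw [Set.disjoint_left]
    rintro _ ⟨p, hp, rfl⟩ ⟨q, hq, h⟩
    obtain ⟨k, rfl⟩ := (mk_eq_mk_iff q p).1 h
    exact hq.2 k hp
  · intro z hz
    obtain ⟨p, rfl⟩ := QuotientAddGroup.mk_surjective z
    by_cases h : ∃ k : ℤ, p + k • ((m : ℝ), (n : ℝ)) ∈ P.region
    · obtain ⟨k, hk⟩ := h
      exact .inl ⟨_, hk, ((mk_eq_mk_iff _ _).2 ⟨k, rfl⟩).symm⟩
    · refine .inr ⟨p, ⟨fun hE => ?_, not_exists.1 h⟩, rfl⟩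
      exact connectedComponentIn_subset _ _ hz ((L.mk_mem_edgeSetBar_iff p).2 hE)

theorem contractibleSpace_component (P : L.Pocket y) (hm : 0 < m) :
    ContractibleSpace (L.component y) := by
  have ho : IsOpenMap (QuotientAddGroup.mk : ℝ × ℝ → Cylinder m n) :=
    QuotientAddGroup.isOpenMap_coe
  have hc : Continuous (QuotientAddGroup.mk : ℝ × ℝ → Cylinder m n) :=
    QuotientAddGroup.continuous_mk
  have he : Topology.IsOpenEmbedding
      (P.region.domRestrict (QuotientAddGroup.mk : ℝ × ℝ → Cylinder m n)) := by
    refine .of_continuous_injective_isOpenMap (hc.comp continuous_subtype_val) ?_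
      (ho.domRestrict P.isOpen_region)
    rintro ⟨p, hp⟩ ⟨q, hq⟩ h
    obtain ⟨k, rfl⟩ := (mk_eq_mk_iff p q).1 h
    simp [P.region_translate hm hp k hq]
  have := he.isEmbedding.toHomeomorph.contractibleSpace_iff.1 P.contractibleSpace_region
  rw [Set.range_domRestrict, ← P.component_eq] at this
  exact this

end Pocket

/-- From a face in an incontractible component no walk leads to a face whose right and upper
edges both have non-zero labels. -/
theorem InIncontractible.vert_eq_zero_or {L : Config m n} (hm : 0 < m) {x z : ℤ × ℤ}
    (hx : L.InIncontractible x) (h : L.Reach x z) : L.vert z = 0 ∨ L.horiz z = 0 := by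
  by_contra! hcon
  obtain ⟨P⟩ := L.exists_pocket z hcon.1 hcon.2
  refine hx ?_
  rw [h.component_eq]
  exact P.contractibleSpace_component hm

/-- The configuration rotated by 180 degrees. -/
def rotate : Config m n where
  vert x := L.vert (-x - (1, 0))
  horiz x := L.horiz (-x - (0, 1))
  vert_periodic e := by
    rw [← L.vert_add_zsmul _ 1]; congr 1; ext <;> simp <;> ring
  horiz_periodic e := by
    rw [← L.horiz_add_zsmul _ 1]; congr 1; ext <;> simp <;> ring
  vert_finite e := by
    obtain ⟨K, hK⟩ := L.vert_finite (-e - (1, 0))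
    refine ⟨K, fun k hk => ?_⟩
    rw [← hK (-k) (by rwa [abs_neg])]; congr 1; ext <;> simp <;> ring
  horiz_finite e := by
    obtain ⟨K, hK⟩ := L.horiz_finite (-e - (0, 1))
    refine ⟨K, fun k hk => ?_⟩
    rw [← hK (-k) (by rwa [abs_neg])]; congr 1; ext <;> simp <;> ring
  ice x y := by
    have := L.ice (-x - 1) (-y - 1)
    have e1 : -((x, y) : ℤ × ℤ) - (0, 1) = (-x - 1 + 1, -y - 1) := by ext <;> simp
    have e2 : -((x, y) : ℤ × ℤ) - (1, 0) = (-x - 1, -y - 1 + 1) := by ext <;> simp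
    have e3 : -((x + 1, y) : ℤ × ℤ) - (0, 1) = (-x - 1, -y - 1) := by ext <;> simp; ring
    have e4 : -((x, y + 1) : ℤ × ℤ) - (1, 0) = (-x - 1, -y - 1) := by ext <;> simp; ring
    rw [e1, e2, e3, e4]
    omega

theorem Adj.rotate {L : Config m n} {x z : ℤ × ℤ} (h : L.Adj x z) : L.rotate.Adj (-x) (-z) := by
  have key : ∀ x d : ℤ × ℤ, -(-(x + d)) - d = x := fun x d => by rw [neg_neg, add_sub_cancel_right]
  have key' : ∀ x d : ℤ × ℤ, -x = -(x + d) + d := fun x d => by rw [neg_add, neg_add_cancel_right]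
  rcases h with ⟨rfl, h⟩ | ⟨rfl, h⟩ | ⟨rfl, h⟩ | ⟨rfl, h⟩
  · exact .inr (.inr (.inl ⟨key' _ _, by simpa only [Config.rotate, key] using h⟩))
  · exact .inr (.inr (.inr ⟨key' _ _, by simpa only [Config.rotate, key] using h⟩))
  · exact .inl ⟨key' _ _, by simpa only [Config.rotate, key] using h⟩
  · exact .inr (.inl ⟨key' _ _, by simpa only [Config.rotate, key] using h⟩)

theorem Reach.rotate {L : Config m n} {x z : ℤ × ℤ} (h : L.Reach x z) :
    L.rotate.Reach (-x) (-z) := by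
  induction h with
  | refl => exact .refl
  | tail _ h ih => exact ih.tail h.rotate

theorem Adj.translate {L : Config m n} {x z : ℤ × ℤ} (h : L.Adj x z) (k : ℤ) :
    L.Adj (x + k • ((m : ℤ), (n : ℤ))) (z + k • ((m : ℤ), (n : ℤ))) := by
  rcases h with ⟨rfl, h⟩ | ⟨rfl, h⟩ | ⟨rfl, h⟩ | ⟨rfl, h⟩
  · exact .inl ⟨add_right_comm _ _ _, by rwa [vert_add_zsmul]⟩
  · exact .inr (.inl ⟨add_right_comm _ _ _, by rwa [horiz_add_zsmul]⟩)
  · exact .inr (.inr (.inl ⟨add_right_comm _ _ _, by rwa [vert_add_zsmul]⟩))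
  · exact .inr (.inr (.inr ⟨add_right_comm _ _ _, by rwa [horiz_add_zsmul]⟩))

theorem Reach.translate {L : Config m n} {x z : ℤ × ℤ} (h : L.Reach x z) (k : ℤ) :
    L.Reach (x + k • ((m : ℤ), (n : ℤ))) (z + k • ((m : ℤ), (n : ℤ))) := by
  induction h with
  | refl => exact .refl
  | tail _ h ih => exact ih.tail (h.translate k)

/-- If every face can be reached from its translate by the period, then the configuration is
five-vertex: at a vertex with three non-zero edges, both incoming or both outgoing edges are
non-zero, and the face between them bounds a pocket. -/
theorem isFiveVertex_of_reach (hm : 0 < m) (h : ∀ y, L.Reach y (y + ((m : ℤ), (n : ℤ)))) :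
    L.IsFiveVertex := by
  intro x y
  have h1 : L.vert (x, y) = 0 ∨ L.horiz (x, y) = 0 := by
    by_contra! hcon
    exact L.not_reach_period hm hcon.1 hcon.2 (h _)
  have h2 : L.vert (x, y + 1) = 0 ∨ L.horiz (x + 1, y) = 0 := by
    by_contra! hcon
    refine L.rotate.not_reach_period hm (y := (-x - 1, -y - 1)) ?_ ?_ ?_
    · have e : -((-x - 1, -y - 1) : ℤ × ℤ) - (1, 0) = (x, y + 1) := by ext <;> simp; ring
      exact fun h => hcon.1 (e ▸ h)
    · have e : -((-x - 1, -y - 1) : ℤ × ℤ) - (0, 1) = (x + 1, y) := by ext <;> simp; ring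
      exact fun h => hcon.2 (e ▸ h)
    · convert ((h (x + 1, y + 1)).translate (-1)).symm.rotate using 1 <;> ext <;> simp <;> ring
  have h3 := L.ice x y
  rw [← Multiset.countP_eq_card_filter]
  simp only [Multiset.insert_eq_cons, Multiset.countP_cons, ← Multiset.cons_zero,
    Multiset.countP_zero]
  split_ifs <;> omega

theorem IsFiveVertex.vert_eq_zero_or {L : Config m n} (h : L.IsFiveVertex) (z : ℤ × ℤ) :
    L.vert z = 0 ∨ L.horiz z = 0 := by
  obtain ⟨x, y⟩ := z
  have h2 := h x y
  have h3 := L.ice x y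
  rw [← Multiset.countP_eq_card_filter] at h2
  simp only [Multiset.insert_eq_cons, Multiset.countP_cons, ← Multiset.cons_zero,
    Multiset.countP_zero] at h2
  split_ifs at h2 <;> omega

end Config

/-! ### The height function -/

namespace Config

variable {m n : ℕ} (L : Config m n)

/-- The height of a face: the sum of the labels of all horizontal edges above it. It changes by
the label of each edge that a walk crosses, with opposite signs for vertical and horizontal
edges. -/
def height (x : ℤ × ℤ) : ℤ := ∑ᶠ t : ℕ, (L.horiz (x + (0, (t : ℤ))) : ℤ)

theorem exists_horiz_above (hm : 0 < m) (hn : 0 < n) (x : ℤ × ℤ) :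
    ∃ N : ℕ, ∀ t : ℕ, N ≤ t → L.horiz (x + (0, (t : ℤ))) = 0 := by
  obtain ⟨N, hN⟩ :=
    eventually_zero hm hn L.horiz L.horiz_periodic L.horiz_finite (0, 1) (.inl rfl) x
  exact ⟨N, fun t ht => by simpa using hN t ht⟩

theorem height_up (hm : 0 < m) (hn : 0 < n) (x : ℤ × ℤ) :
    L.height (x + (0, 1)) = L.height x - L.horiz x := by
  have fin : ∀ x, (Function.support fun t : ℕ => (L.horiz (x + (0, (t : ℤ))) : ℤ)).Finite := by
    intro x
    obtain ⟨N, hN⟩ := L.exists_horiz_above hm hn x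
    refine (Set.finite_Iio N).subset fun t ht => ?_
    by_contra h
    exact ht (by simp [hN t (not_lt.1 h)])
  obtain ⟨N, hN⟩ := L.exists_horiz_above hm hn x
  have h := finsum_telescope (fun t => L.horiz (x + (0, (t : ℤ)))) N hN
  have e : ∀ t : ℕ, x + (0, ((t + 1 : ℕ) : ℤ)) = x + (0, 1) + (0, (t : ℤ)) := fun t => by
    ext <;> simp; ring
  simp only [e] at h
  rw [finsum_sub_distrib (fin x) (fin (x + (0, 1)))] at h
  simp only [Nat.cast_zero, Prod.mk_zero_zero, add_zero] at h
  unfold height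
  linarith

theorem height_right (hm : 0 < m) (hn : 0 < n) (x : ℤ × ℤ) :
    L.height (x + (1, 0)) = L.height x + L.vert x := by
  have fin : ∀ x, (Function.support fun t : ℕ => (L.horiz (x + (0, (t : ℤ))) : ℤ)).Finite := by
    intro x
    obtain ⟨N, hN⟩ := L.exists_horiz_above hm hn x
    refine (Set.finite_Iio N).subset fun t ht => ?_
    by_contra h
    exact ht (by simp [hN t (not_lt.1 h)])
  have h := L.sum_vertexOrder_above hm hn x
  simp only [vertexOrder, add_right_comm x (0, _) (1, 0)] at h
  rw [finsum_sub_distrib (fin (x + (1, 0))) (fin x)] at h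
  unfold height
  linarith

theorem height_period (x : ℤ × ℤ) : L.height (x + ((m : ℤ), (n : ℤ))) = L.height x := by
  unfold height
  simp only [add_right_comm x ((m : ℤ), (n : ℤ)) (0, _), L.horiz_periodic]

theorem vertCross_sub_horizCross (hm : 0 < m) (hn : 0 < n) (i : List (Fin 2)) (x : ℤ × ℤ) :
    (L.vertCross i x : ℤ) - L.horizCross i x
      = L.height (x + ((i.count 0 : ℤ), (i.count 1 : ℤ))) - L.height x := by
  induction i generalizing x with
  | nil => simp [vertCross, horizCross, Prod.mk_zero_zero]
  | cons j i ih =>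
    have h01 : (0 : Fin 2) ≠ 1 := by decide
    fin_cases j
    · have e : x + ((((0 : Fin 2) :: i).count 0 : ℤ), (((0 : Fin 2) :: i).count 1 : ℤ))
          = x + (1, 0) + ((i.count 0 : ℤ), (i.count 1 : ℤ)) := by
        ext <;> simp <;> ring
      have := ih (x + (1, 0))
      have := L.height_right hm hn x
      show (L.vertCross ((0 : Fin 2) :: i) x : ℤ) - L.horizCross ((0 : Fin 2) :: i) x =
        L.height (x + ((((0 : Fin 2) :: i).count 0 : ℤ), (((0 : Fin 2) :: i).count 1 : ℤ))) - _
      rw [e, vertCross, horizCross]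
      push_cast
      linarith
    · have e : x + ((((1 : Fin 2) :: i).count 0 : ℤ), (((1 : Fin 2) :: i).count 1 : ℤ))
          = x + (0, 1) + ((i.count 0 : ℤ), (i.count 1 : ℤ)) := by
        ext <;> simp <;> ring
      have := ih (x + (0, 1))
      have := L.height_up hm hn x
      show (L.vertCross ((1 : Fin 2) :: i) x : ℤ) - L.horizCross ((1 : Fin 2) :: i) x =
        L.height (x + ((((1 : Fin 2) :: i).count 0 : ℤ), (((1 : Fin 2) :: i).count 1 : ℤ))) - _
      rw [e, vertCross, horizCross]
      push_cast
      linarith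

/-- Steps that do not increase the height: to the right or downwards across an edge with label
zero, or to the left or upwards across an arbitrary edge. -/
def DescStep (x z : ℤ × ℤ) : Prop :=
  (z = x + (1, 0) ∧ L.vert x = 0) ∨ z = x + (0, 1) ∨ x = z + (1, 0) ∨
    (x = z + (0, 1) ∧ L.horiz z = 0)

/-- There is a walk between two faces along which the height does not increase. -/
def Desc : ℤ × ℤ → ℤ × ℤ → Prop := Relation.ReflTransGen L.DescStep

theorem Desc.height_le {L : Config m n} (hm : 0 < m) (hn : 0 < n) {x z : ℤ × ℤ} (h : L.Desc x z) :
    L.height z ≤ L.height x ∧ (L.height z = L.height x → L.Reach x z) := by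
  induction h with
  | refl => exact ⟨le_rfl, fun _ => .refl⟩
  | @tail w z _ h ih =>
    obtain ⟨ih1, ih2⟩ := ih
    have hs : L.height z ≤ L.height w ∧ (L.height z = L.height w → L.Adj w z) := by
      rcases h with ⟨rfl, h⟩ | rfl | rfl | ⟨rfl, h⟩
      · have := L.height_right hm hn w
        exact ⟨by omega, fun _ => .inl ⟨rfl, h⟩⟩
      · have := L.height_up hm hn w
        exact ⟨by omega, fun _ => .inr (.inl ⟨rfl, by omega⟩)⟩
      · have := L.height_right hm hn z
        exact ⟨by omega, fun _ => .inr (.inr (.inl ⟨rfl, by omega⟩))⟩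
      · have := L.height_up hm hn z
        exact ⟨by omega, fun _ => .inr (.inr (.inr ⟨rfl, h⟩))⟩
    exact ⟨by omega, fun e => (ih2 (by omega)).tail (hs.2 (by omega))⟩

theorem Desc.reach_period {L : Config m n} (hm : 0 < m) (hn : 0 < n) {x : ℤ × ℤ}
    (h : L.Desc x (x + ((m : ℤ), (n : ℤ)))) : L.Reach x (x + ((m : ℤ), (n : ℤ))) :=
  (h.height_le hm hn).2 (L.height_period x)

/-- If no walk from `x` gets stuck, i.e. reaches a face whose right and upper edges are both
non-zero, then the walk that moves right where possible and upwards elsewhere can be completed to a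
walk to the translate of `x`: once it has made all its steps in one direction, by periodicity of
the height the remaining steps cannot cross non-zero edges. -/
theorem reach_period_of_not_stuck (hm : 0 < m) (hn : 0 < n) (x : ℤ × ℤ)
    (h : ∀ z, L.Reach x z → L.vert z = 0 ∨ L.horiz z = 0) :
    L.Reach x (x + ((m : ℤ), (n : ℤ))) := by
  have ups : ∀ (k : ℕ) (z : ℤ × ℤ), L.Desc z (z + (0, (k : ℤ))) := by
    intro k z
    induction k with
    | zero => simp [Desc, Prod.mk_zero_zero, Relation.ReflTransGen.refl]
    | succ k ih => exact ih.tail (.inr (.inl (by ext <;> simp; ring)))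
  have lefts : ∀ (k : ℕ) (z : ℤ × ℤ), L.Desc (z + ((k : ℤ), 0)) z := by
    intro k z
    induction k with
    | zero => simp [Desc, Prod.mk_zero_zero, Relation.ReflTransGen.refl]
    | succ k ih => exact .head (.inr (.inr (.inl (by ext <;> simp; ring)))) ih
  have greedy : ∀ s : ℕ, ∃ k l : ℕ, k ≤ m ∧ l ≤ n ∧ L.Reach x (x + ((k : ℤ), (l : ℤ))) ∧
      (k = m ∨ l = n ∨ k + l = s) := by
    intro s
    induction s with
    | zero =>
      exact ⟨0, 0, by omega, by omega,
        by simp [Reach, Prod.mk_zero_zero, Relation.ReflTransGen.refl], by omega⟩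
    | succ s ih =>
      obtain ⟨k, l, hk, hl, hr, hs⟩ := ih
      by_cases hkl : k = m ∨ l = n
      · exact ⟨k, l, hk, hl, hr, by omega⟩
      · rcases h _ hr with h0 | h0
        · exact ⟨k + 1, l, by omega, by omega,
            hr.tail (.inl ⟨by ext <;> simp; ring, h0⟩), by omega⟩
        · exact ⟨k, l + 1, by omega, by omega,
            hr.tail (.inr (.inl ⟨by ext <;> simp; ring, h0⟩)), by omega⟩
  obtain ⟨k, l, hk, hl, hr, hs⟩ := greedy (m + n)
  have hh : L.height (x + ((k : ℤ), (l : ℤ))) = L.height x := by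
    have descend : ∀ z, L.Reach x z → L.height z = L.height x := by
      intro z hz
      induction hz with
      | refl => rfl
      | @tail w z _ hs ih =>
        rw [← ih]
        rcases hs with ⟨rfl, h⟩ | ⟨rfl, h⟩ | ⟨rfl, h⟩ | ⟨rfl, h⟩
        · rw [L.height_right hm hn, h]; simp
        · rw [L.height_up hm hn, h]; simp
        · rw [L.height_right hm hn, h]; simp
        · rw [L.height_up hm hn, h]; simp
    exact descend _ hr
  refine hr.trans ?_
  rcases (show k = m ∨ l = n by omega) with rfl | rfl
  · have := ups (n - l) (x + ((k : ℤ), (l : ℤ)))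
    have e : x + ((k : ℤ), (l : ℤ)) + (0, ((n - l : ℕ) : ℤ)) = x + ((k : ℤ), (n : ℤ)) := by
      ext <;> simp; omega
    rw [e] at this
    exact (this.height_le hm hn).2 (by rw [hh, height_period])
  · have := lefts (m - k) (x + ((k : ℤ), (l : ℤ)))
    have e : x + ((k : ℤ), (l : ℤ)) + (((m - k : ℕ) : ℤ), 0) = x + ((m : ℤ), (l : ℤ)) := by
      ext <;> simp; omega
    rw [e] at this
    exact ((this.height_le hm hn).2 (by rw [hh, height_period])).symm

theorem InIncontractible.reach_period {L : Config m n} (hm : 0 < m) (hn : 0 < n) {x : ℤ × ℤ}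
    (hx : L.InIncontractible x) : L.Reach x (x + ((m : ℤ), (n : ℤ))) :=
  L.reach_period_of_not_stuck hm hn x fun _ hz => hx.vert_eq_zero_or hm hz

theorem IsFiveVertex.reach_period {L : Config m n} (hm : 0 < m) (hn : 0 < n) (h : L.IsFiveVertex)
    (x : ℤ × ℤ) : L.Reach x (x + ((m : ℤ), (n : ℤ))) :=
  L.reach_period_of_not_stuck hm hn x fun z _ => h.vert_eq_zero_or z

end Config

/-! ### Polynomials with prescribed orders at the faces -/

namespace Config

theorem faceValue_add (α : Fin 2 → ℂ) (x y : ℤ × ℤ) :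
    faceValue α (x + y) = faceValue α x + faceValue α y := by
  simp [faceValue]; ring

theorem faceValue_neg (α : Fin 2 → ℂ) (x : ℤ × ℤ) : faceValue α (-x) = -faceValue α x := by
  simp [faceValue]; ring

theorem faceValue_zsmul_period {m n : ℕ} {α : Fin 2 → ℂ}
    (hmnα : (m : ℂ) * α 0 + (n : ℂ) * α 1 = 0) (k : ℤ) :
    faceValue α (k • ((m : ℤ), (n : ℤ))) = 0 := by
  simp [faceValue]; linear_combination (k : ℂ) * hmnα

theorem exists_eq_zsmul_period {m n : ℕ} (hm : 0 < m) (hmn : m.Coprime n) {x : ℤ × ℤ}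
    (h : (m : ℤ) * x.2 = n * x.1) : ∃ k : ℤ, x = k • ((m : ℤ), (n : ℤ)) := by
  have hc : IsCoprime (m : ℤ) (n : ℤ) := Nat.isCoprime_iff_coprime.2 hmn
  obtain ⟨k, hk⟩ : (m : ℤ) ∣ x.1 := hc.dvd_of_dvd_mul_left (Dvd.intro _ h)
  have hm' : (m : ℤ) ≠ 0 := by exact_mod_cast hm.ne'
  refine ⟨k, Prod.ext ?_ ?_⟩
  · simp [hk, mul_comm]
  · refine mul_left_cancel₀ hm' ?_
    simp only [Prod.smul_mk, smul_eq_mul]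
    rw [h, hk]; ring

theorem faceValue_eq_zero_iff {m n : ℕ} {α : Fin 2 → ℂ} (hm : 0 < m) (hn : 0 < n)
    (hmn : m.Coprime n)
    (hα : α ≠ 0) (hmnα : (m : ℂ) * α 0 + (n : ℂ) * α 1 = 0) (x : ℤ × ℤ) :
    faceValue α x = 0 ↔ ∃ k : ℤ, x = k • ((m : ℤ), (n : ℤ)) := by
  constructor
  · intro h
    refine exists_eq_zsmul_period hm hmn ?_
    have hm' : (m : ℂ) ≠ 0 := by exact_mod_cast hm.ne'
    have hn' : (n : ℂ) ≠ 0 := by exact_mod_cast hn.ne'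
    have h1 : α 1 ≠ 0 := by
      intro h1
      have h0 : α 0 = 0 := by
        have : (m : ℂ) * α 0 = 0 := by linear_combination hmnα - (n : ℂ) * h1
        exact (mul_eq_zero.1 this).resolve_left hm'
      exact hα (by ext j; fin_cases j <;> assumption)
    have h2 : α 1 * ((m : ℂ) * x.2 - n * x.1) = 0 := by
      rw [faceValue] at h
      linear_combination (m : ℂ) * h - (x.1 : ℂ) * hmnα
    have h3 := sub_eq_zero.1 ((mul_eq_zero.1 h2).resolve_left h1)
    exact_mod_cast h3
  · rintro ⟨k, rfl⟩
    exact faceValue_zsmul_period hmnα k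

/-- A multiplicity function on faces that is periodic, with finite support modulo the period. -/
structure IsFaceMult (m n : ℕ) (g : ℤ × ℤ → ℕ) : Prop where
  periodic : ∀ x (k : ℤ), g (x + k • ((m : ℤ), (n : ℤ))) = g x
  finite : {q : (ℤ × ℤ) ⧸ Period m n | g q.out ≠ 0}.Finite

/-- `∏_λ (u - λ) ^ g(λ)`, the product over the faces modulo the period. -/
def facePoly (m n : ℕ) (α : Fin 2 → ℂ) (g : ℤ × ℤ → ℕ) : ℂ[X] :=
  ∏ᶠ q : (ℤ × ℤ) ⧸ Period m n, (X - C (faceValue α q.out)) ^ g q.out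

theorem exists_out_eq {m n : ℕ} (x : ℤ × ℤ) :
    ∃ k : ℤ, (QuotientAddGroup.mk x : (ℤ × ℤ) ⧸ Period m n).out = x + k • ((m : ℤ), (n : ℤ)) := by
  have h : (QuotientAddGroup.mk x : (ℤ × ℤ) ⧸ Period m n) = QuotientAddGroup.mk
      (QuotientAddGroup.mk x : (ℤ × ℤ) ⧸ Period m n).out := (Quotient.out_eq _).symm
  rw [QuotientAddGroup.eq, AddSubgroup.mem_zmultiples_iff] at h
  obtain ⟨k, hk⟩ := h
  exact ⟨k, by rw [hk]; abel⟩

theorem exists_out_add_eq {m n : ℕ} (q : (ℤ × ℤ) ⧸ Period m n) (d : ℤ × ℤ) :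
    ∃ k : ℤ, (q + QuotientAddGroup.mk d).out = q.out + d + k • ((m : ℤ), (n : ℤ)) := by
  have h : q + QuotientAddGroup.mk d
      = (QuotientAddGroup.mk (q.out + d) : (ℤ × ℤ) ⧸ Period m n) := by
    rw [QuotientAddGroup.mk_add]
    congr 1
    exact (Quotient.out_eq q).symm
  rw [h]
  exact exists_out_eq _

namespace IsFaceMult

variable {m n : ℕ} {g g' : ℤ × ℤ → ℕ}

theorem of_le (hg : IsFaceMult m n g) (hp : ∀ x (k : ℤ), g' (x + k • ((m : ℤ), (n : ℤ))) = g' x)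
    (h : ∀ x, g x = 0 → g' x = 0) : IsFaceMult m n g' :=
  ⟨hp, hg.finite.subset fun q hq h0 => hq (h _ h0)⟩

theorem zero : IsFaceMult m n fun _ => 0 := ⟨fun _ _ => rfl, by simp⟩

theorem add (hg : IsFaceMult m n g) (hg' : IsFaceMult m n g') :
    IsFaceMult m n fun x => g x + g' x := by
  refine ⟨fun x k => by simp only [hg.periodic, hg'.periodic],
    (hg.finite.union hg'.finite).subset fun q hq => ?_⟩
  by_contra hcon
  simp only [Set.mem_union, Set.mem_ofPred_eq, not_or, not_not] at hcon
  exact hq (by simp [hcon.1, hcon.2])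

theorem shift (hg : IsFaceMult m n g) (d : ℤ × ℤ) : IsFaceMult m n fun x => g (x + d) := by
  refine ⟨fun x k => by simp only [add_right_comm x _ d, hg.periodic],
    (hg.finite.image fun q => q - QuotientAddGroup.mk d).subset fun q hq => ?_⟩
  refine ⟨q + QuotientAddGroup.mk d, ?_, add_sub_cancel_right _ _⟩
  obtain ⟨k, hk⟩ := exists_out_add_eq q d
  simp only [Set.mem_ofPred_eq, hk, hg.periodic]
  exact hq

theorem facePoly_mul (hg : IsFaceMult m n g) (hg' : IsFaceMult m n g') (α : Fin 2 → ℂ) :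
    facePoly m n α (fun x => g x + g' x) = facePoly m n α g * facePoly m n α g' := by
  have fin : ∀ {g}, IsFaceMult m n g → (Function.mulSupport fun q : (ℤ × ℤ) ⧸ Period m n =>
      (X - C (faceValue α q.out)) ^ g q.out).Finite := fun hg =>
    hg.finite.subset fun q hq h0 => hq (by simp only [h0, pow_zero])
  simp only [facePoly, pow_add]
  exact finprod_mul_distrib (fin hg) (fin hg')

theorem taylor_facePoly (hg : IsFaceMult m n g) {α : Fin 2 → ℂ}
    (hmnα : (m : ℂ) * α 0 + (n : ℂ) * α 1 = 0) (d : ℤ × ℤ) :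
    taylor (faceValue α d) (facePoly m n α g) = facePoly m n α fun x => g (x + d) := by
  have h1 : taylor (faceValue α d) (facePoly m n α g)
      = ∏ᶠ q : (ℤ × ℤ) ⧸ Period m n, taylor (faceValue α d)
        ((X - C (faceValue α q.out)) ^ g q.out) :=
    (taylorEquiv (faceValue α d)).toMulEquiv.map_finprod _
  rw [h1, ← finprod_comp_equiv (Equiv.addRight (QuotientAddGroup.mk d))]
  refine finprod_congr fun q => ?_
  obtain ⟨k, hk⟩ := exists_out_add_eq q d
  rw [Equiv.coe_addRight, hk, hg.periodic, taylor_pow, map_sub, taylor_X, taylor_C, faceValue_add,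
    faceValue_add, faceValue_zsmul_period hmnα]
  congr 1
  simp only [map_add, map_zero]; ring

theorem eval_facePoly_eq_zero (hg : IsFaceMult m n g) {α : Fin 2 → ℂ}
    (hmnα : (m : ℂ) * α 0 + (n : ℂ) * α 1 = 0) (μ : ℂ) :
    (facePoly m n α g).eval μ = 0 ↔ ∃ x, faceValue α x = μ ∧ g x ≠ 0 := by
  rw [facePoly, finprod_eq_prod_of_mulSupport_subset (s := hg.finite.toFinset), eval_prod,
    Finset.prod_eq_zero_iff]
  · constructor
    · rintro ⟨q, hq, h⟩
      have hq' : g q.out ≠ 0 := by simpa using hq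
      rw [eval_pow] at h
      have := eq_zero_of_pow_eq_zero h
      refine ⟨q.out, ?_, hq'⟩
      simp only [eval_sub, eval_X, eval_C] at this
      exact (sub_eq_zero.1 this).symm
    · rintro ⟨x, rfl, hx⟩
      obtain ⟨k, hk⟩ := exists_out_eq (m := m) (n := n) x
      refine ⟨QuotientAddGroup.mk x, ?_, ?_⟩
      · rw [Set.Finite.mem_toFinset, Set.mem_ofPred_eq, hk, hg.periodic]
        exact hx
      · rw [hk, hg.periodic, faceValue_add, faceValue_zsmul_period hmnα]
        simp [hx]
  · intro q hq
    simp only [Set.Finite.coe_toFinset, Set.mem_ofPred_eq]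
    exact fun h0 => hq (by simp only [h0, pow_zero])

theorem eval_facePoly_faceValue (hg : IsFaceMult m n g) {α : Fin 2 → ℂ} (hm : 0 < m) (hn : 0 < n)
    (hmn : m.Coprime n) (hα : α ≠ 0) (hmnα : (m : ℂ) * α 0 + (n : ℂ) * α 1 = 0) (x : ℤ × ℤ) :
    (facePoly m n α g).eval (faceValue α x) = 0 ↔ g x ≠ 0 := by
  rw [hg.eval_facePoly_eq_zero hmnα]
  refine ⟨?_, fun h => ⟨x, rfl, h⟩⟩
  rintro ⟨z, hz, h⟩
  have h0 : faceValue α (z - x) = 0 := by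
    rw [sub_eq_add_neg, faceValue_add, faceValue_neg, hz, add_neg_cancel]
  obtain ⟨k, hk⟩ := (faceValue_eq_zero_iff hm hn hmn hα hmnα _).1 h0
  rw [sub_eq_iff_eq_add'] at hk
  rwa [hk, hg.periodic] at h

/-- Vanishing far away in the direction `(-n, m)` means finite support modulo the period, since
the two directions span a sublattice of finite index. -/
theorem of_finite (hm : 0 < m) (hmn : m.Coprime n)
    (hp : ∀ x (k : ℤ), g (x + k • ((m : ℤ), (n : ℤ))) = g x)
    (hf : ∀ e, ∃ K : ℤ, ∀ k : ℤ, K ≤ |k| → g (e + k • (-(n : ℤ), (m : ℤ))) = 0) :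
    IsFaceMult m n g := by
  refine ⟨hp, ?_⟩
  obtain ⟨a, b, hab⟩ : IsCoprime (m : ℤ) (n : ℤ) := Nat.isCoprime_iff_coprime.2 hmn
  choose K hK using hf
  set M : ℤ := (m : ℤ) ^ 2 + (n : ℤ) ^ 2 with hM
  have hMpos : 0 < M := by positivity
  set B : ℤ := ∑ r ∈ Finset.Ico 0 M, |K (r • (-b, a))| with hB
  refine (((Set.finite_Ico 0 M).prod (Set.finite_Icc (-B) B)).image fun p : ℤ × ℤ =>
    (QuotientAddGroup.mk (p.1 • (-b, a) + p.2 • (-(n : ℤ), (m : ℤ))) :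
      (ℤ × ℤ) ⧸ Period m n)).subset ?_
  intro q hq
  set x := q.out with hx
  set s : ℤ := m * x.2 - n * x.1 with hs
  have hdiv := Int.emod_add_mul_ediv s M
  obtain ⟨j, hj⟩ := exists_eq_zsmul_period (n := n) hm hmn
    (x := x - ((s % M) • (-b, a) + (s / M) • (-(n : ℤ), (m : ℤ)))) (by
      simp only [Prod.fst_sub, Prod.snd_sub, Prod.fst_add, Prod.snd_add, Prod.smul_mk, smul_eq_mul]
      linear_combination hs.symm - hdiv + (s / M) * hM - (s % M) * hab)
  rw [sub_eq_iff_eq_add'] at hj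
  have hr : s % M ∈ Finset.Ico 0 M :=
    Finset.mem_Ico.2 ⟨Int.emod_nonneg _ hMpos.ne', Int.emod_lt_of_pos _ hMpos⟩
  refine ⟨(s % M, s / M), ⟨by simpa using hr, ?_⟩, ?_⟩
  · rw [Set.mem_Icc, ← abs_le]
    by_contra hcon
    refine hq ?_
    change g x = 0
    rw [hj, hp]
    refine hK _ _ ?_
    have h1 : |K ((s % M) • (-b, a))| ≤ B :=
      Finset.single_le_sum (f := fun r => |K (r • (-b, a))|) (fun _ _ => abs_nonneg _) hr
    exact (le_abs_self _).trans (h1.trans (not_le.1 hcon).le)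
  · have h2 : q = QuotientAddGroup.mk x := (Quotient.out_eq q).symm
    rw [h2, hj]
    simp only
    rw [QuotientAddGroup.eq, AddSubgroup.mem_zmultiples_iff]
    exact ⟨j, by abel⟩

end IsFaceMult

variable {m n : ℕ} (L : Config m n)

theorem isFaceMult_vert (hm : 0 < m) (hmn : m.Coprime n) : IsFaceMult m n L.vert :=
  .of_finite hm hmn L.vert_add_zsmul L.vert_finite

theorem isFaceMult_horiz (hm : 0 < m) (hmn : m.Coprime n) : IsFaceMult m n L.horiz :=
  .of_finite hm hmn L.horiz_add_zsmul L.horiz_finite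

theorem isFaceMult_vertCross (hm : 0 < m) (hmn : m.Coprime n) (i : List (Fin 2)) :
    IsFaceMult m n (L.vertCross i) := by
  induction i with
  | nil => exact .zero
  | cons j i ih =>
    fin_cases j
    · exact (L.isFaceMult_vert hm hmn).add (ih.shift _)
    · exact ih.shift _

theorem isFaceMult_horizCross (hm : 0 < m) (hmn : m.Coprime n) (i : List (Fin 2)) :
    IsFaceMult m n (L.horizCross i) := by
  induction i with
  | nil => exact .zero
  | cons j i ih =>
    fin_cases j
    · exact ih.shift _
    · exact (L.isFaceMult_horiz hm hmn).add (ih.shift _)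

theorem isFaceMult_order (hm : 0 < m) (hmn : m.Coprime n) (i : List (Fin 2)) :
    IsFaceMult m n (L.order i) := by
  have h1 := L.isFaceMult_vertCross hm hmn i
  have h2 := L.isFaceMult_horizCross hm hmn i
  refine (h1.add h2).of_le (fun x k => ?_) fun x hx => ?_
  · simp only [order, h1.periodic, h2.periodic]
  · simp only [order]; omega

theorem taylor_poly_zero (α : Fin 2 → ℂ) :
    taylor (α 0 / 2) (L.poly α 0) = facePoly m n α L.vert := by
  refine ((taylorEquiv (α 0 / 2)).toMulEquiv.map_finprod _).trans (finprod_congr fun q => ?_)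
  show taylor (α 0 / 2) ((X - C (faceValue α q.out + α 0 / 2)) ^ L.vert q.out) = _
  rw [taylor_pow, map_sub, taylor_X, taylor_C]
  congr 1
  simp only [map_add]; ring

theorem taylor_poly_one (α : Fin 2 → ℂ) :
    taylor (α 1 / 2) (L.poly α 1) = facePoly m n α L.horiz := by
  refine ((taylorEquiv (α 1 / 2)).toMulEquiv.map_finprod _).trans (finprod_congr fun q => ?_)
  show taylor (α 1 / 2) ((X - C (faceValue α q.out + α 1 / 2)) ^ L.horiz q.out) = _
  rw [taylor_pow, map_sub, taylor_X, taylor_C]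
  congr 1
  simp only [map_add]; ring

end Config

/-! ### Relations in the Kleinian fiber product -/

theorem aeval_add_algebraMap {B : Type*} [Ring B] [Algebra ℂ B] (h : B) (c : ℂ) (f : ℂ[X]) :
    aeval (h + algebraMap ℂ B c) f = aeval h (taylor c f) := by
  rw [taylor_apply, aeval_comp]
  simp

section Relations

variable (α : Fin 2 → ℂ) (p : Fin 2 → ℂ[X])

/-- The elements `X_i^-`. -/
abbrev elXm (i : Fin 2) : Alg α p := algGen α p (.Xm i)

/-- The projection from the free algebra. -/
def projAlg : FreeAlgebra ℂ Gen →ₐ[ℂ] Alg α p :=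
  (Ideal.Quotient.mkₐ ℂ (torsionIdeal α p)).comp (RingQuot.mkAlgHom ℂ (Rel α p))

theorem projAlg_rel {x y : FreeAlgebra ℂ Gen} (h : Rel α p x y) : projAlg α p x = projAlg α p y :=
  congrArg (Ideal.Quotient.mkₐ ℂ (torsionIdeal α p)) (RingQuot.mkAlgHom_rel ℂ h)

theorem elH_elX (i : Fin 2) :
    elH α p * elX α p i - elX α p i * elH α p = α i • elX α p i := by
  have := projAlg_rel α p (Rel.H_Xp i)
  rwa [map_sub, map_mul, map_mul, map_smul] at this

theorem elH_elXm (i : Fin 2) :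
    elH α p * elXm α p i - elXm α p i * elH α p = -α i • elXm α p i := by
  have := projAlg_rel α p (Rel.H_Xm i)
  rwa [map_sub, map_mul, map_mul, map_smul] at this

theorem elXm_elX (i : Fin 2) :
    elXm α p i * elX α p i = aeval (elH α p) (taylor (α i / 2) (p i)) := by
  have := projAlg_rel α p (Rel.Xm_Xp i)
  rw [map_mul, ← aeval_algHom_apply, map_add, AlgHom.commutes] at this
  rw [← aeval_add_algebraMap]
  exact this

theorem elX_elXm (i : Fin 2) :
    elX α p i * elXm α p i = aeval (elH α p) (taylor (-(α i / 2)) (p i)) := by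
  have := projAlg_rel α p (Rel.Xp_Xm i)
  rw [map_mul, ← aeval_algHom_apply, map_sub, AlgHom.commutes, sub_eq_add_neg, ← map_neg] at this
  rw [← aeval_add_algebraMap]
  exact this

theorem elX_elXm_comm (i j : Fin 2) (hij : i ≠ j) :
    elX α p i * elXm α p j = elXm α p j * elX α p i := by
  have := projAlg_rel α p (Rel.comm i j hij)
  rwa [map_mul, map_mul] at this

theorem aeval_elH_mul_elX (i : Fin 2) (f : ℂ[X]) :
    aeval (elH α p) f * elX α p i = elX α p i * aeval (elH α p) (taylor (α i) f) := by
  rw [shift_aeval (elH_elX α p i), taylor_taylor, neg_add_cancel, taylor_zero]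

theorem aeval_elH_mul_elXm (i : Fin 2) (f : ℂ[X]) :
    aeval (elH α p) f * elXm α p i = elXm α p i * aeval (elH α p) (taylor (-α i) f) := by
  rw [shift_aeval (elH_elXm α p i), taylor_taylor, neg_add_cancel, taylor_zero]

/-- The Kleinian fiber product is torsion-free over the polynomials in `H`. -/
theorem eq_zero_of_aeval_mul (f : ℂ[X]) (hf : f ≠ 0) (a : Alg α p)
    (h : aeval (elH α p) f * a = 0) : a = 0 := by
  obtain ⟨b, rfl⟩ := Ideal.Quotient.mk_surjective a
  have e : aeval (elH α p) f = Ideal.Quotient.mk (torsionIdeal α p) (aeval (preGen α p .H) f) :=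
    aeval_algHom_apply (Ideal.Quotient.mkₐ ℂ (torsionIdeal α p)) _ _
  rw [e, ← map_mul, Ideal.Quotient.eq_zero_iff_mem] at h
  obtain ⟨g, hg, hgb⟩ := h
  rw [Ideal.Quotient.eq_zero_iff_mem]
  exact ⟨g * f, mul_ne_zero hg hf, by rw [map_mul, mul_assoc, hgb]⟩

theorem toLoc_injective : Function.Injective (toLoc α p) := by
  refine OreLocalization.numeratorHom_inj ?_
  rintro _ ⟨f, hf, rfl⟩
  rw [mem_nonZeroDivisorsLeft_iff]
  exact fun x hx => eq_zero_of_aeval_mul α p f hf x hx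

theorem toLoc_mul_invPoly (f : ℂ[X]) (hf : f ≠ 0) :
    toLoc α p (aeval (elH α p) f) * invPoly α p f hf = 1 :=
  (OreLocalization.numeratorUnit (polyH.of α p f hf)).mul_inv

theorem invPoly_mul_toLoc (f : ℂ[X]) (hf : f ≠ 0) :
    invPoly α p f hf * toLoc α p (aeval (elH α p) f) = 1 :=
  (OreLocalization.numeratorUnit (polyH.of α p f hf)).inv_mul

theorem commute_of_commute_toLoc (z : AlgLoc α p) (h : ∀ a, Commute z (toLoc α p a)) :
    z ∈ Subring.center (AlgLoc α p) := by
  rw [Subring.mem_center_iff]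
  intro w
  induction w using OreLocalization.ind with
  | _ r s =>
    obtain ⟨_, f, hf, rfl⟩ := s
    have e : OreLocalization.oreDiv r (⟨aeval (elH α p) f, f, hf, rfl⟩ : polyH α p)
        = invPoly α p f hf * toLoc α p r := by
      have h1 : toLoc α p (aeval (elH α p) f)
          * OreLocalization.oreDiv r (⟨aeval (elH α p) f, f, hf, rfl⟩ : polyH α p)
          = toLoc α p r :=
        OreLocalization.mul_cancel (s := (⟨aeval (elH α p) f, f, hf, rfl⟩ : polyH α p))
      rw [← h1, ← mul_assoc, invPoly_mul_toLoc, one_mul]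
    have hz : Commute z (invPoly α p f hf) :=
      (show Commute z ↑(OreLocalization.numeratorUnit (polyH.of α p f hf)) from
        h (aeval (elH α p) f)).units_inv_right
    rw [e]
    exact (hz.mul_right (h r)).eq.symm

end Relations

/-! ### Gauges

In a ring in which `X_1^-` and `X_2^+` become invertible, the units `Y₁ = (X_1^-)⁻¹` and
`Y₂ = X_2^+` commute, and every product of generators is a monomial in `Y₁, Y₂` times a polynomial
in `H`. -/

/-- A ring homomorphism from the Kleinian fiber product that makes `X_1^-` and `X_2^+`
invertible. -/
structure Gauge (α : Fin 2 → ℂ) (p : Fin 2 → ℂ[X]) (B : Type*) [Ring B] where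
  hom : Alg α p →+* B
  u₁ : Bˣ
  u₂ : Bˣ
  hom_Xm : hom (elXm α p 0) = u₁
  hom_X : hom (elX α p 1) = u₂

namespace Gauge

variable {α : Fin 2 → ℂ} {p : Fin 2 → ℂ[X]} {B : Type*} [Ring B] (G : Gauge α p B)

/-- The monomial `Y₂ ^ l * Y₁ ^ k` for `d = (k, l)`. -/
def mono (d : ℤ × ℤ) : Bˣ := G.u₂ ^ d.2 * G.u₁ ^ (-d.1)

/-- The image of a polynomial in `H`. -/
def poly (f : ℂ[X]) : B := G.hom (aeval (elH α p) f)

theorem poly_mul (f g : ℂ[X]) : G.poly (f * g) = G.poly f * G.poly g := by simp [poly]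

theorem poly_add (f g : ℂ[X]) : G.poly (f + g) = G.poly f + G.poly g := by simp [poly]

theorem poly_one : G.poly 1 = 1 := by simp [poly]

theorem poly_commute (f g : ℂ[X]) : Commute (G.poly f) (G.poly g) := by
  rw [Commute, SemiconjBy, ← poly_mul, ← poly_mul, mul_comm]

theorem commute_units : Commute G.u₁ G.u₂ := by
  refine Units.ext ?_
  rw [Units.val_mul, Units.val_mul, ← G.hom_Xm, ← G.hom_X, ← map_mul, ← map_mul,
    elX_elXm_comm α p 1 0 (by decide)]

theorem mono_zero : G.mono 0 = 1 := by simp [mono]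

theorem mono_add (d e : ℤ × ℤ) : G.mono (d + e) = G.mono d * G.mono e := by
  have h : Commute (G.u₁ ^ (-d.1)) (G.u₂ ^ e.2) := (G.commute_units.zpow_zpow _ _)
  simp only [mono, Prod.fst_add, Prod.snd_add, neg_add, zpow_add]
  rw [mul_assoc, mul_assoc, ← mul_assoc (G.u₁ ^ (-d.1)), h.eq, mul_assoc]

theorem shift_inv {u : Bˣ} {c : ℂ} (h : ∀ f, G.poly f * u = u * G.poly (taylor c f)) (f : ℂ[X]) :
    G.poly f * (u⁻¹ : Bˣ) = (u⁻¹ : Bˣ) * G.poly (taylor (-c) f) := by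
  have := h (taylor (-c) f)
  rw [taylor_taylor, add_neg_cancel, taylor_zero] at this
  rw [Units.mul_inv_eq_iff_eq_mul, mul_assoc, this, Units.inv_mul_cancel_left]

theorem shift_mul {u v : Bˣ} {c d : ℂ} (hu : ∀ f, G.poly f * u = u * G.poly (taylor c f))
    (hv : ∀ f, G.poly f * v = v * G.poly (taylor d f)) (f : ℂ[X]) :
    G.poly f * (u * v : Bˣ) = (u * v : Bˣ) * G.poly (taylor (c + d) f) := by
  rw [Units.val_mul, ← mul_assoc, hu, mul_assoc, hv, taylor_taylor, mul_assoc, add_comm d c]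

theorem shift_zpow {u : Bˣ} {c : ℂ} (h : ∀ f, G.poly f * u = u * G.poly (taylor c f)) (k : ℤ) :
    ∀ f, G.poly f * (u ^ k : Bˣ) = (u ^ k : Bˣ) * G.poly (taylor (k * c) f) := by
  induction k with
  | zero => simp
  | succ k ih =>
    intro f
    rw [zpow_add_one, G.shift_mul ih h]
    congr 4; push_cast; ring
  | pred k ih =>
    intro f
    rw [zpow_sub_one, G.shift_mul ih (G.shift_inv h)]
    congr 4; push_cast; ring

theorem poly_mul_mono (d : ℤ × ℤ) (f : ℂ[X]) :
    G.poly f * G.mono d = G.mono d * G.poly (taylor (Config.faceValue α d) f) := by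
  have h₁ : ∀ f, G.poly f * G.u₁ = G.u₁ * G.poly (taylor (-α 0) f) := fun f => by
    rw [← G.hom_Xm, poly, poly, ← map_mul, ← map_mul, aeval_elH_mul_elXm]
  have h₂ : ∀ f, G.poly f * G.u₂ = G.u₂ * G.poly (taylor (α 1) f) := fun f => by
    rw [← G.hom_X, poly, poly, ← map_mul, ← map_mul, aeval_elH_mul_elX]
  rw [mono, G.shift_mul (G.shift_zpow h₂ _) (G.shift_zpow h₁ _)]
  congr 4; simp [Config.faceValue]; ring

theorem hom_mul {a b : Alg α p} {d e : ℤ × ℤ} {f g : ℂ[X]} (ha : G.hom a = G.mono d * G.poly f)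
    (hb : G.hom b = G.mono e * G.poly g) :
    G.hom (a * b) = G.mono (d + e) * G.poly (taylor (Config.faceValue α e) f * g) := by
  rw [map_mul, ha, hb, G.poly_mul, G.mono_add, Units.val_mul, mul_assoc, ← mul_assoc (G.poly f),
    G.poly_mul_mono]
  simp only [mul_assoc]

theorem hom_elXm_zero : G.hom (elXm α p 0) = G.mono (-1, 0) * G.poly 1 := by
  rw [G.hom_Xm, poly_one, mul_one]; simp [mono]

theorem hom_elX_one : G.hom (elX α p 1) = G.mono (0, 1) * G.poly 1 := by
  rw [G.hom_X, poly_one, mul_one]; simp [mono]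

theorem hom_elX_zero :
    G.hom (elX α p 0) = G.mono (1, 0) * G.poly (taylor (α 0 / 2) (p 0)) := by
  rw [poly, ← elXm_elX, map_mul, G.hom_Xm]
  simp [mono]

theorem hom_elXm_one :
    G.hom (elXm α p 1) = G.mono (0, -1) * G.poly (taylor (-(α 1 / 2)) (p 1)) := by
  rw [poly, ← elX_elXm, map_mul, G.hom_X]
  simp [mono]

theorem hom_elH : G.hom (elH α p) = G.mono 0 * G.poly X := by
  simp [mono_zero, poly]

theorem hom_algebraMap (c : ℂ) : G.hom (algebraMap ℂ _ c) = G.mono 0 * G.poly (C c) := by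
  simp [mono_zero, poly]

end Gauge

namespace Config

variable {m n : ℕ} {L : Config m n} {α : Fin 2 → ℂ} {B : Type*} [Ring B]

/-- The elements of degree `d`: those whose image is the monomial of degree `d` times a polynomial
`q` in `H`. Moreover `q` may only be non-zero at a face `y` if there is a height-decreasing walk
from `y` to `y + d`; the generators `X_i^±` correspond to the steps of such walks. -/
def piece (G : Gauge α (L.poly α) B) (d : ℤ × ℤ) : Submodule ℂ (Alg α (L.poly α)) where
  carrier := {a | ∃ q : ℂ[X], G.hom a = G.mono d * G.poly q ∧
    ∀ y, q.eval (faceValue α y) ≠ 0 → L.Desc y (y + d)}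
  zero_mem' := ⟨0, by simp [Gauge.poly], by simp⟩
  add_mem' := by
    rintro a b ⟨q, h1, h2⟩ ⟨r, h3, h4⟩
    refine ⟨q + r, by rw [map_add, h1, h3, G.poly_add, mul_add], fun y hy => ?_⟩
    by_cases h : q.eval (faceValue α y) = 0
    · exact h4 y fun h' => hy (by rw [eval_add, h, h', add_zero])
    · exact h2 y h
  smul_mem' := by
    rintro c a ⟨q, h1, h2⟩
    refine ⟨C c * q, ?_, fun y hy => h2 y fun h => hy (by rw [eval_mul, h, mul_zero])⟩
    rw [Algebra.smul_def, map_mul, G.hom_algebraMap, h1, G.poly_mul, Gauge.mono_zero,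
      Units.val_one, one_mul, ← mul_assoc, G.poly_mul_mono, taylor_C, mul_assoc]

theorem mul_mem_piece (G : Gauge α (L.poly α) B) {d e : ℤ × ℤ} {a b : Alg α (L.poly α)}
    (ha : a ∈ piece G d) (hb : b ∈ piece G e) : a * b ∈ piece G (d + e) := by
  obtain ⟨q, h1, h2⟩ := ha
  obtain ⟨r, h3, h4⟩ := hb
  refine ⟨_, G.hom_mul h1 h3, fun y hy => ?_⟩
  rw [eval_mul, taylor_eval, ← faceValue_add] at hy
  have h5 := h4 y (right_ne_zero_of_mul hy)
  have h6 := h2 _ (left_ne_zero_of_mul hy)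
  rw [add_assoc, add_comm e d] at h6
  exact h5.trans h6

theorem one_mem_piece (G : Gauge α (L.poly α) B) : 1 ∈ piece G 0 := by
  refine ⟨1, by simp [G.mono_zero, G.poly_one], fun y _ => ?_⟩
  rw [add_zero]; exact .refl

theorem algGen_mem_piece (hm : 0 < m) (hn : 0 < n) (hmn : m.Coprime n) (hα : α ≠ 0)
    (hmnα : (m : ℂ) * α 0 + (n : ℂ) * α 1 = 0) (G : Gauge α (L.poly α) B) (g : Gen) :
    ∃ d, algGen α (L.poly α) g ∈ piece G d := by
  cases g with
  | H => exact ⟨0, X, G.hom_elH, fun y _ => by rw [add_zero]; exact .refl⟩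
  | Xp i =>
    fin_cases i
    · refine ⟨(1, 0), _, G.hom_elX_zero, fun y hy => ?_⟩
      rw [taylor_poly_zero, Ne,
        (L.isFaceMult_vert hm hmn).eval_facePoly_faceValue hm hn hmn hα hmnα, not_not] at hy
      exact .single (.inl ⟨rfl, hy⟩)
    · exact ⟨(0, 1), 1, G.hom_elX_one, fun y _ => .single (.inr (.inl rfl))⟩
  | Xm i =>
    fin_cases i
    · refine ⟨(-1, 0), 1, G.hom_elXm_zero, fun y _ => .single (.inr (.inr (.inl ?_)))⟩
      ext <;> simp
    · refine ⟨(0, -1), _, G.hom_elXm_one, fun y hy => .single (.inr (.inr (.inr ⟨?_, ?_⟩)))⟩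
      · ext <;> simp
      · have e1 : -(α 1 / 2) = faceValue α (0, -1) + α 1 / 2 := by simp [faceValue]; ring
        rw [e1, ← taylor_taylor, taylor_poly_one, taylor_eval, ← faceValue_add, Ne,
          (L.isFaceMult_horiz hm hmn).eval_facePoly_faceValue hm hn hmn hα hmnα, not_not] at hy
        exact hy

theorem iSup_piece (hm : 0 < m) (hn : 0 < n) (hmn : m.Coprime n) (hα : α ≠ 0)
    (hmnα : (m : ℂ) * α 0 + (n : ℂ) * α 1 = 0) (G : Gauge α (L.poly α) B) :
    ⨆ d, piece G d = ⊤ := by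
  rw [eq_top_iff]
  rintro a -
  have ha : a ∈ Algebra.adjoin ℂ (Set.range (algGen α (L.poly α))) := by
    rw [adjoin_algGen]; trivial
  induction ha using Algebra.adjoin_induction with
  | mem x hx =>
    obtain ⟨g, rfl⟩ := hx
    obtain ⟨d, hd⟩ := algGen_mem_piece hm hn hmn hα hmnα G g
    exact Submodule.mem_iSup_of_mem d hd
  | algebraMap r =>
    rw [Algebra.algebraMap_eq_smul_one]
    exact Submodule.mem_iSup_of_mem 0 (Submodule.smul_mem _ _ (one_mem_piece G))
  | add x y _ _ ihx ihy => exact add_mem ihx ihy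
  | mul x y hx hy ihx ihy =>
    clear hx hy
    induction ihx using Submodule.iSup_induction' with
    | mem d x hx =>
      induction ihy using Submodule.iSup_induction' with
      | mem e y hy => exact Submodule.mem_iSup_of_mem _ (mul_mem_piece G hx hy)
      | zero => rw [mul_zero]; exact zero_mem _
      | add y z _ _ h1 h2 => rw [mul_add]; exact add_mem h1 h2
    | zero => rw [zero_mul]; exact zero_mem _
    | add y z _ _ h1 h2 => rw [add_mul]; exact add_mem h1 h2

theorem elH_mul_of_mem_piece (G : Gauge α (L.poly α) B) (hG : Function.Injective G.hom) {d : ℤ × ℤ}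
    {a : Alg α (L.poly α)} (ha : a ∈ piece G d) :
    elH α (L.poly α) * a - a * elH α (L.poly α) = faceValue α d • a := by
  obtain ⟨q, h1, -⟩ := ha
  refine hG ?_
  rw [Algebra.smul_def, map_sub, map_mul, map_mul, map_mul, G.hom_algebraMap, G.hom_elH, h1,
    G.mono_zero, Units.val_one, one_mul, one_mul, ← mul_assoc, G.poly_mul_mono, ← mul_assoc,
    G.poly_mul_mono, mul_assoc, mul_assoc, mul_assoc, ← G.poly_mul, ← G.poly_mul, ← G.poly_mul,
    ← mul_sub]
  congr 1
  rw [taylor_C, taylor_X, sub_eq_iff_eq_add, ← G.poly_add]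
  congr 1; ring

/-- An element of the cyclic subalgebra is a sum of elements whose degrees are multiples of the
period: the other components are removed by a polynomial in the commutator with `H`. -/
theorem mem_iSup_piece_of_commute (hm : 0 < m) (hn : 0 < n) (hmn : m.Coprime n) (hα : α ≠ 0)
    (hmnα : (m : ℂ) * α 0 + (n : ℂ) * α 1 = 0) (G : Gauge α (L.poly α) B)
    (hG : Function.Injective G.hom) {a : Alg α (L.poly α)}
    (ha : elH α (L.poly α) * a = a * elH α (L.poly α)) :
    a ∈ ⨆ k : ℤ, piece G (k • ((m : ℤ), (n : ℤ))) := by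
  have hat : a ∈ ⨆ d, piece G d := by rw [iSup_piece hm hn hmn hα hmnα]; trivial
  obtain ⟨f, hf, hfa⟩ := (Submodule.mem_iSup_iff_exists_finsupp _ _).1 hat
  set D : Module.End ℂ (Alg α (L.poly α)) :=
    LinearMap.mulLeft ℂ (elH α (L.poly α)) - LinearMap.mulRight ℂ (elH α (L.poly α)) with hD
  have haev : ∀ (r : ℂ[X]) (c : ℂ) (b : Alg α (L.poly α)), D b = c • b →
      aeval D r b = r.eval c • b := by
    intro r c b hb
    exact Module.End.aeval_apply_of_mem_apply_eq_smul hb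
  have hadef : a = ∑ d ∈ f.support, f d := hfa.symm
  set r : ℂ[X] := ∏ d ∈ f.support with faceValue α d ≠ 0, (1 - C (faceValue α d)⁻¹ * X) with hr
  have ha0 : aeval D r a = a := by
    rw [haev r 0 a (by simp [hD, ha])]
    simp [hr, eval_prod]
  rw [← ha0, hadef, map_sum]
  refine Submodule.sum_mem _ fun d hd => ?_
  rw [haev r (faceValue α d) (f d) (elH_mul_of_mem_piece G hG (hf d))]
  by_cases h : faceValue α d = 0
  · obtain ⟨k, hk⟩ := (faceValue_eq_zero_iff hm hn hmn hα hmnα d).1 h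
    refine Submodule.smul_mem _ _ (Submodule.mem_iSup_of_mem k ?_)
    rw [← hk]; exact hf d
  · have : r.eval (faceValue α d) = 0 := by
      rw [hr, eval_prod]
      refine Finset.prod_eq_zero (i := d) (by simpa using ⟨by simpa using hd, h⟩) ?_
      simp [h]
    rw [this, zero_smul]
    exact zero_mem _

end Config

/-! ### A representation of the Kleinian fiber product

Functions on `ℤ` with values in `ℂ[z, z⁻¹][u]`, on which `H` acts diagonally by `u + t s`, the
generators `X_1^±`, `X_2^±` by shifts, and `C` by the central element `z`. -/

/-- The coefficient ring `ℂ[z, z⁻¹][u]`. -/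
abbrev Coeff : Type := Polynomial (LaurentPolynomial ℂ)

/-- The monomial `z ^ k`. -/
def zC (k : ℤ) : Coeff := Polynomial.C (LaurentPolynomial.T k)

theorem zC_add (k l : ℤ) : zC (k + l) = zC k * zC l := by
  rw [zC, LaurentPolynomial.T_add, map_mul]; rfl

theorem zC_zero : zC 0 = 1 := by simp [zC]

/-- A shift followed by a multiplication. -/
def shiftOp (d : ℤ) (g : ℤ → Coeff) : Module.End Coeff (ℤ → Coeff) where
  toFun φ s := g s * φ (s + d)
  map_add' φ ψ := by ext1 s; simp [mul_add]
  map_smul' c φ := by ext1 s; simp [mul_left_comm]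

theorem shiftOp_apply (d : ℤ) (g φ : ℤ → Coeff) (s : ℤ) :
    shiftOp d g φ s = g s * φ (s + d) := rfl

theorem shiftOp_mul (d e : ℤ) (g h : ℤ → Coeff) :
    shiftOp d g * shiftOp e h = shiftOp (d + e) fun s => g s * h (s + d) := by
  ext1 φ; ext1 s
  simp only [Module.End.mul_apply, shiftOp_apply, mul_assoc, add_assoc]

theorem shiftOp_one : shiftOp 0 (fun _ => 1) = 1 := by
  ext1 φ; ext1 s
  simp [shiftOp_apply]

/-- Multiplication by a function. -/
def diagOp : (ℤ → Coeff) →ₐ[ℂ] Module.End Coeff (ℤ → Coeff) where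
  toFun g := shiftOp 0 g
  map_one' := shiftOp_one
  map_mul' g h := by rw [shiftOp_mul]; simp only [add_zero]; rfl
  map_zero' := by ext1 φ; ext1 s; simp [shiftOp_apply]
  map_add' g h := by ext1 φ; ext1 s; simp [shiftOp_apply, add_mul]
  commutes' c := by
    ext1 φ; ext1 s
    simp [shiftOp_apply, Algebra.smul_def, Module.algebraMap_end_apply]

theorem diagOp_eq (g : ℤ → Coeff) : diagOp g = shiftOp 0 g := rfl

theorem aeval_diagOp (g : ℤ → Coeff) (f : ℂ[X]) :
    aeval (diagOp g) f = diagOp fun s => aeval (g s) f := by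
  rw [aeval_algHom_apply]
  congr 1
  ext1 s
  exact (aeval_algHom_apply (Pi.evalAlgHom ℂ (fun _ : ℤ => Coeff) s) g f).symm

/-- The eigenvalue `u + t s` of `H`. -/
def eigenH (t : ℂ) (s : ℤ) : Coeff := X + algebraMap ℂ Coeff (t * s)

theorem eigenH_add (t : ℂ) (s d : ℤ) :
    eigenH t (s + d) = eigenH t s + algebraMap ℂ Coeff (t * d) := by
  simp only [eigenH, add_assoc, ← map_add]; congr 2; push_cast; ring

theorem aeval_eigenH_add (t : ℂ) (s d : ℤ) (f : ℂ[X]) :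
    aeval (eigenH t (s + d)) f = aeval (eigenH t s) (taylor (t * d) f) := by
  rw [eigenH_add, aeval_add_algebraMap]

theorem aeval_eigenH_ne_zero (t : ℂ) (s : ℤ) (f : ℂ[X]) (hf : f ≠ 0) :
    aeval (eigenH t s) f ≠ 0 := by
  rw [eigenH, aeval_add_algebraMap, aeval_X_left_eq_map,
    Polynomial.map_ne_zero_iff (algebraMap ℂ (LaurentPolynomial ℂ)).injective]
  exact fun h => hf (taylor_injective _ (by rw [h, map_zero]))

theorem diagOp_eigenH_mul_shiftOp (t : ℂ) (d : ℤ) (g : ℤ → Coeff) :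
    diagOp (eigenH t) * shiftOp d g - shiftOp d g * diagOp (eigenH t)
      = (-(t * d)) • shiftOp d g := by
  rw [diagOp_eq, shiftOp_mul, shiftOp_mul]
  ext1 φ; ext1 s
  change _ = (-(t * d)) • (g s * φ (s + d))
  rw [Algebra.smul_def]
  simp only [LinearMap.sub_apply, Pi.sub_apply, shiftOp_apply, zero_add, add_zero, eigenH_add,
    map_neg]
  ring

namespace Config

variable {m n : ℕ} (L : Config m n) (α : Fin 2 → ℂ)

/-- The action of the generators; `a m + b n = 1` makes `Y₁ ^ m Y₂ ^ n` act by `z`. -/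
def repGen (t : ℂ) (a b : ℤ) : Gen → Module.End Coeff (ℤ → Coeff)
  | .H => diagOp (eigenH t)
  | .Xp i => ![shiftOp n fun s => zC a * aeval (eigenH t s) (taylor (-(α 0 / 2)) (L.poly α 0)),
      shiftOp (-m) fun _ => zC b] i
  | .Xm i => ![shiftOp (-n) fun _ => zC (-a),
      shiftOp m fun s => zC (-b) * aeval (eigenH t s) (taylor (α 1 / 2) (L.poly α 1))] i

variable {α}

/-- Current conservation in terms of the polynomials `P₁, P₂`. -/
theorem taylor_poly_mul (hm : 0 < m) (hmn : m.Coprime n)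
    (hmnα : (m : ℂ) * α 0 + (n : ℂ) * α 1 = 0) :
    taylor (-(α 0 / 2)) (L.poly α 0) * taylor (-α 0) (taylor (α 1 / 2) (L.poly α 1)) =
      taylor (α 1 / 2) (L.poly α 1) * taylor (α 1) (taylor (-(α 0 / 2)) (L.poly α 0)) := by
  have hV := L.isFaceMult_vert hm hmn
  have hH := L.isFaceMult_horiz hm hmn
  have e1 : taylor (-(α 0 / 2)) (L.poly α 0) = facePoly m n α fun x => L.vert (x + (-1, 0)) := by
    rw [← hV.taylor_facePoly hmnα, ← taylor_poly_zero, taylor_taylor]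
    congr 2; simp [faceValue]; ring
  have e2 : taylor (-α 0) (taylor (α 1 / 2) (L.poly α 1))
      = facePoly m n α fun x => L.horiz (x + (-1, 0)) := by
    rw [← hH.taylor_facePoly hmnα, ← taylor_poly_one]
    congr 2; simp [faceValue]
  have e3 : taylor (α 1) (taylor (-(α 0 / 2)) (L.poly α 0))
      = facePoly m n α fun x => L.vert (x + (-1, 1)) := by
    rw [← hV.taylor_facePoly hmnα, ← taylor_poly_zero, taylor_taylor, taylor_taylor]
    congr 2; simp [faceValue]; ring
  rw [e2, e3, e1, taylor_poly_one, ← (hV.shift _).facePoly_mul (hH.shift _),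
    ← hH.facePoly_mul (hV.shift _)]
  congr 1
  ext ⟨x, y⟩
  have := L.ice (x - 1) y
  have a1 : (x, y) + ((-1, 0) : ℤ × ℤ) = (x - 1, y) := by ext <;> simp; ring
  have a2 : (x, y) + ((-1, 1) : ℤ × ℤ) = (x - 1, y + 1) := by ext <;> simp; ring
  rw [a1, a2]
  simp only [sub_add_cancel] at this
  omega

theorem repGen_rel (hm : 0 < m) (hmn : m.Coprime n) (hmnα : (m : ℂ) * α 0 + (n : ℂ) * α 1 = 0)
    {t : ℂ} (h0 : α 0 = -(t * n)) (h1 : α 1 = t * m) (a b : ℤ) {x y : FreeAlgebra ℂ Gen}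
    (h : Rel α (L.poly α) x y) :
    FreeAlgebra.lift ℂ (L.repGen α t a b) x = FreeAlgebra.lift ℂ (L.repGen α t a b) y := by
  set Φ := FreeAlgebra.lift ℂ (L.repGen α t a b)
  have hg : ∀ g, Φ (gen g) = L.repGen α t a b g := fun g => FreeAlgebra.lift_ι_apply _ _
  have hX0 : Φ (gen (.Xp 0)) = shiftOp n fun s =>
    zC a * aeval (eigenH t s) (taylor (-(α 0 / 2)) (L.poly α 0)) := hg _
  have hX1 : Φ (gen (.Xp 1)) = shiftOp (-m) fun _ => zC b := hg _
  have hY0 : Φ (gen (.Xm 0)) = shiftOp (-n) fun _ => zC (-a) := hg _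
  have hY1 : Φ (gen (.Xm 1)) = shiftOp m fun s =>
    zC (-b) * aeval (eigenH t s) (taylor (α 1 / 2) (L.poly α 1)) := hg _
  have hH : Φ (gen .H) = diagOp (eigenH t) := hg _
  have hz : ∀ k, zC k * zC (-k) = 1 := fun k => by rw [← zC_add, add_neg_cancel, zC_zero]
  have e0 : -α 0 = t * ((n : ℤ) : ℂ) := by rw [h0]; push_cast; ring
  have e1 : α 1 = t * ((m : ℤ) : ℂ) := by rw [h1]; push_cast; ring
  have e0' : α 0 = t * ((-n : ℤ) : ℂ) := by rw [h0]; push_cast; ring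
  have e1' : -α 1 = t * ((-m : ℤ) : ℂ) := by rw [h1]; push_cast; ring
  have e0'' : -(t * ((n : ℤ) : ℂ)) = α 0 := by rw [← e0, neg_neg]
  have e1'' : -(t * ((-m : ℤ) : ℂ)) = α 1 := by rw [← e1', neg_neg]
  have e2 : -(t * ((-n : ℤ) : ℂ)) = -α 0 := by rw [← e0']
  have e3 : -(t * ((m : ℤ) : ℂ)) = -α 1 := by rw [← e1]
  have hpoly : ∀ (c : ℂ) (f : ℂ[X]), Φ (aeval (gen .H + algebraMap ℂ _ c) f)
      = shiftOp 0 fun s => aeval (eigenH t s) (taylor c f) := by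
    intro c f
    rw [← aeval_algHom_apply, map_add, AlgHom.commutes, hH]
    exact (aeval_add_algebraMap (diagOp (eigenH t)) c f).trans (aeval_diagOp _ _)
  have hpoly' : ∀ (c : ℂ) (f : ℂ[X]), Φ (aeval (gen .H - algebraMap ℂ _ c) f)
      = shiftOp 0 fun s => aeval (eigenH t s) (taylor (-c) f) := by
    intro c f
    rw [← hpoly, map_neg, sub_eq_add_neg]
  have two : ∀ i : Fin 2, i = 0 ∨ i = 1 := by decide
  cases h with
  | H_Xp i =>
    rw [map_sub, map_mul, map_mul, map_smul, hH]
    rcases two i with rfl | rfl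
    · rw [hX0, diagOp_eigenH_mul_shiftOp, e0'']
    · rw [hX1, diagOp_eigenH_mul_shiftOp, e1'']
  | H_Xm i =>
    rw [map_sub, map_mul, map_mul, map_smul, hH]
    rcases two i with rfl | rfl
    · rw [hY0, diagOp_eigenH_mul_shiftOp, e2]
    · rw [hY1, diagOp_eigenH_mul_shiftOp, e3]
  | Xp_Xm i =>
    rw [map_mul, hpoly']
    rcases two i with rfl | rfl
    · rw [hX0, hY0, shiftOp_mul, add_neg_cancel]
      refine congrArg (shiftOp _) (funext fun s => ?_)
      linear_combination aeval (eigenH t s) (taylor (-(α 0 / 2)) (L.poly α 0)) * hz a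
    · rw [hX1, hY1, shiftOp_mul, neg_add_cancel]
      refine congrArg (shiftOp _) (funext fun s => ?_)
      rw [aeval_eigenH_add, taylor_taylor, ← e1',
        show -α 1 + α 1 / 2 = -(α 1 / 2) by ring]
      linear_combination aeval (eigenH t s) (taylor (-(α 1 / 2)) (L.poly α 1)) * hz b
  | Xm_Xp i =>
    rw [map_mul, hpoly]
    rcases two i with rfl | rfl
    · rw [hX0, hY0, shiftOp_mul, neg_add_cancel]
      refine congrArg (shiftOp _) (funext fun s => ?_)
      rw [aeval_eigenH_add, taylor_taylor, ← e0', show α 0 + -(α 0 / 2) = α 0 / 2 by ring]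
      linear_combination aeval (eigenH t s) (taylor (α 0 / 2) (L.poly α 0)) * hz a
    · rw [hX1, hY1, shiftOp_mul, add_neg_cancel]
      refine congrArg (shiftOp _) (funext fun s => ?_)
      linear_combination aeval (eigenH t s) (taylor (α 1 / 2) (L.poly α 1)) * hz b
  | comm i j hij =>
    rw [map_mul, map_mul]
    rcases two i with rfl | rfl <;> rcases two j with rfl | rfl
    · exact absurd rfl hij
    · rw [hX0, hY1, shiftOp_mul, shiftOp_mul, add_comm (n : ℤ)]
      refine congrArg (shiftOp _) (funext fun s => ?_)
      have key : aeval (eigenH t s) (taylor (-(α 0 / 2)) (L.poly α 0))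
          * aeval (eigenH t (s + n)) (taylor (α 1 / 2) (L.poly α 1))
          = aeval (eigenH t s) (taylor (α 1 / 2) (L.poly α 1))
            * aeval (eigenH t (s + m)) (taylor (-(α 0 / 2)) (L.poly α 0)) := by
        rw [aeval_eigenH_add, aeval_eigenH_add, ← e0, ← e1, ← map_mul, ← map_mul,
          L.taylor_poly_mul hm hmn hmnα]
      rw [mul_mul_mul_comm, key, mul_mul_mul_comm (zC (-b)), mul_comm (zC a)]
    · rw [hX1, hY0, shiftOp_mul, shiftOp_mul, add_comm (-(m : ℤ))]
      refine congrArg (shiftOp _) (funext fun s => ?_)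
      ring
    · exact absurd rfl hij

/-- The representation before killing torsion. -/
def preRep (hm : 0 < m) (hmn : m.Coprime n) (hmnα : (m : ℂ) * α 0 + (n : ℂ) * α 1 = 0)
    {t : ℂ} (h0 : α 0 = -(t * n)) (h1 : α 1 = t * m) (a b : ℤ) :
    PreAlg α (L.poly α) →ₐ[ℂ] Module.End Coeff (ℤ → Coeff) :=
  RingQuot.liftAlgHom ℂ ⟨FreeAlgebra.lift ℂ (L.repGen α t a b),
    fun _ _ h => L.repGen_rel hm hmn hmnα h0 h1 a b h⟩

theorem preRep_preGen (hm : 0 < m) (hmn : m.Coprime n)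
    (hmnα : (m : ℂ) * α 0 + (n : ℂ) * α 1 = 0)
    {t : ℂ} (h0 : α 0 = -(t * n)) (h1 : α 1 = t * m) (a b : ℤ) (g : Gen) :
    L.preRep hm hmn hmnα h0 h1 a b (preGen α (L.poly α) g) = L.repGen α t a b g := by
  rw [preRep, preGen, RingQuot.liftAlgHom_mkAlgHom_apply]
  exact FreeAlgebra.lift_ι_apply _ _

theorem preRep_torsion (hm : 0 < m) (hmn : m.Coprime n)
    (hmnα : (m : ℂ) * α 0 + (n : ℂ) * α 1 = 0)
    {t : ℂ} (h0 : α 0 = -(t * n)) (h1 : α 1 = t * m) (a b : ℤ) (x : PreAlg α (L.poly α))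
    (hx : x ∈ torsionIdeal α (L.poly α)) : L.preRep hm hmn hmnα h0 h1 a b x = 0 := by
  obtain ⟨f, hf, hx⟩ := hx
  have h := congrArg (L.preRep hm hmn hmnα h0 h1 a b) hx
  have hH : L.preRep hm hmn hmnα h0 h1 a b (preGen α (L.poly α) .H) = diagOp (eigenH t) :=
    L.preRep_preGen hm hmn hmnα h0 h1 a b .H
  rw [map_mul, map_zero, ← aeval_algHom_apply, hH, aeval_diagOp] at h
  refine LinearMap.ext fun φ => funext fun s => ?_
  have h2 := congrFun (LinearMap.congr_fun h φ) s
  rw [Module.End.mul_apply, diagOp_eq, shiftOp_apply, add_zero] at h2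
  exact (mul_eq_zero.1 h2).resolve_left (aeval_eigenH_ne_zero t s f hf)

/-- The representation of the Kleinian fiber product. -/
def rep (hm : 0 < m) (hmn : m.Coprime n) (hmnα : (m : ℂ) * α 0 + (n : ℂ) * α 1 = 0)
    {t : ℂ} (h0 : α 0 = -(t * n)) (h1 : α 1 = t * m) (a b : ℤ) :
    Alg α (L.poly α) →ₐ[ℂ] Module.End Coeff (ℤ → Coeff) :=
  Ideal.Quotient.liftₐ _ (L.preRep hm hmn hmnα h0 h1 a b)
    (L.preRep_torsion hm hmn hmnα h0 h1 a b)

theorem rep_algGen (hm : 0 < m) (hmn : m.Coprime n) (hmnα : (m : ℂ) * α 0 + (n : ℂ) * α 1 = 0)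
    {t : ℂ} (h0 : α 0 = -(t * n)) (h1 : α 1 = t * m) (a b : ℤ) (g : Gen) :
    L.rep hm hmn hmnα h0 h1 a b (algGen α (L.poly α) g) = L.repGen α t a b g :=
  L.preRep_preGen hm hmn hmnα h0 h1 a b g

/-- Shifts by constant monomials are invertible. -/
def shiftUnit : Multiplicative (ℤ × ℤ) →* (Module.End Coeff (ℤ → Coeff))ˣ where
  toFun d :=
    { val := shiftOp d.toAdd.1 fun _ => zC d.toAdd.2
      inv := shiftOp (-d.toAdd.1) fun _ => zC (-d.toAdd.2)
      val_inv := by rw [shiftOp_mul]; simp only [← zC_add, add_neg_cancel, zC_zero, shiftOp_one]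
      inv_val := by rw [shiftOp_mul]; simp only [← zC_add, neg_add_cancel, zC_zero, shiftOp_one] }
  map_one' := Units.ext (by simp [zC_zero, shiftOp_one])
  map_mul' d e := Units.ext (by simp [shiftOp_mul, zC_add])

/-- The gauge given by the representation. -/
def repGauge (hm : 0 < m) (hmn : m.Coprime n) (hmnα : (m : ℂ) * α 0 + (n : ℂ) * α 1 = 0)
    {t : ℂ} (h0 : α 0 = -(t * n)) (h1 : α 1 = t * m) (a b : ℤ) :
    Gauge α (L.poly α) (Module.End Coeff (ℤ → Coeff)) where
  hom := (L.rep hm hmn hmnα h0 h1 a b).toRingHom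
  u₁ := shiftUnit (Multiplicative.ofAdd (-n, -a))
  u₂ := shiftUnit (Multiplicative.ofAdd (-m, b))
  hom_Xm := L.rep_algGen hm hmn hmnα h0 h1 a b (.Xm 0)
  hom_X := L.rep_algGen hm hmn hmnα h0 h1 a b (.Xp 1)

theorem repGauge_mono (hm : 0 < m) (hmn : m.Coprime n) (hmnα : (m : ℂ) * α 0 + (n : ℂ) * α 1 = 0)
    {t : ℂ} (h0 : α 0 = -(t * n)) (h1 : α 1 = t * m) (a b : ℤ) (hab : a * m + b * n = 1) (k : ℤ) :
    ((L.repGauge hm hmn hmnα h0 h1 a b).mono (k • ((m : ℤ), (n : ℤ))) :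
      Module.End Coeff (ℤ → Coeff)) = diagOp fun _ => zC k := by
  rw [Gauge.mono, repGauge]
  simp only
  rw [← map_zpow shiftUnit, ← map_zpow shiftUnit, ← map_mul shiftUnit, ← ofAdd_zsmul, ← ofAdd_zsmul,
    ← ofAdd_add]
  have e : (k • ((m : ℤ), (n : ℤ))).2 • (-(m : ℤ), b) + (-(k • ((m : ℤ), (n : ℤ))).1) •
      (-(n : ℤ), -a) = (0, k) := by
    ext
    · simp; ring
    · simp; linear_combination k * hab
  rw [e]
  rfl

theorem repGauge_poly (hm : 0 < m) (hmn : m.Coprime n) (hmnα : (m : ℂ) * α 0 + (n : ℂ) * α 1 = 0)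
    {t : ℂ} (h0 : α 0 = -(t * n)) (h1 : α 1 = t * m) (a b : ℤ) (f : ℂ[X]) :
    (L.repGauge hm hmn hmnα h0 h1 a b).poly f = diagOp fun s => aeval (eigenH t s) f := by
  rw [Gauge.poly, repGauge]
  refine (aeval_algHom_apply (L.rep hm hmn hmnα h0 h1 a b) _ _).symm.trans ?_
  rw [elH, rep_algGen]
  exact aeval_diagOp _ _

end Config

/-! ### The localization as a gauge -/

namespace Gauge

variable {α : Fin 2 → ℂ} {p : Fin 2 → ℂ[X]} {B B' : Type*} [Ring B] [Ring B']

/-- Two gauges combine to one with values in the product ring. -/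
def prod (G : Gauge α p B) (G' : Gauge α p B') : Gauge α p (B × B') where
  hom := G.hom.prod G'.hom
  u₁ := MulEquiv.prodUnits.symm (G.u₁, G'.u₁)
  u₂ := MulEquiv.prodUnits.symm (G.u₂, G'.u₂)
  hom_Xm := Prod.ext G.hom_Xm G'.hom_Xm
  hom_X := Prod.ext G.hom_X G'.hom_X

theorem prod_mono (G : Gauge α p B) (G' : Gauge α p B') (d : ℤ × ℤ) :
    ((G.prod G').mono d : B × B') = (↑(G.mono d), ↑(G'.mono d)) := by
  have h : (G.prod G').mono d = MulEquiv.prodUnits.symm (G.mono d, G'.mono d) := by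
    simp only [mono, prod, ← map_zpow, ← map_mul]
    rfl
  rw [h]; rfl

theorem prod_hom_eq_iff (G : Gauge α p B) (G' : Gauge α p B') (a : Alg α p) (d : ℤ × ℤ)
    (q : ℂ[X]) : (G.prod G').hom a = (G.prod G').mono d * (G.prod G').poly q ↔
      G.hom a = G.mono d * G.poly q ∧ G'.hom a = G'.mono d * G'.poly q := by
  rw [prod_mono]
  exact Prod.ext_iff

theorem mem_cyclicSubalgebra (G : Gauge α p B) (hG : Function.Injective G.hom) {a : Alg α p}
    {d : ℤ × ℤ} (hd : Config.faceValue α d = 0) {q : ℂ[X]} (h : G.hom a = G.mono d * G.poly q) :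
    a ∈ cyclicSubalgebra α p := by
  rw [Subalgebra.mem_centralizer_iff]
  rintro _ rfl
  refine hG ?_
  rw [map_mul, map_mul, G.hom_elH, h, G.mono_zero, Units.val_one, one_mul, ← mul_assoc,
    G.poly_mul_mono, hd, taylor_zero, mul_assoc, mul_assoc, (G.poly_commute _ _).eq]

/-- A preimage of the monomial `Y₂ ^ l Y₁ ^ k` under an injective gauge is a preimage under every
gauge, since it is characterized by an equation that does not involve inverses. -/
theorem hom_eq_mono_of_injective (G : Gauge α p B) (G' : Gauge α p B')
    (hG : Function.Injective G.hom) {a : Alg α p} (k l : ℕ)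
    (h : G.hom a = G.mono ((k : ℤ), (l : ℤ))) : G'.hom a = G'.mono ((k : ℤ), (l : ℤ)) := by
  have key : a * elXm α p 0 ^ k = elX α p 1 ^ l := by
    refine hG ?_
    rw [map_mul, map_pow, map_pow, h, G.hom_Xm, G.hom_X, ← Units.val_pow_eq_pow_val,
      ← Units.val_pow_eq_pow_val, ← Units.val_mul]
    congr 1
    simp [mono]
  have h' := congrArg G'.hom key
  rw [map_mul, map_pow, map_pow, G'.hom_Xm, G'.hom_X, ← Units.val_pow_eq_pow_val,
    ← Units.val_pow_eq_pow_val] at h'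
  rw [(Units.eq_mul_inv_iff_mul_eq _).2 h', ← Units.val_mul]
  congr 1
  simp [mono]

end Gauge

namespace Config

/-- The assumptions on `m, n` and `α`, with the number `t` such that `α = (-t n, t m)` and Bézout
coefficients for `m, n`. -/
structure Params (m n : ℕ) (α : Fin 2 → ℂ) where
  hm : 0 < m
  hn : 0 < n
  hmn : m.Coprime n
  hα : α ≠ 0
  hmnα : (m : ℂ) * α 0 + (n : ℂ) * α 1 = 0
  t : ℂ
  h0 : α 0 = -(t * n)
  h1 : α 1 = t * m
  a : ℤ
  b : ℤ
  hab : a * m + b * n = 1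

theorem exists_params {m n : ℕ} {α : Fin 2 → ℂ} (hm : 0 < m) (hn : 0 < n) (hmn : m.Coprime n)
    (hα : α ≠ 0) (hmnα : (m : ℂ) * α 0 + (n : ℂ) * α 1 = 0) : Nonempty (Params m n α) := by
  obtain ⟨a, b, hab⟩ : IsCoprime (m : ℤ) (n : ℤ) := Nat.isCoprime_iff_coprime.2 hmn
  have hm' : (m : ℂ) ≠ 0 := by exact_mod_cast hm.ne'
  refine ⟨⟨hm, hn, hmn, hα, hmnα, α 1 / m, ?_, ?_, a, b, hab⟩⟩
  · field_simp
    linear_combination hmnα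
  · field_simp

variable {m n : ℕ} {L : Config m n} {α : Fin 2 → ℂ} (S : Params m n α)

theorem facePoly_ne_zero (g : ℤ × ℤ → ℕ) : facePoly m n α g ≠ 0 :=
  finprod_induction (· ≠ 0) one_ne_zero (fun _ _ => mul_ne_zero)
    (fun _ => pow_ne_zero _ (X_sub_C_ne_zero _))

theorem poly_ne_zero (i : Fin 2) : L.poly α i ≠ 0 := by
  rcases (by decide : ∀ i : Fin 2, i = 0 ∨ i = 1) i with rfl | rfl
  · exact fun h => facePoly_ne_zero L.vert (by rw [← L.taylor_poly_zero α]; simp [h])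
  · exact fun h => facePoly_ne_zero L.horiz (by rw [← L.taylor_poly_one α]; simp [h])

theorem taylor_poly_ne_zero (c : ℂ) (i : Fin 2) : taylor c (L.poly α i) ≠ 0 :=
  fun h => poly_ne_zero i (taylor_injective c (by rw [h, map_zero]))

theorem isUnit_toLoc_elX (i : Fin 2) : IsUnit (toLoc α (L.poly α) (elX α (L.poly α) i)) := by
  rw [isUnit_iff_exists_and_exists]
  constructor
  · refine ⟨toLoc α (L.poly α) (elXm α (L.poly α) i) *
      invPoly α (L.poly α) _ (taylor_poly_ne_zero (L := L) (α := α) (-(α i / 2)) i), ?_⟩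
    rw [← mul_assoc, ← map_mul, elX_elXm, toLoc_mul_invPoly]
  · refine ⟨invPoly α (L.poly α) _ (taylor_poly_ne_zero (L := L) (α := α) (α i / 2) i) *
      toLoc α (L.poly α) (elXm α (L.poly α) i), ?_⟩
    rw [mul_assoc, ← map_mul, elXm_elX, invPoly_mul_toLoc]

theorem isUnit_toLoc_elXm (i : Fin 2) : IsUnit (toLoc α (L.poly α) (elXm α (L.poly α) i)) := by
  rw [isUnit_iff_exists_and_exists]
  constructor
  · refine ⟨toLoc α (L.poly α) (elX α (L.poly α) i) *
      invPoly α (L.poly α) _ (taylor_poly_ne_zero (L := L) (α := α) (α i / 2) i), ?_⟩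
    rw [← mul_assoc, ← map_mul, elXm_elX, toLoc_mul_invPoly]
  · refine ⟨invPoly α (L.poly α) _ (taylor_poly_ne_zero (L := L) (α := α) (-(α i / 2)) i) *
      toLoc α (L.poly α) (elX α (L.poly α) i), ?_⟩
    rw [mul_assoc, ← map_mul, elX_elXm, invPoly_mul_toLoc]

variable (L α) in
/-- The gauge given by the localization. -/
def locGauge : Gauge α (L.poly α) (AlgLoc α (L.poly α)) where
  hom := toLoc α (L.poly α)
  u₁ := (isUnit_toLoc_elXm 0).unit
  u₂ := (isUnit_toLoc_elX 1).unit
  hom_Xm := rfl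
  hom_X := rfl

theorem locGauge_injective : Function.Injective (L.locGauge α).hom := toLoc_injective _ _

theorem locGauge_poly_mul_invPoly (f : ℂ[X]) (hf : f ≠ 0) :
    (L.locGauge α).poly f * invPoly α (L.poly α) f hf = 1 := toLoc_mul_invPoly _ _ f hf

variable (L) in
/-- The gauge given by the localization and the representation together. -/
def fullGauge : Gauge α (L.poly α) (AlgLoc α (L.poly α) × Module.End Coeff (ℤ → Coeff)) :=
  (L.locGauge α).prod (L.repGauge S.hm S.hmn S.hmnα S.h0 S.h1 S.a S.b)

theorem fullGauge_injective : Function.Injective (L.fullGauge S).hom := fun _ _ h =>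
  locGauge_injective (congrArg Prod.fst h)

end Config

/-! ### The elements `C_{k,l}` -/

namespace Config

variable {m n : ℕ} {L : Config m n} {α : Fin 2 → ℂ} {B : Type*} [Ring B]

theorem hom_pathX (hm : 0 < m) (hmn : m.Coprime n) (hmnα : (m : ℂ) * α 0 + (n : ℂ) * α 1 = 0)
    (G : Gauge α (L.poly α) B) (i : List (Fin 2)) :
    G.hom (L.pathX α i) = G.mono ((i.count 0 : ℤ), (i.count 1 : ℤ)) *
      G.poly (facePoly m n α (L.vertCross i)) := by
  induction i with
  | nil =>
    have h : facePoly m n α (L.vertCross []) = 1 := by simp [facePoly, vertCross]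
    rw [h]
    simp [pathX, Gauge.poly_one, Prod.mk_zero_zero, Gauge.mono_zero]
  | cons j i ih =>
    have e : L.pathX α (j :: i) = L.pathX α i * elX α (L.poly α) j := by simp [pathX]
    have hv := L.isFaceMult_vertCross hm hmn i
    rw [e]
    rcases (by decide : ∀ j : Fin 2, j = 0 ∨ j = 1) j with rfl | rfl
    · rw [G.hom_mul ih G.hom_elX_zero, hv.taylor_facePoly hmnα, taylor_poly_zero,
        ← (hv.shift _).facePoly_mul (L.isFaceMult_vert hm hmn)]
      congr 3
      · ext <;> simp
      · ext x; rw [vertCross, add_comm]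
    · rw [G.hom_mul ih G.hom_elX_one, hv.taylor_facePoly hmnα, mul_one]
      congr 3
      ext <;> simp

theorem poly_mul_invPoly_eq {f g f' g' : ℂ[X]} (hg : g ≠ 0) (hg' : g' ≠ 0) (h : f * g' = f' * g) :
    (L.locGauge α).poly f * invPoly α (L.poly α) g hg
      = (L.locGauge α).poly f' * invPoly α (L.poly α) g' hg' := by
  set G := L.locGauge α
  have h1 : G.poly f = G.poly f' * invPoly α (L.poly α) g' hg' * G.poly g := by
    have hc : Commute (G.poly g) (invPoly α (L.poly α) g' hg') :=
      (show Commute (G.poly g) ↑(OreLocalization.numeratorUnit (polyH.of α (L.poly α) g' hg')) from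
        G.poly_commute g g').units_inv_right
    rw [mul_assoc, ← hc.eq, ← mul_assoc, ← G.poly_mul, ← h, G.poly_mul, mul_assoc,
      locGauge_poly_mul_invPoly, mul_one]
  rw [h1, mul_assoc, locGauge_poly_mul_invPoly, mul_one]

theorem pathC_eq (hm : 0 < m) (hmn : m.Coprime n) (hmnα : (m : ℂ) * α 0 + (n : ℂ) * α 1 = 0)
    (i : List (Fin 2)) : L.pathC α i = (L.locGauge α).mono ((i.count 0 : ℤ), (i.count 1 : ℤ)) *
      ((L.locGauge α).poly (facePoly m n α (L.vertCross i)) *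
        invPoly α (L.poly α) (L.orderPoly α i) (L.orderPoly_ne_zero α i)) := by
  rw [← mul_assoc, ← hom_pathX hm hmn hmnα]
  rfl

/-- The excess of vertical over horizontal crossings is a difference of heights, so for two paths
with the same end points the orders differ in the same way as the vertical crossing numbers. -/
theorem pathC_eq_pathC (hm : 0 < m) (hn : 0 < n) (hmn : m.Coprime n)
    (hmnα : (m : ℂ) * α 0 + (n : ℂ) * α 1 = 0) {i j : List (Fin 2)} (h0 : i.count 0 = j.count 0)
    (h1 : i.count 1 = j.count 1) : L.pathC α i = L.pathC α j := by
  rw [pathC_eq hm hmn hmnα, pathC_eq hm hmn hmnα, h0, h1]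
  congr 1
  refine poly_mul_invPoly_eq _ _ ?_
  change facePoly m n α _ * facePoly m n α _ = facePoly m n α _ * facePoly m n α _
  rw [← (L.isFaceMult_vertCross hm hmn i).facePoly_mul (L.isFaceMult_order hm hmn j),
    ← (L.isFaceMult_vertCross hm hmn j).facePoly_mul (L.isFaceMult_order hm hmn i)]
  congr 1
  ext x
  have hi := L.vertCross_sub_horizCross hm hn i x
  have hj := L.vertCross_sub_horizCross hm hn j x
  rw [h0, h1, ← hj] at hi
  simp only [order]
  omega

/-- Going once around the cylinder a path has as many vertical as horizontal crossings, so `C` is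
just a monomial. -/
theorem elC_eq_mono (hm : 0 < m) (hn : 0 < n) (hmn : m.Coprime n)
    (hmnα : (m : ℂ) * α 0 + (n : ℂ) * α 1 = 0) :
    L.elC α m n = (L.locGauge α).mono ((m : ℤ), (n : ℤ)) := by
  set i : List (Fin 2) := List.replicate m 0 ++ List.replicate n 1 with hi
  have c0 : i.count 0 = m := by simp [hi, List.count_replicate]
  have c1 : i.count 1 = n := by simp [hi, List.count_replicate]
  have hord : L.vertCross i = L.order i := by
    ext x
    have := L.vertCross_sub_horizCross hm hn i x
    rw [c0, c1, height_period] at this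
    simp only [order]
    omega
  have key : ∀ (f g : ℂ[X]) (hg : g ≠ 0), f = g →
      (L.locGauge α).poly f * invPoly α (L.poly α) g hg = 1 := by
    rintro f _ hg rfl
    exact locGauge_poly_mul_invPoly f hg
  rw [elC, pathC_eq hm hmn hmnα, c0, c1, key _ _ _ (by rw [hord]; rfl), mul_one]

theorem commute_mono_period (S : Params m n α) (G : Gauge α (L.poly α) B) (a : Alg α (L.poly α)) :
    Commute (G.mono ((m : ℤ), (n : ℤ)) : B) (G.hom a) := by
  have ha : a ∈ ⨆ d, piece G d := by
    rw [iSup_piece S.hm S.hn S.hmn S.hα S.hmnα]; trivial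
  induction ha using Submodule.iSup_induction' with
  | mem d a ha =>
    obtain ⟨q, hq, -⟩ := ha
    have hP : faceValue α ((m : ℤ), (n : ℤ)) = 0 := by
      simpa using faceValue_zsmul_period S.hmnα 1
    have h1 : Commute (G.mono ((m : ℤ), (n : ℤ)) : B) (G.mono d) := by
      rw [Commute, SemiconjBy, ← Units.val_mul, ← Units.val_mul, ← G.mono_add, ← G.mono_add,
        add_comm]
    have h2 : Commute (G.mono ((m : ℤ), (n : ℤ)) : B) (G.poly q) := by
      have := G.poly_mul_mono ((m : ℤ), (n : ℤ)) q
      rw [hP, taylor_zero] at this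
      exact this.symm
    rw [hq]
    exact h1.mul_right h2
  | zero => rw [map_zero]; exact Commute.zero_right _
  | add a b _ _ iha ihb => rw [map_add]; exact iha.add_right ihb

/-! ### Elements of given degree that do not vanish at a face -/

theorem exists_of_adj (S : Params m n α) (G : Gauge α (L.poly α) B) {w z : ℤ × ℤ}
    (h : L.Adj w z) : ∃ (a : Alg α (L.poly α)) (q : ℂ[X]),
      G.hom a = G.mono (z - w) * G.poly q ∧ q.eval (faceValue α w) ≠ 0 := by
  rcases h with ⟨rfl, h⟩ | ⟨rfl, -⟩ | ⟨rfl, -⟩ | ⟨rfl, h⟩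
  · refine ⟨_, _, by rw [add_sub_cancel_left]; exact G.hom_elX_zero, ?_⟩
    rwa [taylor_poly_zero, Ne, (L.isFaceMult_vert S.hm S.hmn).eval_facePoly_faceValue S.hm S.hn
      S.hmn S.hα S.hmnα, not_not]
  · exact ⟨_, _, by rw [add_sub_cancel_left]; exact G.hom_elX_one, by simp⟩
  · refine ⟨_, _, by rw [sub_add_cancel_left]; exact G.hom_elXm_zero, by simp⟩
  · refine ⟨_, _, by rw [sub_add_cancel_left]; exact G.hom_elXm_one, ?_⟩
    rw [taylor_eval, show faceValue α (z + (0, 1)) + -(α 1 / 2) = faceValue α z + α 1 / 2 by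
      simp [faceValue]; ring, ← taylor_eval, taylor_poly_one, Ne,
      (L.isFaceMult_horiz S.hm S.hmn).eval_facePoly_faceValue S.hm S.hn S.hmn S.hα S.hmnα, not_not]
    exact h

theorem exists_of_reach (S : Params m n α) (G : Gauge α (L.poly α) B) {x z : ℤ × ℤ}
    (h : L.Reach x z) : ∃ (a : Alg α (L.poly α)) (q : ℂ[X]),
      G.hom a = G.mono (z - x) * G.poly q ∧ q.eval (faceValue α x) ≠ 0 := by
  induction h with
  | refl => exact ⟨1, 1, by simp [G.mono_zero, G.poly_one], by simp⟩
  | @tail w z _ h ih =>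
    obtain ⟨a, q, ha, hq⟩ := ih
    obtain ⟨b, r, hb, hr⟩ := exists_of_adj S G h
    refine ⟨b * a, _, by rw [G.hom_mul hb ha, sub_add_sub_cancel], ?_⟩
    rw [eval_mul, taylor_eval, ← faceValue_add, add_sub_cancel]
    exact mul_ne_zero hr hq

end Config

namespace Config

variable {m n : ℕ} {L : Config m n} {α : Fin 2 → ℂ}

/-! ### Evaluation of the cyclic subquotient in Laurent polynomials -/

/-- The value of the representation on the constant function at the point `0`, with `H` set to
`μ` there. -/
def evalRep (S : Params m n α) (μ : ℂ) : Alg α (L.poly α) →ₗ[ℂ] LaurentPolynomial ℂ where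
  toFun a := Polynomial.eval (algebraMap ℂ (LaurentPolynomial ℂ) μ)
    (L.rep S.hm S.hmn S.hmnα S.h0 S.h1 S.a S.b a 1 0)
  map_add' a b := by simp
  map_smul' c a := by
    have e : ∀ x : Coeff, c • x = Polynomial.C (algebraMap ℂ (LaurentPolynomial ℂ) c) * x :=
      fun x => Algebra.smul_def c x
    rw [map_smul, LinearMap.smul_apply, Pi.smul_apply, e, eval_mul, eval_C, Algebra.smul_def]
    rfl

theorem evalRep_of_diagOp (S : Params m n α) (μ : ℂ) {a : Alg α (L.poly α)} {g : ℤ → Coeff}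
    (h : L.rep S.hm S.hmn S.hmnα S.h0 S.h1 S.a S.b a = diagOp g) :
    evalRep S μ a = Polynomial.eval (algebraMap ℂ (LaurentPolynomial ℂ) μ) (g 0) := by
  change Polynomial.eval _ (L.rep S.hm S.hmn S.hmnα S.h0 S.h1 S.a S.b a 1 0) = _
  rw [h, diagOp_eq, shiftOp_apply, Pi.one_apply, mul_one]

theorem rep_of_hom_eq (S : Params m n α) {a : Alg α (L.poly α)} {k : ℤ} {q : ℂ[X]}
    (h : (L.fullGauge S).hom a
      = (L.fullGauge S).mono (k • ((m : ℤ), (n : ℤ))) * (L.fullGauge S).poly q) :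
    L.rep S.hm S.hmn S.hmnα S.h0 S.h1 S.a S.b a
      = diagOp fun s => zC k * aeval (eigenH S.t s) q := by
  have h1 := ((Gauge.prod_hom_eq_iff _ _ _ _ _).1 h).2
  rw [repGauge_mono _ _ _ _ _ _ _ _ S.hab, repGauge_poly, ← map_mul] at h1
  exact h1

theorem evalRep_of_hom_eq (S : Params m n α) (μ : ℂ) {a : Alg α (L.poly α)} {k : ℤ} {q : ℂ[X]}
    (h : (L.fullGauge S).hom a
      = (L.fullGauge S).mono (k • ((m : ℤ), (n : ℤ))) * (L.fullGauge S).poly q) :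
    evalRep S μ a = q.eval μ • LaurentPolynomial.T k := by
  have e : eigenH S.t 0 = X := by simp [eigenH]
  rw [evalRep_of_diagOp S μ (rep_of_hom_eq S h), eval_mul, zC, eval_C, e, aeval_X_left_eq_map,
    eval_map_algebraMap, aeval_algebraMap_apply, mul_comm, ← Algebra.smul_def]
  simp

theorem exists_rep_eq_diagOp (S : Params m n α) {a : Alg α (L.poly α)}
    (ha : a ∈ cyclicSubalgebra α (L.poly α)) :
    ∃ g, L.rep S.hm S.hmn S.hmnα S.h0 S.h1 S.a S.b a = diagOp g := by
  have h := mem_iSup_piece_of_commute S.hm S.hn S.hmn S.hα S.hmnα (L.fullGauge S)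
    (fullGauge_injective S) ((Subalgebra.mem_centralizer_iff ℂ).1 ha _ rfl)
  clear ha
  induction h using Submodule.iSup_induction' with
  | mem k a ha =>
    obtain ⟨q, hq, -⟩ := ha
    exact ⟨_, rep_of_hom_eq S hq⟩
  | zero => exact ⟨0, by rw [map_zero, map_zero]⟩
  | add a b _ _ iha ihb =>
    obtain ⟨g, hg⟩ := iha
    obtain ⟨h, hh⟩ := ihb
    exact ⟨g + h, by rw [map_add, map_add, hg, hh]⟩

/-- The homomorphism from the cyclic subalgebra to the Laurent polynomials that sends an element of
degree `k • (m, n)` with polynomial `q` to `q(μ) T ^ k`. -/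
def evalCyclic (S : Params m n α) (μ : ℂ) :
    cyclicSubalgebra α (L.poly α) →ₐ[ℂ] LaurentPolynomial ℂ :=
  AlgHom.ofLinearMap ((evalRep S μ).comp (cyclicSubalgebra α (L.poly α)).val.toLinearMap)
    (by
      refine (evalRep_of_diagOp S μ (g := 1) ?_).trans (by simp)
      exact (map_one _).trans (map_one _).symm)
    (by
      rintro ⟨a, ha⟩ ⟨b, hb⟩
      obtain ⟨g, hg⟩ := exists_rep_eq_diagOp S ha
      obtain ⟨h, hh⟩ := exists_rep_eq_diagOp S hb
      change evalRep S μ (a * b) = evalRep S μ a * evalRep S μ b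
      rw [evalRep_of_diagOp S μ hg, evalRep_of_diagOp S μ hh, ← eval_mul]
      exact evalRep_of_diagOp S μ (g := g * h) (by rw [map_mul, map_mul, hg, hh]))

theorem evalCyclic_cyclicH (S : Params m n α) (μ : ℂ) :
    evalCyclic S μ (cyclicH α (L.poly α)) = algebraMap ℂ _ μ := by
  refine (evalRep_of_diagOp S μ (L.rep_algGen S.hm S.hmn S.hmnα S.h0 S.h1 S.a S.b .H)).trans ?_
  simp [eigenH]

/-- The homomorphism induced on the cyclic subquotient. -/
def evalSubquotient (S : Params m n α) (μ : ℂ) :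
    CyclicSubquotient α (L.poly α) μ →ₐ[ℂ] LaurentPolynomial ℂ :=
  Ideal.Quotient.liftₐ _ (evalCyclic S μ) (by
    intro a ha
    obtain ⟨b, rfl⟩ := Ideal.mem_span_singleton'.1 ha
    rw [map_mul, map_sub, evalCyclic_cyclicH, AlgHom.commutes, sub_self, mul_zero])

theorem evalSubquotient_mk (S : Params m n α) (μ : ℂ) (a : cyclicSubalgebra α (L.poly α)) :
    evalSubquotient S μ (Ideal.Quotient.mk (cyclicIdeal α (L.poly α) μ) a) =
      evalRep S μ (a : Alg α (L.poly α)) := rfl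

/-! ### Generators of the cyclic subquotient -/

theorem mk_aeval_cyclicH (μ : ℂ) (f : ℂ[X]) :
    Ideal.Quotient.mk (cyclicIdeal α (L.poly α) μ) (aeval (cyclicH α (L.poly α)) f)
      = algebraMap ℂ _ (f.eval μ) := by
  have h : Ideal.Quotient.mk (cyclicIdeal α (L.poly α) μ) (cyclicH α (L.poly α))
      = algebraMap ℂ _ μ := by
    refine (Ideal.Quotient.mk_eq_mk_iff_sub_mem _ _).2 ?_
    exact Ideal.subset_span rfl
  refine (aeval_algHom_apply (Ideal.Quotient.mkₐ ℂ (cyclicIdeal α (L.poly α) μ)) _ f).symm.trans ?_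
  rw [Ideal.Quotient.mkₐ_eq_mk, h, aeval_algebraMap_apply]
  simp

variable {B : Type*} [Ring B]

/-- Elements of the cyclic subalgebra of the same degree have proportional images in a cyclic
subquotient. -/
theorem smul_mk_eq_smul_mk (G : Gauge α (L.poly α) B) (hG : Function.Injective G.hom) (μ : ℂ)
    {a b : cyclicSubalgebra α (L.poly α)} {d : ℤ × ℤ} {q r : ℂ[X]}
    (ha : G.hom a = G.mono d * G.poly q) (hb : G.hom b = G.mono d * G.poly r) :
    r.eval μ • Ideal.Quotient.mk (cyclicIdeal α (L.poly α) μ) a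
      = q.eval μ • Ideal.Quotient.mk (cyclicIdeal α (L.poly α) μ) b := by
  have h : a * aeval (cyclicH α (L.poly α)) r = b * aeval (cyclicH α (L.poly α)) q := by
    have e : ∀ f : ℂ[X], ((aeval (cyclicH α (L.poly α)) f : cyclicSubalgebra α (L.poly α)) :
        Alg α (L.poly α)) = aeval (elH α (L.poly α)) f := fun f =>
      (aeval_algHom_apply (cyclicSubalgebra α (L.poly α)).val _ f).symm
    refine Subtype.ext (hG ?_)
    rw [MulMemClass.coe_mul, MulMemClass.coe_mul, e, e, map_mul, map_mul, ha, hb]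
    change _ * G.poly q * G.poly r = _ * G.poly r * G.poly q
    rw [mul_assoc, mul_assoc, (G.poly_commute q r).eq]
  have h' := congrArg (Ideal.Quotient.mk (cyclicIdeal α (L.poly α) μ)) h
  rw [map_mul, map_mul, mk_aeval_cyclicH, mk_aeval_cyclicH, ← Algebra.commutes, ← Algebra.commutes,
    ← Algebra.smul_def, ← Algebra.smul_def] at h'
  exact h'

/-- In each degree `k • (m, n)` there is an element of the cyclic subalgebra whose polynomial does
not vanish at `μ`, and its image is that value times `c ^ k`. This says that `c` is the value of `C`
at `μ` and that all powers of `C` are regular there. -/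
def IsPeriodUnit (S : Params m n α) (μ : ℂ) (c : (CyclicSubquotient α (L.poly α) μ)ˣ) : Prop :=
  ∀ k : ℤ, ∃ (b : cyclicSubalgebra α (L.poly α)) (q : ℂ[X]),
    (L.fullGauge S).hom b
      = (L.fullGauge S).mono (k • ((m : ℤ), (n : ℤ))) * (L.fullGauge S).poly q ∧
    q.eval μ ≠ 0 ∧ Ideal.Quotient.mk (cyclicIdeal α (L.poly α) μ) b = q.eval μ • (c ^ k).val

/-- The walk around the cylinder and its reverse give elements of the cyclic subalgebra that are `C`
and `C⁻¹` up to polynomials that do not vanish at `x`; rescaled, their images are inverse units. -/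
theorem exists_unit (S : Params m n α) {x : ℤ × ℤ}
    (hx : L.Reach x (x + ((m : ℤ), (n : ℤ)))) :
    ∃ c : (CyclicSubquotient α (L.poly α) (faceValue α x))ˣ, IsPeriodUnit S (faceValue α x) c := by
  set G := L.fullGauge S
  set μ := faceValue α x
  set P : ℤ × ℤ := ((m : ℤ), (n : ℤ)) with hP
  set π := Ideal.Quotient.mk (cyclicIdeal α (L.poly α) μ)
  have hG : Function.Injective G.hom := fullGauge_injective S
  have hv : ∀ k : ℤ, faceValue α (k • P) = 0 := faceValue_zsmul_period S.hmnα
  have lift : ∀ k : ℤ, L.Reach x (x + k • P) → ∃ (b : cyclicSubalgebra α (L.poly α)) (q : ℂ[X]),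
      G.hom b = G.mono (k • P) * G.poly q ∧ q.eval μ ≠ 0 := by
    intro k hk
    obtain ⟨a, q, ha, hq⟩ := exists_of_reach S G hk
    rw [add_sub_cancel_left] at ha
    exact ⟨⟨a, G.mem_cyclicSubalgebra hG (hv k) ha⟩, q, ha, hq⟩
  obtain ⟨a₁, q₁, ha₁, hq₁⟩ := lift 1 (by rwa [one_smul])
  obtain ⟨a₂, q₂, ha₂, hq₂⟩ := lift (-1) (by
    have := hx.symm.translate (-1)
    rw [neg_one_zsmul, add_neg_cancel_right] at this
    rwa [neg_one_zsmul])
  have prod : ∀ {k l : ℤ} {a b : cyclicSubalgebra α (L.poly α)} {q r : ℂ[X]},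
      G.hom a = G.mono (k • P) * G.poly q → G.hom b = G.mono (l • P) * G.poly r →
      G.hom (a * b : cyclicSubalgebra α (L.poly α)) = G.mono ((k + l) • P) * G.poly (q * r) := by
    intro k l a b q r ha hb
    rw [MulMemClass.coe_mul, G.hom_mul ha hb, hv, taylor_zero, add_smul]
  have one : G.hom (1 : cyclicSubalgebra α (L.poly α)) = G.mono ((0 : ℤ) • P) * G.poly 1 := by
    rw [zero_smul, G.mono_zero, G.poly_one, OneMemClass.coe_one, map_one]; simp
  have h12 := smul_mk_eq_smul_mk G hG μ (prod ha₁ ha₂) one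
  have h21 := smul_mk_eq_smul_mk G hG μ (prod ha₂ ha₁) one
  rw [eval_one, one_smul, map_mul, eval_mul, map_one] at h12 h21
  refine ⟨⟨(q₁.eval μ)⁻¹ • π a₁, (q₂.eval μ)⁻¹ • π a₂, ?_, ?_⟩, ?_⟩
  · rw [smul_mul_smul_comm, h12, smul_smul]
    field_simp
    exact one_smul _ _
  · rw [smul_mul_smul_comm, h21, smul_smul]
    field_simp
    exact one_smul _ _
  · set c : (CyclicSubquotient α (L.poly α) μ)ˣ :=
      ⟨(q₁.eval μ)⁻¹ • π a₁, (q₂.eval μ)⁻¹ • π a₂, _, _⟩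
    have hc₁ : π a₁ = q₁.eval μ • (c : CyclicSubquotient α (L.poly α) μ) :=
      (smul_inv_smul₀ hq₁ (π a₁)).symm
    have hc₂ : π a₂ = q₂.eval μ • ((c⁻¹ : (CyclicSubquotient α (L.poly α) μ)ˣ) :
        CyclicSubquotient α (L.poly α) μ) := (smul_inv_smul₀ hq₂ (π a₂)).symm
    intro k
    induction k with
    | zero => exact ⟨1, 1, one, by simp, by simp⟩
    | succ k ih =>
      obtain ⟨b, q, hb, hq, hbc⟩ := ih
      refine ⟨b * a₁, q * q₁, prod hb ha₁, by rw [eval_mul]; exact mul_ne_zero hq hq₁, ?_⟩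
      change π (b * a₁) = _
      rw [map_mul, hbc, hc₁, smul_mul_smul_comm, zpow_add_one, Units.val_mul, eval_mul]
    | pred k ih =>
      obtain ⟨b, q, hb, hq, hbc⟩ := ih
      refine ⟨b * a₂, q * q₂, prod hb ha₂, by rw [eval_mul]; exact mul_ne_zero hq hq₂, ?_⟩
      change π (b * a₂) = _
      rw [map_mul, hbc, hc₂, smul_mul_smul_comm, zpow_sub_one, Units.val_mul, eval_mul]

namespace IsPeriodUnit

variable {S : Params m n α} {μ : ℂ} {c : (CyclicSubquotient α (L.poly α) μ)ˣ}

/-- The image of an element of the cyclic subalgebra is determined by its degree and the value of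
its polynomial at `μ`. -/
theorem mk_eq (hc : IsPeriodUnit S μ c) {k : ℤ} {b : cyclicSubalgebra α (L.poly α)} {r : ℂ[X]}
    (hb : (L.locGauge α).hom b
      = (L.locGauge α).mono (k • ((m : ℤ), (n : ℤ))) * (L.locGauge α).poly r) :
    Ideal.Quotient.mk (cyclicIdeal α (L.poly α) μ) b = r.eval μ • (c ^ k).val := by
  obtain ⟨a, q, ha, hq, hac⟩ := hc k
  have h := smul_mk_eq_smul_mk (L.locGauge α) locGauge_injective μ hb
    ((Gauge.prod_hom_eq_iff _ _ _ _ _).1 ha).1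
  rw [hac, smul_comm] at h
  exact (IsUnit.mk0 _ hq).smul_left_cancel.1 h

theorem isValueAt_iff (hc : IsPeriodUnit S μ c) (d : CyclicSubquotient α (L.poly α) μ) :
    IsValueAt α (L.poly α) μ (L.elC α m n) d ↔ d = c := by
  have hC := L.elC_eq_mono S.hm S.hn S.hmn S.hmnα
  constructor
  · rintro ⟨a, f, hf, hz, rfl⟩
    have ha : (L.locGauge α).hom a = (L.locGauge α).mono ((1 : ℤ) • ((m : ℤ), (n : ℤ))) *
        (L.locGauge α).poly f := by
      rw [one_smul, ← hC, hz, mul_assoc]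
      exact ((congrArg _ (invPoly_mul_toLoc _ _ f _)).trans (mul_one _)).symm
    rw [hc.mk_eq ha, zpow_one, inv_smul_smul₀ hf]
  · rintro rfl
    obtain ⟨a, q, ha, hq, hac⟩ := hc 1
    refine ⟨a, q, hq, ?_, by rw [hac, zpow_one, inv_smul_smul₀ hq]⟩
    have h := ((Gauge.prod_hom_eq_iff _ _ _ _ _).1 ha).1
    rw [one_smul] at h
    rw [hC, show toLoc α (L.poly α) a = _ from h, mul_assoc, locGauge_poly_mul_invPoly, mul_one]

theorem adjoin_eq_top (hc : IsPeriodUnit S μ c) :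
    Algebra.adjoin ℂ {(c : CyclicSubquotient α (L.poly α) μ), ↑c⁻¹} = ⊤ := by
  set G := L.fullGauge S
  have hG : Function.Injective G.hom := fullGauge_injective S
  set A := Algebra.adjoin ℂ {(c : CyclicSubquotient α (L.poly α) μ), ↑c⁻¹}
  have hc₁ : (c : CyclicSubquotient α (L.poly α) μ) ∈ A := Algebra.subset_adjoin (by simp)
  have hc₂ : ((c⁻¹ : (CyclicSubquotient α (L.poly α) μ)ˣ) :
    CyclicSubquotient α (L.poly α) μ) ∈ A := Algebra.subset_adjoin (by simp)
  have hpow : ∀ k : ℤ, (c ^ k).val ∈ A := by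
    intro k
    induction k with
    | zero => rw [zpow_zero]; exact one_mem A
    | succ k ih => rw [zpow_add_one, Units.val_mul]; exact mul_mem ih hc₁
    | pred k ih => rw [zpow_sub_one, Units.val_mul]; exact mul_mem ih hc₂
  set W : Submodule ℂ (Alg α (L.poly α)) := ((Subalgebra.toSubmodule A).comap
    (Ideal.Quotient.mkₐ ℂ (cyclicIdeal α (L.poly α) μ)).toLinearMap).map
      (cyclicSubalgebra α (L.poly α)).val.toLinearMap
  have hle : ⨆ k : ℤ, piece G (k • ((m : ℤ), (n : ℤ))) ≤ W := by
    refine iSup_le fun k a ha => ?_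
    obtain ⟨q, hq, -⟩ := ha
    refine ⟨⟨a, G.mem_cyclicSubalgebra hG (faceValue_zsmul_period S.hmnα k) hq⟩, ?_, rfl⟩
    change Ideal.Quotient.mk (cyclicIdeal α (L.poly α) μ) _ ∈ A
    rw [hc.mk_eq ((Gauge.prod_hom_eq_iff _ _ _ _ _).1 hq).1]
    exact A.smul_mem (hpow k) _
  refine eq_top_iff.2 fun y _ => ?_
  obtain ⟨⟨a, ha⟩, rfl⟩ := Ideal.Quotient.mk_surjective y
  obtain ⟨b, hb, hba⟩ := hle (mem_iSup_piece_of_commute S.hm S.hn S.hmn S.hα S.hmnα G hG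
    ((Subalgebra.mem_centralizer_iff ℂ).1 ha _ rfl))
  obtain rfl : b = ⟨a, ha⟩ := Subtype.ext hba
  exact hb

theorem evalSubquotient_zpow (hc : IsPeriodUnit S μ c) (k : ℤ) :
    evalSubquotient S μ (c ^ k).val = LaurentPolynomial.T k := by
  obtain ⟨b, q, hb, hq, hbc⟩ := hc k
  have h := congrArg (evalSubquotient S μ) hbc
  rw [evalSubquotient_mk, evalRep_of_hom_eq S μ hb, Algebra.smul_def (q.eval μ) (c ^ k).val,
    map_mul, AlgHom.commutes, ← Algebra.smul_def] at h
  exact ((IsUnit.mk0 _ hq).smul_left_cancel.1 h).symm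

theorem exists_laurent_equiv (hc : IsPeriodUnit S μ c) :
    ∃ e : LaurentPolynomial ℂ ≃ₐ[ℂ] CyclicSubquotient α (L.poly α) μ,
      e (LaurentPolynomial.T 1) = c := by
  set f : LaurentPolynomial ℂ →ₐ[ℂ] CyclicSubquotient α (L.poly α) μ :=
    AddMonoidAlgebra.lift ℂ (CyclicSubquotient α (L.poly α) μ) ℤ
      ((Units.coeHom _).comp (zpowersHom _ c)) with hf
  have hfT : ∀ k : ℤ, f (LaurentPolynomial.T k) = (c ^ k).val := by
    intro k
    refine (AddMonoidAlgebra.lift_single _ _ _).trans ?_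
    rw [one_smul]; rfl
  clear_value f
  have hρ : (evalSubquotient S μ).comp f = AlgHom.id ℂ _ := by
    refine AddMonoidAlgebra.algHom_ext (fun k => ?_) (Subsingleton.elim _ _)
    exact (congrArg (evalSubquotient S μ) (hfT k)).trans (hc.evalSubquotient_zpow k)
  have hinj : Function.Injective f := by
    intro p q h
    have h1 : ∀ p, evalSubquotient S μ (f p) = p := fun p => DFunLike.congr_fun hρ p
    rw [← h1 p, h, h1]
  have hT1 : f (LaurentPolynomial.T 1) = c := (hfT 1).trans (by rw [zpow_one])
  have hT2 : f (LaurentPolynomial.T (-1)) = (c⁻¹).val := (hfT (-1)).trans (by rw [zpow_neg_one])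
  have hsurj : Function.Surjective f := by
    rw [← AlgHom.range_eq_top, eq_top_iff, ← hc.adjoin_eq_top]
    refine Algebra.adjoin_le ?_
    rintro _ (rfl | rfl)
    · exact ⟨_, hT1⟩
    · exact ⟨_, hT2⟩
  exact ⟨AlgEquiv.ofBijective f ⟨hinj, hsurj⟩, hT1⟩

end IsPeriodUnit

end Config

namespace Config

variable {m n : ℕ} {L : Config m n} {α : Fin 2 → ℂ}

/-! ### Membership of `C` in the algebra -/

/-- The polynomials `f` for which `C f(H)` lies in the algebra. -/
def denomIdeal (L : Config m n) (α : Fin 2 → ℂ) : Ideal ℂ[X] where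
  carrier := {q | ∃ a, (L.locGauge α).hom a
    = (L.locGauge α).mono ((m : ℤ), (n : ℤ)) * (L.locGauge α).poly q}
  zero_mem' := ⟨0, by simp [Gauge.poly]⟩
  add_mem' := by
    rintro f g ⟨a, ha⟩ ⟨b, hb⟩
    exact ⟨a + b, by rw [map_add, ha, hb, Gauge.poly_add, mul_add]⟩
  smul_mem' := by
    rintro f g ⟨a, ha⟩
    refine ⟨a * aeval (elH α (L.poly α)) f, ?_⟩
    rw [map_mul, ha, smul_eq_mul, mul_comm f g, Gauge.poly_mul, mul_assoc]
    rfl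

/-- For a five-vertex configuration the ideal of denominators of `C` has no zeros: at a face there
is an element of the degree of `C` that does not vanish, and elsewhere the product of generators
along a path does not vanish. -/
theorem IsFiveVertex.exists_toLoc_eq (S : Params m n α) (h : L.IsFiveVertex) :
    ∃ a, toLoc α (L.poly α) a = L.elC α m n := by
  have key : ∀ μ : ℂ, ∃ q ∈ denomIdeal L α, q.eval μ ≠ 0 := by
    intro μ
    by_cases hμ : ∃ x, faceValue α x = μ
    · obtain ⟨x, rfl⟩ := hμ
      obtain ⟨a, q, ha, hq⟩ := exists_of_reach S (L.locGauge α) (h.reach_period S.hm S.hn x)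
      rw [add_sub_cancel_left] at ha
      exact ⟨q, ⟨a, ha⟩, hq⟩
    · set i : List (Fin 2) := List.replicate m 0 ++ List.replicate n 1 with hi
      have c0 : i.count 0 = m := by simp [hi, List.count_replicate]
      have c1 : i.count 1 = n := by simp [hi, List.count_replicate]
      refine ⟨facePoly m n α (L.vertCross i), ⟨L.pathX α i, ?_⟩, ?_⟩
      · rw [hom_pathX S.hm S.hmn S.hmnα, c0, c1]
      · rw [Ne, (L.isFaceMult_vertCross S.hm S.hmn i).eval_facePoly_eq_zero S.hmnα]
        rintro ⟨x, hx, -⟩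
        exact hμ ⟨x, hx⟩
  obtain ⟨g, hg⟩ := (IsPrincipalIdealRing.principal (denomIdeal L α)).principal
  have hg0 : g.degree = 0 := by
    by_contra hd
    obtain ⟨μ, hroot⟩ := IsAlgClosed.exists_root g hd
    obtain ⟨q, hq, hqμ⟩ := key μ
    rw [hg, Submodule.mem_span_singleton] at hq
    obtain ⟨r, rfl⟩ := hq
    exact hqμ (by rw [smul_eq_mul, eval_mul, hroot.eq_zero, mul_zero])
  have h1 : (1 : ℂ[X]) ∈ denomIdeal L α := by
    rw [hg, Submodule.mem_span_singleton]
    obtain ⟨u, hu⟩ := isUnit_iff_degree_eq_zero.2 hg0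
    exact ⟨(u⁻¹ : ℂ[X]ˣ), by rw [← hu, smul_eq_mul, Units.inv_mul]⟩
  obtain ⟨a, ha⟩ := h1
  rw [Gauge.poly_one, mul_one] at ha
  exact ⟨a, ha.trans (L.elC_eq_mono S.hm S.hn S.hmn S.hmnα).symm⟩

theorem coeff_T (k l : ℤ) :
    (LaurentPolynomial.T k : LaurentPolynomial ℂ).coeff l = if k = l then 1 else 0 :=
  Finsupp.single_apply

/-- If `C` lies in the algebra, then every face descends to its translate by the period: otherwise
no element of the degree of `C` would be non-zero at that face. -/
theorem desc_of_toLoc_eq (S : Params m n α) {a : Alg α (L.poly α)}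
    (ha : toLoc α (L.poly α) a = L.elC α m n) (y : ℤ × ℤ) :
    L.Desc y (y + ((m : ℤ), (n : ℤ))) := by
  set G := L.fullGauge S
  have hG : Function.Injective G.hom := fullGauge_injective S
  have hmono : G.hom a = G.mono ((m : ℤ), (n : ℤ)) :=
    (L.locGauge α).hom_eq_mono_of_injective G locGauge_injective m n
      (ha.trans (L.elC_eq_mono S.hm S.hn S.hmn S.hmnα))
  have hmono' : G.hom a = G.mono ((1 : ℤ) • ((m : ℤ), (n : ℤ))) * G.poly 1 := by
    rw [one_smul, G.poly_one, mul_one, hmono]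
  have hval := evalRep_of_hom_eq S (faceValue α y) hmono'
  rw [eval_one, one_smul] at hval
  have hmem := mem_iSup_piece_of_commute S.hm S.hn S.hmn S.hα S.hmnα G hG
    ((Subalgebra.mem_centralizer_iff ℂ).1
      (G.mem_cyclicSubalgebra hG (faceValue_zsmul_period S.hmnα 1) hmono') _ rfl)
  by_contra hcon
  have hzero : ∀ b ∈ ⨆ k : ℤ, piece G (k • ((m : ℤ), (n : ℤ))),
      (evalRep S (faceValue α y) b).coeff 1 = 0 := by
    intro b hb
    induction hb using Submodule.iSup_induction' with
    | mem k b hb =>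
      obtain ⟨q, hq, hdesc⟩ := hb
      rw [evalRep_of_hom_eq S _ hq]
      by_cases hk : k = 1
      · subst hk
        have : q.eval (faceValue α y) = 0 := by
          by_contra h
          exact hcon (by simpa using hdesc y h)
        simp [this]
      · rw [AddMonoidAlgebra.coeff_smul, Finsupp.smul_apply, coeff_T, if_neg hk, smul_zero]
    | zero => simp
    | add b c _ _ ihb ihc => simp [ihb, ihc]
  have := hzero a hmem
  rw [hval, coeff_T, if_pos rfl] at this
  exact one_ne_zero this

theorem exists_toLoc_eq_iff (S : Params m n α) :
    (∃ a, toLoc α (L.poly α) a = L.elC α m n) ↔ L.IsFiveVertex :=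
  ⟨fun ⟨_, ha⟩ => L.isFiveVertex_of_reach S.hm fun y =>
    (desc_of_toLoc_eq S ha y).reach_period S.hm S.hn, fun h => h.exists_toLoc_eq S⟩

theorem commute_elC (S : Params m n α) (a : Alg α (L.poly α)) :
    Commute (L.elC α m n) (toLoc α (L.poly α) a) := by
  rw [L.elC_eq_mono S.hm S.hn S.hmn S.hmnα]
  exact commute_mono_period S (L.locGauge α) a

theorem mem_center_of_toLoc_eq (S : Params m n α) {a : Alg α (L.poly α)}
    (ha : toLoc α (L.poly α) a = L.elC α m n) : a ∈ Subring.center (Alg α (L.poly α)) := by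
  rw [Subring.mem_center_iff]
  intro b
  refine toLoc_injective _ _ ?_
  rw [map_mul, map_mul, ha]
  exact (commute_elC S b).eq.symm

end Config

end KleinianFiber

end

open KleinianFiber KleinianFiber.Config

theorem mainTheorem7 (m n : ℕ) (hm : 0 < m) (hn : 0 < n) (hmn : m.Coprime n)
    (α : Fin 2 → ℂ) (hα : α ≠ 0) (hmnα : (m : ℂ) * α 0 + (n : ℂ) * α 1 = 0)
    (L : Config m n) :
    -- (a) `C_{k,l}` does not depend on the sequence
    (∀ (k l : ℕ), ∀ i ∈ Seq2 k l, L.pathC α i = L.elC α k l) ∧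
    -- (b) `C = C_{m,n}` is central in the localization; in particular it commutes with the algebra
    (L.elC α m n ∈ Subring.center (AlgLoc α (L.poly α)) ∧
      ∀ a : Alg α (L.poly α), Commute (L.elC α m n) (toLoc α (L.poly α) a)) ∧
    -- (c) at a face in an incontractible component, `C` has a unique image `c` in the cyclic
    -- subquotient, `c` is a unit, and `c`, `c⁻¹` generate the subquotient as a Laurent algebra
    (∀ x : ℤ × ℤ, L.InIncontractible x →
      ∃ c : (CyclicSubquotient α (L.poly α) (faceValue α x))ˣ,
        (∀ d, IsValueAt α (L.poly α) (faceValue α x) (L.elC α m n) d ↔ d = c) ∧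
        Algebra.adjoin ℂ {(c : CyclicSubquotient α (L.poly α) (faceValue α x)), ↑c⁻¹} = ⊤ ∧
        ∃ e : LaurentPolynomial ℂ ≃ₐ[ℂ] CyclicSubquotient α (L.poly α) (faceValue α x),
          e (LaurentPolynomial.T 1) = c) ∧
    -- (d) `C` lies in the algebra, equivalently in its center, iff `L` is a five-vertex
    -- configuration
    ((∃ a : Alg α (L.poly α), toLoc α (L.poly α) a = L.elC α m n) ↔ L.IsFiveVertex) ∧
    ((∃ a ∈ Subring.center (Alg α (L.poly α)), toLoc α (L.poly α) a = L.elC α m n) ↔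
      L.IsFiveVertex) := by
  obtain ⟨S⟩ := exists_params hm hn hmn hα hmnα
  refine ⟨?_, ⟨?_, commute_elC S⟩, ?_, exists_toLoc_eq_iff S, ?_⟩
  · rintro k l i ⟨h0, h1⟩
    exact pathC_eq_pathC hm hn hmn hmnα (by simp [h0, List.count_replicate])
      (by simp [h1, List.count_replicate])
  · exact commute_of_commute_toLoc _ _ _ (commute_elC S)
  · intro x hx
    obtain ⟨c, hc⟩ := exists_unit S (hx.reach_period hm hn)
    exact ⟨c, hc.isValueAt_iff, hc.adjoin_eq_top, hc.exists_laurent_equiv⟩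
  · rw [← exists_toLoc_eq_iff S]
    exact ⟨fun ⟨a, _, ha⟩ => ⟨a, ha⟩, fun ⟨a, ha⟩ => ⟨a, mem_center_of_toLoc_eq S ha, ha⟩⟩
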